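/- Let $k$ be a field, $G$ a finite group, $r\in G$ with conjugacy class $\mathcal C$ and centraliser $C_G$. For each $c\in\mathcal C$ choose $q_c\in G$ with $q_c r q_c^{-1}=c$, and put $\zeta_c(g)=q_{gcg^{-1}}^{-1}\,g\,q_c\in C_G$. Let $\pi:C_G\to GL_{\dim\pi}(k)$ be a representation by orthogonal matrices, $\pi(n)^T\pi(n)=1$ (for instance, $k=\mathbb C$ and $\pi$ an irreducible representation by real orthogonal matrices). Assume that $\mathcal C$ is stable under inversion and that the $q_c$ are compatible with inversion, in the sense that $\pi(\zeta_{c^{-1}}(g))=\pi(\zeta_c(g))$ for all $c\in\mathcal C$, $g\in G$ (which holds if $q_{c^{-1}}=q_c$ for all $c$, and in particular for every class of involutions). Below, the labels $a,b,c,d,f,g$ of generators run over $\mathcal C$ and $i,j,k,l,m,n,p,q$ over $1,\dots,\dim\pi$, repeated matrix indices are summed, and in $\pi(n)^i{}_j$ the row is $i$ and the column $j$. **Objects.** A $G$-crossed module is a $G$-graded $G$-module with $|h\triangleright v|=h|v|h^{-1}$; these form a braided category with $\Psi(v\otimes w)=|v|\triangleright w\otimes v$. * $\mathcal L_{\mathcal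 C,\pi}$ has basis $E_{ai}{}^{bj}=E_{ai}\otimes E^{bj}$ and is the crossed module with $h\triangleright E_{ai}=\pi(\zeta_a(h))^m{}_iE_{(hah^{-1})m}$, $h\triangleright E^{bj}=\pi(\zeta_b(h)^{-1})^j{}_nE^{(hbh^{-1})n}$, $|E_{ai}{}^{bj}|=ab^{-1}$; it has the matrix coalgebra $\Delta E_{ai}{}^{bj}=\sum_{c,k}E_{ai}{}^{ck}\otimes E_{ck}{}^{bj}$, $\epsilon(E_{ai}{}^{bj})=\delta_{a,b}\delta_{i,j}$, and the fundamental braiding $\tilde\Psi(E_{ai}{}^{bj}\otimes E_{ck}{}^{dl})=F\otimes(|F|^{-1}\triangleright E_{ai})\otimes E^{bj}$ with $F=b^{-1}\triangleright E_{ck}{}^{dl}$. $U(\mathcal L_{\mathcal C,\pi})$ is the tensor algebra of $\mathcal L_{\mathcal C,\pi}$ modulo the relations $\cdot\circ\tilde\Psi=\cdot$. * $A_{\mathcal C,\pi}$ is the FRT algebra with generators $t_{ai}{}^{bj}$ and relations $$\sum \mathcal R^{fp}{}_{ai}{}^{gq}{}_{ck}\,t_{fp}{}^{bj}t_{gq}{}^{dl}=\sum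 t_{ck}{}^{gq}t_{ai}{}^{fp}\,\mathcal R^{bj}{}_{fp}{}^{dl}{}_{gq},\qquad \mathcal R^{ai}{}_{bj}{}^{ck}{}_{dl}=\delta_{a,b}\,\delta_{c,ada^{-1}}\,\delta^i_j\,\pi(\zeta_d(a))^k{}_l ,$$ where $f,g$ run over $\mathcal C$ and $p,q$ over $1,\dots,\dim\pi$. * $D^\vee(G)$ has the algebra $k(G)\otimes kG$, $\Delta(\delta_g\otimes h)=\sum_f(\delta_f\otimes f^{-1}ghg^{-1}f)\otimes(\delta_{f^{-1}g}\otimes h)$, $\epsilon(\delta_g\otimes h)=\delta_{g,e}$, and coquasitriangular structure $\mathcal R(\delta_g\otimes h,\delta_u\otimes v)=\delta_{g,e}\delta_{h,u}$. $BD(G)$ is the same space with the coalgebra of $D^\vee(G)$, the algebra of $D(G)$, $(\delta_g\otimes h)(\delta_u\otimes v)=\delta_{g,huh^{-1}}\,\delta_g\otimes hv$, and the crossed module structure $f\triangleright(\delta_g\otimes h)=\delta_{fgf^{-1}}\otimes fhf^{-1}$, $|\delta_g\otimes h|=gh^{-1}g^{-1}h$. Put $r_{ai}{}^{bj}=\sum_{n\in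 C_G}\pi(n)^j{}_i\,\delta_{q_an^{-1}q_b^{-1}}\otimes b^{-1}$. **Statement.** 1. $U(\mathcal L_{\mathcal C,\pi})$ is a braided bialgebra in the category of $G$-crossed modules, with structure extending that of $\mathcal L_{\mathcal C,\pi}$; $E_{ai}{}^{bj}\mapsto r_{ai}{}^{bj}$ extends to a map of braided bialgebras $U(\mathcal L_{\mathcal C,\pi})\to BD(G)$; and there is a unique unital braided anti-algebra map $\underline S:U(\mathcal L_{\mathcal C,\pi})\to U(\mathcal L_{\mathcal C,\pi})$ (a crossed module map with $\underline S(1)=1$, $\underline S\circ\cdot=\cdot\circ\Psi\circ(\underline S\otimes\underline S)$) such that $$\underline S E_{ai}{}^{bj}=\sum_k\pi\big(\zeta_b(ab^{-1})^{-1}\big)^j{}_k\;E_{(ab^{-1}a^{-1})k}{}^{a^{-1}i}.$$ 2. The quotient algebra $$B_{\mathcal C,\pi}=U(\mathcal L_{\mathcal C,\pi})\Big/\Big\langle \sum_{c,k}E_{ai}{}^{ck}\,\underline SE_{ck}{}^{bj}-\delta_{a,b}\delta_{i,j},\ \sum_{c,k}(\underline SE_{ai}{}^{ck})E_{ck}{}^{bj}-\delta_{a,b}\delta_{i,j}\Big\rangle$$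 inherits from $U(\mathcal L_{\mathcal C,\pi})$ the structure of a braided Hopf algebra in the category of $G$-crossed modules, with invertible antipode induced by $\underline S$, and the map $U(\mathcal L_{\mathcal C,\pi})\to BD(G)$ factors through a map of braided bialgebras $B_{\mathcal C,\pi}\to BD(G)$. 3. $A_{\mathcal C,\pi}$ is a coquasitriangular bialgebra with the matrix coalgebra structure on the $t_{ai}{}^{bj}$ and $\mathcal R(t_{ai}{}^{bj}\otimes t_{ck}{}^{dl})=\mathcal R^{bj}{}_{ai}{}^{dl}{}_{ck}$, and $t_{ai}{}^{bj}\mapsto r_{ai}{}^{bj}$ extends to a map of coquasitriangular bialgebras $A_{\mathcal C,\pi}\to D^\vee(G)$. With $St_{ai}{}^{bj}:=t_{b^{-1}j}{}^{a^{-1}i}$, the quotient algebra $$H_{\mathcal C,\pi}=A_{\mathcal C,\pi}\Big/\Big\langle \sum_{c,k}t_{ai}{}^{ck}\,St_{ck}{}^{bj}-\delta_{a,b}\delta_{i,j},\ \sum_{c,k}(St_{ai}{}^{ck})t_{ck}{}^{bj}-\delta_{a,b}\delta_{i,j}\Big\rangle$$ inherits from $A_{\mathcal C,\pi}$ the structure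 of a coquasitriangular Hopf algebra, whose antipode is $S$ on the generators, and the map $A_{\mathcal C,\pi}\to D^\vee(G)$ factors through a map of coquasitriangular bialgebras $H_{\mathcal C,\pi}\to D^\vee(G)$. 4. $B_{\mathcal C,\pi}$ is the comodule transmutation of $H_{\mathcal C,\pi}$: there is a linear isomorphism $\Phi:B_{\mathcal C,\pi}\to H_{\mathcal C,\pi}$ with $\Phi(E_{ai}{}^{bj})=t_{ai}{}^{bj}$ which is an isomorphism of braided bialgebras onto the space $H=H_{\mathcal C,\pi}$ with its coalgebra structure and unit, the product $x\,\underline\cdot\,y=x_2y_2\,\mathcal R\big((Sx_1)x_3\otimes Sy_1\big)$, and the $G$-crossed module structure corresponding to the right adjoint coaction $x\mapsto x_2\otimes(Sx_1)x_3$ pushed forward along $H\to D^\vee(G)$ (a crossed module $V$ has the right $D^\vee(G)$-coaction $v\mapsto\sum_g g\triangleright v\otimes\delta_g\otimes|v|$). -/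

import Mathlib

open scoped TensorProduct

noncomputable section

namespace QDouble

/-! ### Braided bialgebras in the category of `G`-crossed modules -/

/-- The structure maps of a bialgebra in the category of `G`-crossed modules on a `k`-vector
space `V`. The `G`-grading of `V` is recorded by its projections: `proj g` is the projection of
`V` onto the component of grade `g`. -/
structure BraidedData (k G V : Type*) [Field k] [AddCommGroup V] [Module k V] where
  act : G → V →ₗ[k] V
  proj : G → V →ₗ[k] V
  mul : V →ₗ[k] V →ₗ[k] V
  one : V
  comul : V →ₗ[k] V ⊗[k] V
  counit : V →ₗ[k] k

section Braided

variable {k G V W : Type*} [Field k] [Group G] [Fintype G] [DecidableEq G]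
  [AddCommGroup V] [Module k V] [AddCommGroup W] [Module k W]

/-- `V` is a (Whitehead) `G`-crossed module: a `G`-module with a `G`-grading such that
`|h ▷ v| = h |v| h⁻¹`. -/
structure IsCrossedModule (X : BraidedData k G V) : Prop where
  act_one : X.act 1 = LinearMap.id
  act_mul : ∀ g h, X.act (g * h) = X.act g ∘ₗ X.act h
  proj_proj : ∀ g h, X.proj g ∘ₗ X.proj h = if g = h then X.proj g else 0
  sum_proj : ∑ g, X.proj g = LinearMap.id
  act_proj : ∀ h g, X.act h ∘ₗ X.proj g = X.proj (h * g * h⁻¹) ∘ₗ X.act h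

/-- The braiding `Ψ(v ⊗ w) = (|v| ▷ w) ⊗ v` of `G`-crossed modules. -/
def BraidedData.braiding (X : BraidedData k G V) : V ⊗[k] V →ₗ[k] V ⊗[k] V :=
  (∑ g, TensorProduct.map (X.act g) (X.proj g)) ∘ₗ (TensorProduct.comm k V V).toLinearMap

/-- The product of the braided tensor product algebra `V ⊗ V`:
`(a ⊗ b)(c ⊗ d) = a (|b| ▷ c) ⊗ b d`. -/
def BraidedData.tensorMul (X : BraidedData k G V) :
    V ⊗[k] V →ₗ[k] V ⊗[k] V →ₗ[k] V ⊗[k] V :=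
  ∑ g, TensorProduct.map₂ (X.mul.compl₂ (X.act g)) (X.mul ∘ₗ X.proj g)

/-- `X` is a bialgebra in the braided category of `G`-crossed modules: an algebra and a coalgebra
whose structure maps are morphisms (tensor products carry the diagonal action and the product
grading, the unit object is `k` with trivial action and grade `1`), such that the coproduct and
the counit are algebra maps, the coproduct with respect to the braided tensor product algebra. -/
structure IsBraidedBialgebra (X : BraidedData k G V) : Prop extends IsCrossedModule X where
  mul_assoc : ∀ x y z, X.mul (X.mul x y) z = X.mul x (X.mul y z)
  one_mul : ∀ x, X.mul X.one x = x
  mul_one : ∀ x, X.mul x X.one = x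
  coassoc : (TensorProduct.assoc k V V V).toLinearMap ∘ₗ X.comul.rTensor V ∘ₗ X.comul =
    X.comul.lTensor V ∘ₗ X.comul
  counit_comul : ∀ x, TensorProduct.lid k V (X.counit.rTensor V (X.comul x)) = x
  comul_counit : ∀ x, TensorProduct.rid k V (X.counit.lTensor V (X.comul x)) = x
  act_mul_map : ∀ g x y, X.act g (X.mul x y) = X.mul (X.act g x) (X.act g y)
  proj_mul_map : ∀ g x y,
    X.proj g (X.mul x y) = ∑ f, X.mul (X.proj f x) (X.proj (f⁻¹ * g) y)
  act_one_map : ∀ g, X.act g X.one = X.one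
  proj_one_map : X.proj 1 X.one = X.one
  comul_act : ∀ g x, X.comul (X.act g x) = TensorProduct.map (X.act g) (X.act g) (X.comul x)
  comul_proj : ∀ g x,
    X.comul (X.proj g x) = ∑ f, TensorProduct.map (X.proj f) (X.proj (f⁻¹ * g)) (X.comul x)
  counit_act : ∀ g x, X.counit (X.act g x) = X.counit x
  counit_proj : ∀ g x, X.counit (X.proj g x) = if g = 1 then X.counit x else 0
  comul_mul : ∀ x y, X.comul (X.mul x y) = X.tensorMul (X.comul x) (X.comul y)
  comul_one : X.comul X.one = X.one ⊗ₜ[k] X.one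
  counit_mul : ∀ x y, X.counit (X.mul x y) = X.counit x * X.counit y
  counit_one : X.counit X.one = 1

/-- `S` is an endomorphism of the underlying `G`-crossed module. -/
structure IsCrossedEnd (X : BraidedData k G V) (S : V →ₗ[k] V) : Prop where
  map_act : ∀ g x, S (X.act g x) = X.act g (S x)
  map_proj : ∀ g x, S (X.proj g x) = X.proj g (S x)

/-- `S` is a braided antipode: a morphism of `G`-crossed modules with
`(S x₁) x₂ = ε(x) 1 = x₁ (S x₂)`. A braided bialgebra with an antipode is a braided Hopf
algebra. -/
structure IsBraidedAntipode (X : BraidedData k G V) (S : V →ₗ[k] V) : Prop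
    extends IsCrossedEnd X S where
  antipode_left : ∀ x, TensorProduct.lift X.mul (S.rTensor V (X.comul x)) = X.counit x • X.one
  antipode_right : ∀ x, TensorProduct.lift X.mul (S.lTensor V (X.comul x)) = X.counit x • X.one

/-- `S` is a unital braided anti-algebra map: a morphism of `G`-crossed modules with `S 1 = 1`
and `S ∘ · = · ∘ Ψ ∘ (S ⊗ S)`. -/
structure IsBraidedAntiAlgMap (X : BraidedData k G V) (S : V →ₗ[k] V) : Prop
    extends IsCrossedEnd X S where
  map_one : S X.one = X.one
  map_mul : ∀ x y, S (X.mul x y) = TensorProduct.lift X.mul (X.braiding (S x ⊗ₜ[k] S y))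

/-- `f` is a map of braided bialgebras in the category of `G`-crossed modules. -/
structure IsBraidedMap (X : BraidedData k G V) (Y : BraidedData k G W) (f : V →ₗ[k] W) :
    Prop where
  map_act : ∀ g x, f (X.act g x) = Y.act g (f x)
  map_proj : ∀ g x, f (X.proj g x) = Y.proj g (f x)
  map_mul : ∀ x y, f (X.mul x y) = Y.mul (f x) (f y)
  map_one : f X.one = Y.one
  map_comul : ∀ x, Y.comul (f x) = TensorProduct.map f f (X.comul x)
  map_counit : ∀ x, Y.counit (f x) = X.counit x

end Braided

/-! ### Coquasitriangular Hopf algebras -/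

/-- A coproduct, a counit and a bilinear form `R` on an algebra `A`. -/
structure CoquasiData (k A : Type*) [Field k] [Ring A] [Algebra k A] where
  comul : A →ₗ[k] A ⊗[k] A
  counit : A →ₗ[k] k
  R : A →ₗ[k] A →ₗ[k] k

section Coquasi

variable {k A A' : Type*} [Field k] [Ring A] [Algebra k A] [Ring A'] [Algebra k A']

/-- `a, b ↦ (a₁ ⊗ b₁) ⊗ (a₂ ⊗ b₂)`. -/
def CoquasiData.comul₂ (X : CoquasiData k A) (a b : A) : (A ⊗[k] A) ⊗[k] (A ⊗[k] A) :=
  TensorProduct.tensorTensorTensorComm k A A A A (X.comul a ⊗ₜ[k] X.comul b)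

/-- The convolution product `a, b ↦ φ(a₁, b₁) ψ(a₂, b₂)` of bilinear forms. -/
def CoquasiData.conv (X : CoquasiData k A) (φ ψ : A →ₗ[k] A →ₗ[k] k) (a b : A) : k :=
  TensorProduct.lid k k
    (TensorProduct.map (TensorProduct.lift φ) (TensorProduct.lift ψ) (X.comul₂ a b))

/-- `X` is a coquasitriangular bialgebra structure on the algebra `A`. -/
structure IsCoquasiBialgebra (X : CoquasiData k A) : Prop where
  coassoc : (TensorProduct.assoc k A A A).toLinearMap ∘ₗ X.comul.rTensor A ∘ₗ X.comul =
    X.comul.lTensor A ∘ₗ X.comul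
  counit_comul : ∀ x, TensorProduct.lid k A (X.counit.rTensor A (X.comul x)) = x
  comul_counit : ∀ x, TensorProduct.rid k A (X.counit.lTensor A (X.comul x)) = x
  comul_mul : ∀ x y, X.comul (x * y) = X.comul x * X.comul y
  comul_one : X.comul 1 = 1
  counit_mul : ∀ x y, X.counit (x * y) = X.counit x * X.counit y
  counit_one : X.counit 1 = 1
  /-- `R` is invertible for the convolution product -/
  invertible : ∃ R' : A →ₗ[k] A →ₗ[k] k, ∀ a b,
    X.conv X.R R' a b = X.counit a * X.counit b ∧ X.conv R' X.R a b = X.counit a * X.counit b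
  /-- `R(ab ⊗ c) = R(a ⊗ c₁) R(b ⊗ c₂)` -/
  R_mul_left : ∀ a b c,
    X.R (a * b) c = TensorProduct.lid k k (TensorProduct.map (X.R a) (X.R b) (X.comul c))
  /-- `R(a ⊗ bc) = R(a₁ ⊗ c) R(a₂ ⊗ b)` -/
  R_mul_right : ∀ a b c,
    X.R a (b * c) =
      TensorProduct.lid k k (TensorProduct.map (X.R.flip c) (X.R.flip b) (X.comul a))
  /-- `R(a₁ ⊗ b₁) a₂ b₂ = b₁ a₁ R(a₂ ⊗ b₂)` -/
  quasi_comm : ∀ a b,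
    TensorProduct.lid k A (TensorProduct.map (TensorProduct.lift X.R)
        (TensorProduct.lift (LinearMap.mul k A)) (X.comul₂ a b)) =
      TensorProduct.rid k A (TensorProduct.map (TensorProduct.lift (LinearMap.mul k A).flip)
        (TensorProduct.lift X.R) (X.comul₂ a b))

/-- `S` is an antipode: `(S x₁) x₂ = ε(x) 1 = x₁ (S x₂)`. -/
structure IsAntipode (X : CoquasiData k A) (S : A →ₗ[k] A) : Prop where
  antipode_left : ∀ x,
    TensorProduct.lift (LinearMap.mul k A) (S.rTensor A (X.comul x)) = X.counit x • (1 : A)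
  antipode_right : ∀ x,
    TensorProduct.lift (LinearMap.mul k A) (S.lTensor A (X.comul x)) = X.counit x • (1 : A)

/-- `f` is a map of coquasitriangular bialgebras. -/
structure IsCoquasiMap (X : CoquasiData k A) (Y : CoquasiData k A') (f : A →ₐ[k] A') :
    Prop where
  map_comul : ∀ x, Y.comul (f x) = TensorProduct.map f.toLinearMap f.toLinearMap (X.comul x)
  map_counit : ∀ x, Y.counit (f x) = X.counit x
  map_R : ∀ x y, Y.R (f x) (f y) = X.R x y

/-- The right adjoint coaction `Ad_R(x) = x₂ ⊗ (S x₁) x₃`. -/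
def CoquasiData.adR (X : CoquasiData k A) (S : A →ₗ[k] A) : A →ₗ[k] A ⊗[k] A :=
  (TensorProduct.lift (LinearMap.mul k A) ∘ₗ S.rTensor A).lTensor A ∘ₗ
    (TensorProduct.leftComm k A A A).toLinearMap ∘ₗ X.comul.lTensor A ∘ₗ X.comul

/-- The product of the comodule transmutation:
`x • y = x₂ y₂ R((S x₁) x₃ ⊗ S y₁)`. -/
def CoquasiData.transMul (X : CoquasiData k A) (S : A →ₗ[k] A) : A →ₗ[k] A →ₗ[k] A :=
  ((TensorProduct.map₂ (LinearMap.mul k A) (X.R.compl₂ S)).compr₂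
      (TensorProduct.rid k A).toLinearMap).compl₁₂
    (X.adR S) ((TensorProduct.comm k A A).toLinearMap ∘ₗ X.comul)

end Coquasi

/-! ### The dual `D^∨(G)` of the quantum double and its transmutation `BD(G)` -/

section Double

variable (k G : Type*) [Field k] [Group G] [Fintype G] [DecidableEq G]

/-- `D^∨(G)` has the tensor product algebra `k(G) ⊗ kG`, that is, functions on `G` with values in
the group algebra. -/
abbrev DV := G → MonoidAlgebra k G

variable {k G}

/-- The basis element `δ_g ⊗ h`. -/
def dl (g h : G) : DV k G := Pi.single g (MonoidAlgebra.single h 1)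

/-- The coefficient of `δ_g ⊗ h`. -/
def coord (g h : G) : DV k G →ₗ[k] k :=
  Finsupp.lapply h ∘ₗ (MonoidAlgebra.coeffLinearEquiv k).toLinearMap ∘ₗ LinearMap.proj g

/-- The linear map with `δ_g ⊗ h ↦ F g h`. -/
def onBasis {V : Type*} [AddCommGroup V] [Module k V] (F : G → G → V) : DV k G →ₗ[k] V :=
  ∑ g, ∑ h, (coord g h).smulRight (F g h)

variable (k G)

/-- The coquasitriangular structure of `D^∨(G)`:
`Δ(δ_g ⊗ h) = ∑_f (δ_f ⊗ f⁻¹ghg⁻¹f) ⊗ (δ_{f⁻¹g} ⊗ h)`, `ε(δ_g ⊗ h) = δ_{g,e}`,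
`R(δ_g ⊗ h, δ_u ⊗ v) = δ_{g,e} δ_{h,u}`. -/
def DVdata : CoquasiData k (DV k G) where
  comul := onBasis fun g h =>
    ∑ f, dl f (f⁻¹ * g * h * g⁻¹ * f) ⊗ₜ[k] dl (f⁻¹ * g) h
  counit := onBasis fun g _ => if g = 1 then 1 else 0
  R := onBasis fun g h => onBasis fun u _ => if g = 1 ∧ h = u then 1 else 0

/-- The braided Hopf algebra `BD(G)`, on the vector space of `D^∨(G)`: it has the coalgebra of
`D^∨(G)`, the algebra of `D(G)`, namely
`(δ_g ⊗ h)(δ_u ⊗ v) = δ_{g, huh⁻¹} δ_g ⊗ hv`, and the crossed module structure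
`f ▷ (δ_g ⊗ h) = δ_{fgf⁻¹} ⊗ fhf⁻¹`, `|δ_g ⊗ h| = gh⁻¹g⁻¹h`. -/
def BD : BraidedData k G (DV k G) where
  act f := onBasis fun g h => dl (f * g * f⁻¹) (f * h * f⁻¹)
  proj f := onBasis fun g h => if g * h⁻¹ * g⁻¹ * h = f then dl g h else 0
  mul := onBasis fun g h => onBasis fun u v => if g = h * u * h⁻¹ then dl g (h * v) else 0
  one := ∑ g, dl g 1
  comul := (DVdata k G).comul
  counit := (DVdata k G).counit

variable {k G}

/-- The comodule transmutation of a coquasitriangular Hopf algebra `A`, regarded in the category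
of `G`-crossed modules along a map `p : A → D^∨(G)`. It has the coalgebra of `A`, the transmuted
product, and the crossed module structure given by the coaction `(id ⊗ p) Ad_R`, where a crossed
module has the right `D^∨(G)`-coaction `v ↦ ∑_g g ▷ v ⊗ (δ_g ⊗ |v|)`. -/
def transmutation {A : Type*} [Ring A] [Algebra k A] (X : CoquasiData k A) (S : A →ₗ[k] A)
    (p : A →ₐ[k] DV k G) : BraidedData k G A where
  act g := (TensorProduct.rid k A).toLinearMap ∘ₗ
    ((∑ h, coord g h) ∘ₗ p.toLinearMap).lTensor A ∘ₗ X.adR S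
  proj f := (TensorProduct.rid k A).toLinearMap ∘ₗ
    (coord 1 f ∘ₗ p.toLinearMap).lTensor A ∘ₗ X.adR S
  mul := X.transMul S
  one := 1
  comul := X.comul
  counit := X.counit

end Double

/-! ### The block of a conjugacy class and a representation of the centraliser -/

/-- A conjugacy class with a base point `r`, a choice of `q_c` with `q_c r q_c⁻¹ = c` for each
`c` in the class, and a matrix representation `π` of the centraliser of `r`. -/
structure Block (k G : Type*) [Field k] [Group G] where
  r : G
  q : {c : G // IsConj r c} → G
  q_conj : ∀ c, q c * r * (q c)⁻¹ = c
  d : ℕ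
  π : Subgroup.centralizer {r} →* Matrix (Fin d) (Fin d) k

namespace Block

variable {k G : Type*} [Field k] [Group G] (D : Block k G)

/-- The conjugacy class. -/
abbrev Cls := {c : G // IsConj D.r c}

/-- The centraliser `C_G` of `r`. -/
abbrev CG := Subgroup.centralizer {D.r}

/-- Labels `(a, i)` of the basis of `V_{𝒞,π}`. -/
abbrev Idx := D.Cls × Fin D.d

/-- `c ↦ g c g⁻¹` on the conjugacy class. -/
def conj (g : G) (c : D.Cls) : D.Cls :=
  ⟨g * c * g⁻¹, c.2.trans (isConj_iff.2 ⟨g, rfl⟩)⟩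

theorem zeta_mem (c : D.Cls) (g : G) : (D.q (D.conj g c))⁻¹ * g * D.q c ∈ D.CG := by
  have h1 : D.q (D.conj g c) * D.r * (D.q (D.conj g c))⁻¹ = g * c * g⁻¹ := D.q_conj _
  have h2 : D.q c * D.r * (D.q c)⁻¹ = c := D.q_conj c
  rw [Subgroup.mem_centralizer_singleton_iff]
  rw [← h2] at h1
  have h3 : D.q (D.conj g c) * D.r =
      g * (D.q c * D.r * (D.q c)⁻¹) * g⁻¹ * D.q (D.conj g c) := by
    rw [← h1]; group
  calc (D.q (D.conj g c))⁻¹ * g * D.q c * D.r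
      = (D.q (D.conj g c))⁻¹ * (g * (D.q c * D.r * (D.q c)⁻¹) * g⁻¹ * D.q (D.conj g c)) *
        (D.q (D.conj g c))⁻¹ * g * D.q c := by group
    _ = D.r * ((D.q (D.conj g c))⁻¹ * g * D.q c) := by rw [← h3]; group

/-- The cocycle `ζ_c(g) = q_{gcg⁻¹}⁻¹ g q_c` with values in `C_G`. -/
def zeta (c : D.Cls) (g : G) : D.CG := ⟨(D.q (D.conj g c))⁻¹ * g * D.q c, D.zeta_mem c g⟩

/-- The class is stable under inversion. -/
def InvStable : Prop := ∀ c, IsConj D.r c → IsConj D.r c⁻¹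

/-- The matrices `π(n)` are orthogonal, `π(n)ᵀ π(n) = 1`. For `k = ℂ` this holds in particular if
they are real orthogonal. -/
def IsOrthogonal : Prop := ∀ n, (D.π n).transpose * D.π n = 1

variable {D} in
/-- `c ↦ c⁻¹` on a class which is stable under inversion. -/
def InvStable.inv (hC : D.InvStable) (c : D.Cls) : D.Cls := ⟨(c : G)⁻¹, hC c c.2⟩

variable {D} in
/-- The representatives are chosen compatibly with inversion on the class, as seen by `π`. This
holds if `q_{c⁻¹} = q_c`, and in particular if `c⁻¹ = c`. -/
def InvStable.Compatible (hC : D.InvStable) : Prop :=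
  ∀ c g, D.π (D.zeta (hC.inv c) g) = D.π (D.zeta c g)

section Families

variable [Fintype G] [DecidableEq G] {A : Type*} [AddCommGroup A] [Module k A] (e : D.Idx → D.Idx → A)

/-- For `e x y = E_x{}^y = E_x ⊗ E^y`, the element
`g ▷ E_{ai}{}^{bj} = ∑ π(ζ_a(g))^m_i π(ζ_b(g)⁻¹)^j_n E_{(gag⁻¹)m}{}^{(gbg⁻¹)n}`. -/
def actGen (g : G) (x y : D.Idx) : A :=
  ∑ m, ∑ n, (D.π (D.zeta x.1 g) m x.2 * D.π (D.zeta y.1 g)⁻¹ y.2 n) •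
    e (D.conj g x.1, m) (D.conj g y.1, n)

/-- The element `(g ▷ E_{ai}) ⊗ E^{bj}`. -/
def actLow (g : G) (x y : D.Idx) : A :=
  ∑ m, D.π (D.zeta x.1 g) m x.2 • e (D.conj g x.1, m) y

variable {D} in
/-- The element `∑_k π(ζ_b(ab⁻¹)⁻¹)_j^k E_{(ab⁻¹a⁻¹)k}{}^{a⁻¹i}`, the value of the braided
antipode on `E_{ai}{}^{bj}`. -/
def InvStable.brAntipodeGen (hC : D.InvStable) (x y : D.Idx) : A :=
  ∑ m, D.π (D.zeta y.1 (x.1 * (y.1 : G)⁻¹))⁻¹ y.2 m •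
    e (D.conj x.1 (hC.inv y.1), m) (hC.inv x.1, x.2)

variable {D} in
/-- The element `t_{b⁻¹j}{}^{a⁻¹i}`, the value of the antipode on `t_{ai}{}^{bj}`. -/
def InvStable.antipodeGen (hC : D.InvStable) (x y : D.Idx) : A :=
  e (hC.inv y.1, y.2) (hC.inv x.1, x.2)

end Families

variable [Fintype G] [DecidableEq G]

instance : Fintype D.CG := Fintype.ofFinite _

/-- `r_{ai}{}^{bj} = ∑_{n ∈ C_G} π(n)^j_i δ_{q_a n⁻¹ q_b⁻¹} ⊗ b⁻¹`. -/
def rGen (x y : D.Idx) : DV k G :=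
  ∑ n : D.CG, D.π n y.2 x.2 • dl (D.q x.1 * (n : G)⁻¹ * (D.q y.1)⁻¹) (y.1 : G)⁻¹

/-- The generators of the tensor algebra of `𝓛_{𝒞,π} = End(V_{𝒞,π})`, taken as the free algebra
on the basis `E_x{}^y`. -/
def genT (x y : D.Idx) : FreeAlgebra k (D.Idx × D.Idx) := FreeAlgebra.ι k (x, y)

/-- The relations `· ∘ Ψ̃ = ·` for the fundamental braiding
`Ψ̃(E_{ai}{}^{bj} ⊗ E_{ck}{}^{dl}) = F ⊗ ((|F|⁻¹ ▷ E_{ai}) ⊗ E^{bj})`, where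
`F = b⁻¹ ▷ E_{ck}{}^{dl}`, which has grade `|F| = b⁻¹cd⁻¹b`. -/
inductive URel : FreeAlgebra k (D.Idx × D.Idx) → FreeAlgebra k (D.Idx × D.Idx) → Prop
  | mk (x y z w : D.Idx) : URel
      (D.actGen D.genT (y.1 : G)⁻¹ z w *
        D.actLow D.genT ((y.1 : G)⁻¹ * w.1 * (z.1 : G)⁻¹ * y.1) x y)
      (D.genT x y * D.genT z w)

/-- The braided enveloping algebra `U(𝓛_{𝒞,π})`. -/
abbrev U := RingQuot D.URel

/-- The generators `E_{ai}{}^{bj}` of `U(𝓛_{𝒞,π})`. -/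
def E (x y : D.Idx) : D.U := RingQuot.mkAlgHom k D.URel (D.genT x y)

/-- The matrix `R^{ai}_{bj}{}^{ck}_{dl} = δ_{a,b} δ_{c,ada⁻¹} δ^i_j π(ζ_d(a))^k_l`. -/
def Rmat (x y z w : D.Idx) : k :=
  if x = y ∧ z.1 = D.conj x.1 w.1 then D.π (D.zeta w.1 x.1) z.2 w.2 else 0

/-- The FRT relations `∑ R^f_x{}^g_z t_f{}^y t_g{}^w = ∑ t_z{}^g t_x{}^f R^y_f{}^w_g`. -/
inductive ARel : FreeAlgebra k (D.Idx × D.Idx) → FreeAlgebra k (D.Idx × D.Idx) → Prop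
  | mk (x y z w : D.Idx) : ARel
      (∑ f, ∑ g, D.Rmat f x g z • (D.genT f y * D.genT g w))
      (∑ f, ∑ g, D.Rmat y f w g • (D.genT z g * D.genT x f))

/-- The FRT bialgebra `A_{𝒞,π}`. -/
abbrev A := RingQuot D.ARel

/-- The generators `t_{ai}{}^{bj}` of `A_{𝒞,π}`. -/
def t (x y : D.Idx) : D.A := RingQuot.mkAlgHom k D.ARel (D.genT x y)

variable {D}

/-- The antipode relations imposed on `U(𝓛_{𝒞,π})`. -/
inductive InvStable.BRel (hC : D.InvStable) : D.U → D.U → Prop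
  | right (x y : D.Idx) : BRel hC
      (∑ z, D.E x z * hC.brAntipodeGen D.E z y) (if x = y then 1 else 0)
  | left (x y : D.Idx) : BRel hC
      (∑ z, hC.brAntipodeGen D.E x z * D.E z y) (if x = y then 1 else 0)

/-- The quotient `B_{𝒞,π}` of `U(𝓛_{𝒞,π})`. -/
abbrev InvStable.B (hC : D.InvStable) := RingQuot hC.BRel

/-- The projection `U(𝓛_{𝒞,π}) → B_{𝒞,π}`. -/
def InvStable.mkB (hC : D.InvStable) : D.U →ₐ[k] hC.B := RingQuot.mkAlgHom k hC.BRel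

/-- The antipode relations imposed on `A_{𝒞,π}`. -/
inductive InvStable.HRel (hC : D.InvStable) : D.A → D.A → Prop
  | right (x y : D.Idx) : HRel hC
      (∑ z, D.t x z * hC.antipodeGen D.t z y) (if x = y then 1 else 0)
  | left (x y : D.Idx) : HRel hC
      (∑ z, hC.antipodeGen D.t x z * D.t z y) (if x = y then 1 else 0)

/-- The quotient `H_{𝒞,π}` of `A_{𝒞,π}`. -/
abbrev InvStable.H (hC : D.InvStable) := RingQuot hC.HRel

/-- The projection `A_{𝒞,π} → H_{𝒞,π}`. -/
def InvStable.mkH (hC : D.InvStable) : D.A →ₐ[k] hC.H := RingQuot.mkAlgHom k hC.HRel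

variable (D)

/-- `X` is a braided bialgebra on the algebra `A` in the category of `G`-crossed modules, which on
the elements `e x y = E_x{}^y` has the crossed module structure of `End(V_{𝒞,π})` and the matrix
coalgebra structure. If the `e x y` generate `A`, then there is at most one such `X`. -/
structure IsMatrixBraided {A : Type*} [Ring A] [Algebra k A] (e : D.Idx → D.Idx → A)
    (X : BraidedData k G A) : Prop extends IsBraidedBialgebra X where
  mul_eq : X.mul = LinearMap.mul k A
  one_eq : X.one = 1
  act_gen : ∀ g x y, X.act g (e x y) = D.actGen e g x y
  proj_gen : ∀ g x y, X.proj g (e x y) = if (x.1 : G) * (y.1 : G)⁻¹ = g then e x y else 0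
  comul_gen : ∀ x y, X.comul (e x y) = ∑ z, e x z ⊗ₜ[k] e z y
  counit_gen : ∀ x y, X.counit (e x y) = if x = y then 1 else 0

/-- `X` is a coquasitriangular bialgebra on the algebra `A`, which on the elements
`e x y = t_x{}^y` has the matrix coalgebra structure and `R(t_x{}^y ⊗ t_z{}^w) = R^y_x{}^w_z`. If
the `e x y` generate `A`, then there is at most one such `X`. -/
structure IsMatrixCoquasi {A : Type*} [Ring A] [Algebra k A] (e : D.Idx → D.Idx → A)
    (X : CoquasiData k A) : Prop extends IsCoquasiBialgebra X where
  comul_gen : ∀ x y, X.comul (e x y) = ∑ z, e x z ⊗ₜ[k] e z y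
  counit_gen : ∀ x y, X.counit (e x y) = if x = y then 1 else 0
  R_gen : ∀ x y z w, X.R (e x y) (e z w) = D.Rmat y x w z

end Block

end QDouble

end

open QDouble

set_option linter.unusedSectionVars false

/-! ### The induced representation of `G` on `V_{𝒞,π}` -/

noncomputable section

namespace QDouble

namespace Block

variable {k G : Type*} [Field k] [Group G] (D : Block k G)

/-! Let `ρ` be the representation of `G` on `V_{𝒞,π}` induced from `π`. All index sums in the
statement are matrix products with `ρ(g)`. Orthogonality of `π` makes `ρ(g⁻¹)` the transpose of
`ρ(g)`, and compatibility of the `q_c` makes `ρ` commute with the involution `ι : (a, i) ↦ (a⁻¹, i)`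
of the labels.

The algebras `A` and `H` are treated together as instances of `FRTModel`. Such an algebra has two
commuting actions of `G` by algebra automorphisms, the translations `L` of the lower and `R` of the
upper index. It is spanned by elements homogeneous for two degrees `(l, m)`, where `t_{ai}{}^{bj}`
has degrees `(a⁻¹, b⁻¹)`. The FRT relations amount to `a · L_{l⁻¹}(b) = R_m(b) · a` (`Homog.mul_L`).
The coquasitriangular form, pulled back from `D^∨(G)`, is `R(a, b) = ε(a) α_m(b)` with `α_m` the
character "evaluation at `m`", and `ε(a) = 0` unless `l = m`. Transmutation is therefore explicit:
`|a| = l⁻¹m`, `g` acts as `L_g R_g`, and `a • b = a · L_{l⁻¹m}(b) = (m ▷ b) · a` (`Homog.trans_mul`,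
`Homog.trans_mul'`). The axioms of a braided bialgebra become short computations with degrees. They
use only the involutive anti-endomorphism `S` that swaps the two indices through `ι`, and not that
`S` is an antipode, so they hold for `A` as well as for `H`. The braided antipode is `a ↦ S(R_{|a|}
a)`.

It remains to identify `U` with the transmutation of `A`, and `B` with that of `H` (`Twist`). The
relations of `U` hold for transmuted multiplication by the `t_{ai}{}^{bj}`, so `U` acts on `A`, and
evaluation at `1` gives a map `U → A`. Conversely `a · t_{ai}{}^{bj} = t_{ai}{}^{bj} • (b ▷ a)`.
Accordingly the operators `u ↦ E_{ai}{}^{bj} (b ▷ u)` on `U` satisfy the FRT relations in the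
opposite of `End(U)`, and evaluation at `1` gives the inverse map. For `B` and `H` the antipode
relations must also match. They do because `(S̲a₁) • a₂ = (S a₁) a₂`, while `a₁ • (S̲a₂)` is `a'₁ (S
a'₂)` for `a' = R_{|a|} a`. The structures on `U` and `B` are transported along these linear
isomorphisms. -/

@[simp]
theorem coe_conj (g : G) (c : D.Cls) : (D.conj g c : G) = g * c * g⁻¹ := rfl

theorem conj_conj (g h : G) (c : D.Cls) : D.conj g (D.conj h c) = D.conj (g * h) c := by
  apply Subtype.ext; simp [mul_assoc]

theorem conj_one (c : D.Cls) : D.conj 1 c = c := by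
  apply Subtype.ext; simp

theorem zeta_mul (c : D.Cls) (g h : G) :
    D.zeta c (g * h) = D.zeta (D.conj h c) g * D.zeta c h := by
  apply Subtype.ext
  simp [zeta, conj_conj, mul_assoc]

theorem zeta_one (c : D.Cls) : D.zeta c 1 = 1 := by
  apply Subtype.ext
  simp [zeta, conj_one]

theorem zeta_inv (c : D.Cls) (g : G) : D.zeta (D.conj g c) g⁻¹ = (D.zeta c g)⁻¹ := by
  rw [eq_inv_iff_mul_eq_one, ← zeta_mul, inv_mul_cancel, zeta_one]

variable [Fintype G] [DecidableEq G]

/-- The matrix of the action of `g` on the basis of `V_{𝒞,π}`. -/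
def rhoMat (g : G) : Matrix D.Idx D.Idx k := fun z w =>
  if z.1 = D.conj g w.1 then D.π (D.zeta w.1 g) z.2 w.2 else 0

theorem sum_rhoMat {M : Type*} [AddCommMonoid M] [Module k M] (g : G) (w : D.Idx) (f : D.Idx → M) :
    ∑ z, D.rhoMat g z w • f z = ∑ m, D.π (D.zeta w.1 g) m w.2 • f (D.conj g w.1, m) := by
  rw [Fintype.sum_prod_type, Finset.sum_eq_single (D.conj g w.1)]
  · simp [rhoMat]
  · intro b _ hb
    simp [rhoMat, hb]
  · simp

/-- The representation of `G` on `V_{𝒞,π}`. -/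
def rho : G →* Matrix D.Idx D.Idx k where
  toFun := D.rhoMat
  map_one' := by
    ext ⟨a, i⟩ ⟨b, j⟩
    simp only [rhoMat, conj_one, zeta_one, map_one, Matrix.one_apply, Prod.mk.injEq]
    split_ifs <;> simp_all
  map_mul' g h := by
    ext z w
    rw [Matrix.mul_apply]
    have := D.sum_rhoMat h w fun v => D.rhoMat g z v
    simp only [smul_eq_mul] at this
    simp_rw [mul_comm (D.rhoMat g z _)]
    rw [this]
    simp only [rhoMat, conj_conj, zeta_mul, map_mul, Matrix.mul_apply]
    split_ifs
    · simp only [mul_comm]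
    · simp

theorem rho_apply (g : G) (z w : D.Idx) : D.rho g z w =
    if z.1 = D.conj g w.1 then D.π (D.zeta w.1 g) z.2 w.2 else 0 := rfl

theorem sum_rho_smul {M : Type*} [AddCommMonoid M] [Module k M] (g : G) (w : D.Idx)
    (f : D.Idx → M) :
    ∑ z, D.rho g z w • f z = ∑ m, D.π (D.zeta w.1 g) m w.2 • f (D.conj g w.1, m) :=
  D.sum_rhoMat g w f

variable {D}

theorem rho_ne_zero {g : G} {z w : D.Idx} (h : D.rho g z w ≠ 0) :
    (z.1 : G) = g * w.1 * g⁻¹ := by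
  rw [rho_apply] at h
  have : z.1 = D.conj g w.1 := by by_contra h'; simp [h'] at h
  rw [this, coe_conj]

theorem rho_inv_apply (g : G) (y w : D.Idx) :
    D.rho g⁻¹ y w = if w.1 = D.conj g y.1 then D.π (D.zeta y.1 g)⁻¹ y.2 w.2 else 0 := by
  rw [rho_apply]
  by_cases h : w.1 = D.conj g y.1
  · rw [if_pos h, if_pos, h, zeta_inv]
    rw [h, conj_conj, inv_mul_cancel, conj_one]
  · rw [if_neg h, if_neg]
    intro h'
    rw [h', conj_conj, mul_inv_cancel, conj_one] at h
    exact h rfl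

theorem sum_rho_inv_smul {M : Type*} [AddCommMonoid M] [Module k M] (g : G) (y : D.Idx)
    (f : D.Idx → M) :
    ∑ w, D.rho g⁻¹ y w • f w = ∑ n, D.π (D.zeta y.1 g)⁻¹ y.2 n • f (D.conj g y.1, n) := by
  simp_rw [rho_inv_apply]
  rw [Fintype.sum_prod_type, Finset.sum_eq_single (D.conj g y.1)]
  · simp
  · intro b _ hb
    simp [hb]
  · simp

/-- The induced representation permutes the blocks indexed by the class and acts between blocks
through the matrices `π(n)`. It is therefore orthogonal because `π` is. -/
theorem IsOrthogonal.rho_inv (hπ : D.IsOrthogonal) (g : G) (x y : D.Idx) :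
    D.rho g⁻¹ x y = D.rho g y x := by
  rw [rho_inv_apply, rho_apply]
  have h1 : D.π (D.zeta x.1 g)⁻¹ = (D.π (D.zeta x.1 g)).transpose := by
    have h2 : D.π (D.zeta x.1 g) * D.π (D.zeta x.1 g)⁻¹ = 1 := by
      rw [← map_mul, mul_inv_cancel, map_one]
    exact (left_inv_eq_right_inv (hπ _) h2).symm
  rw [h1, Matrix.transpose_apply]

/-! ### Inversion of labels -/

/-- `(a, i) ↦ (a⁻¹, i)`. -/
def InvStable.iota (hC : D.InvStable) (x : D.Idx) : D.Idx := (hC.inv x.1, x.2)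

@[simp]
theorem InvStable.coe_iota (hC : D.InvStable) (x : D.Idx) :
    ((hC.iota x).1 : G) = (x.1 : G)⁻¹ := rfl

@[simp]
theorem InvStable.iota_iota (hC : D.InvStable) (x : D.Idx) : hC.iota (hC.iota x) = x := by
  refine Prod.ext (Subtype.ext ?_) rfl
  simp

/-- `x ↦ ι x` as a permutation. -/
def InvStable.iotaEquiv (hC : D.InvStable) : D.Idx ≃ D.Idx where
  toFun := hC.iota
  invFun := hC.iota
  left_inv := hC.iota_iota
  right_inv := hC.iota_iota

theorem InvStable.sum_iota {M : Type*} [AddCommMonoid M] (hC : D.InvStable) (f : D.Idx → M) :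
    ∑ x, f (hC.iota x) = ∑ x, f x :=
  Equiv.sum_comp hC.iotaEquiv f

theorem InvStable.iota_inj (hC : D.InvStable) {x y : D.Idx} : hC.iota x = hC.iota y ↔ x = y :=
  hC.iotaEquiv.apply_eq_iff_eq

/-- Conjugation commutes with inversion on the class, so both sides have the same support.
Compatibility is exactly the equality of the remaining blocks. -/
theorem InvStable.Compatible.rho_iota {hC : D.InvStable} (hq : hC.Compatible) (g : G)
    (x y : D.Idx) : D.rho g (hC.iota x) (hC.iota y) = D.rho g x y := by
  rw [rho_apply, rho_apply]
  have h1 : (hC.iota x).1 = D.conj g (hC.iota y).1 ↔ x.1 = D.conj g y.1 := by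
    simp only [Subtype.ext_iff, coe_conj, coe_iota]
    rw [← inv_inj]
    simp [mul_assoc]
  have h2 : D.π (D.zeta (hC.iota y).1 g) = D.π (D.zeta y.1 g) := hq y.1 g
  simp only [h1, h2]
  rfl

theorem sum_rho_mul (g h : G) (x y : D.Idx) : ∑ z, D.rho g x z * D.rho h z y = D.rho (g * h) x y := by
  rw [map_mul, Matrix.mul_apply]

/-! ### Families indexed by matrix units -/

section Families

variable {M : Type*} [AddCommGroup M] [Module k M] (e : D.Idx → D.Idx → M)

/-- The linear map on matrices with `E_x{}^y ↦ e x y`. -/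
def hat : Matrix D.Idx D.Idx k →ₗ[k] M where
  toFun c := ∑ x, ∑ y, c x y • e x y
  map_add' c d := by simp [add_smul, Finset.sum_add_distrib]
  map_smul' r c := by simp [mul_smul, Finset.smul_sum]

theorem hat_apply (c : Matrix D.Idx D.Idx k) : hat e c = ∑ x, ∑ y, c x y • e x y := rfl

/-- The matrix unit `E_x{}^y`. -/
def unit (x y : D.Idx) : Matrix D.Idx D.Idx k := Matrix.single x y 1

theorem mul_unit (c : Matrix D.Idx D.Idx k) (x y a b : D.Idx) :
    (c * unit x y) a b = if b = y then c a x else 0 := by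
  rw [unit]
  split_ifs with h
  · subst h; simp
  · rw [Matrix.mul_single_apply_of_ne _ _ _ _ _ h]

theorem unit_mul (c : Matrix D.Idx D.Idx k) (x y a b : D.Idx) :
    (unit x y * c) a b = if a = x then c y b else 0 := by
  rw [unit]
  split_ifs with h
  · subst h; simp
  · rw [Matrix.single_mul_apply_of_ne _ _ _ _ _ h]

theorem hat_mul_unit (c : Matrix D.Idx D.Idx k) (x y : D.Idx) :
    hat e (c * unit x y) = ∑ v, c v x • e v y := by
  simp [hat_apply, mul_unit]

theorem hat_unit_mul (c : Matrix D.Idx D.Idx k) (x y : D.Idx) :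
    hat e (unit x y * c) = ∑ v, c y v • e x v := by
  simp only [hat_apply, unit_mul]
  rw [Finset.sum_eq_single x]
  · simp
  · intro b _ hb; simp [hb]
  · simp

theorem hat_unit (x y : D.Idx) : hat e (unit x y) = e x y := by
  have := hat_mul_unit e 1 x y
  rw [one_mul] at this
  simp [this, Matrix.one_apply]

theorem map_hat {N : Type*} [AddCommGroup N] [Module k N] (f : M →ₗ[k] N)
    (c : Matrix D.Idx D.Idx k) : f (hat e c) = hat (fun x y => f (e x y)) c := by
  simp [hat_apply]

theorem mul_unit_mul (c d : Matrix D.Idx D.Idx k) (x y a b : D.Idx) :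
    (c * unit x y * d) a b = c a x * d y b := by
  rw [Matrix.mul_apply]
  simp [mul_unit]

/-- From here on, sums over `π ∘ ζ` are replaced by products of matrices, so identities between
generators reduce to the homomorphism property of `ρ`. -/
theorem actGen_eq_hat (g : G) (x y : D.Idx) :
    D.actGen e g x y = hat e (D.rho g * unit x y * D.rho g⁻¹) := by
  simp only [hat_apply, mul_unit_mul, mul_smul, ← Finset.smul_sum]
  rw [sum_rho_smul]
  simp only [sum_rho_inv_smul, actGen, mul_smul, ← Finset.smul_sum]

theorem actLow_eq_hat (g : G) (x y : D.Idx) :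
    D.actLow e g x y = hat e (D.rho g * unit x y) := by
  rw [hat_mul_unit, sum_rho_smul]
  rfl

theorem InvStable.brAntipodeGen_eq (hC : D.InvStable) (x y : D.Idx) :
    hC.brAntipodeGen e x y =
      ∑ z, D.rho ((x.1 : G) * (y.1 : G)⁻¹)⁻¹ y z • e (hC.iota z) (hC.iota x) := by
  rw [sum_rho_inv_smul]
  unfold brAntipodeGen
  refine Finset.sum_congr rfl fun m _ => ?_
  -- The class label `ab⁻¹a⁻¹` is the inverse of `(ab⁻¹) b (ab⁻¹)⁻¹ = aba⁻¹`.
  congr 2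
  refine Prod.ext (Subtype.ext ?_) rfl
  simp [inv, mul_assoc]

theorem InvStable.antipodeGen_eq (hC : D.InvStable) (x y : D.Idx) :
    hC.antipodeGen e x y = e (hC.iota y) (hC.iota x) := rfl

end Families

theorem Rmat_eq (x y z w : D.Idx) :
    D.Rmat x y z w = if x = y then D.rho x.1 z w else 0 := by
  rw [Rmat, rho_apply]
  by_cases h : x = y <;> simp [h]

/-- A term with `q_a n⁻¹ q_b⁻¹ = g` has `n = q_b⁻¹ g⁻¹ q_a`. This lies in the centraliser only if `b
= g⁻¹ag`, and then it is `ζ_a(g⁻¹)`. Hence the coefficient at `g` is a matrix entry of `ρ(g⁻¹)`. -/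
theorem rGen_eq (x y : D.Idx) :
    D.rGen x y = fun g => MonoidAlgebra.single (y.1 : G)⁻¹ (D.rho g⁻¹ y x) := by
  funext g
  rw [rGen, Finset.sum_apply]
  simp only [Pi.smul_apply, dl, Pi.single_apply, rho_apply]
  by_cases h : y.1 = D.conj g⁻¹ x.1
  · rw [if_pos h, Finset.sum_eq_single (D.zeta x.1 g⁻¹)]
    · rw [if_pos]
      · simp
      · change g = D.q x.1 * ((D.q (D.conj g⁻¹ x.1))⁻¹ * g⁻¹ * D.q x.1)⁻¹ * (D.q y.1)⁻¹
        rw [← h]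
        group
    · intro n _ hn
      rw [if_neg, smul_zero]
      intro hg
      apply hn
      apply Subtype.ext
      change (n : G) = (D.q (D.conj g⁻¹ x.1))⁻¹ * g⁻¹ * D.q x.1
      rw [← h, hg]
      group
    · simp
  · rw [if_neg h]
    simp only [MonoidAlgebra.single_zero]
    refine Finset.sum_eq_zero fun n _ => ?_
    rw [if_neg, smul_zero]
    intro hg
    apply h
    apply Subtype.ext
    have hn : (n : G) * D.r = D.r * n := (Subgroup.mem_centralizer_singleton_iff.1 n.2)
    rw [coe_conj, ← D.q_conj x.1, ← D.q_conj y.1, hg]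
    have hn' : D.r = n * D.r * (n : G)⁻¹ := by rw [hn]; group
    conv_lhs => rw [hn']
    group

end Block
end QDouble
end

/-! ### The bialgebra `D^∨(G)`: basis, characters, translations -/

noncomputable section

namespace QDouble

section Double

variable {k G : Type*} [Field k] [Group G] [Fintype G] [DecidableEq G]

theorem coord_dl (g h u v : G) :
    coord g h (dl u v : DV k G) = if u = g ∧ v = h then 1 else 0 := by
  by_cases hg : u = g
  · subst hg
    simp [coord, dl, MonoidAlgebra.coeffLinearEquiv, Finsupp.single_apply]
  · simp [coord, dl, hg, Ne.symm hg, eq_comm]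

theorem eq_sum_dl (F : DV k G) : F = ∑ g, ∑ h, coord g h F • dl g h := by
  have h1 : ∀ a : MonoidAlgebra k G, a = ∑ h, a.coeff h • MonoidAlgebra.single h 1 := by
    intro a
    induction a using MonoidAlgebra.induction_linear with
    | zero => simp
    | add f g hf hg =>
      simp only [MonoidAlgebra.coeff_add, Finsupp.add_apply, add_smul, Finset.sum_add_distrib]
      rw [← hf, ← hg]
    | single a b => simp [Finsupp.single_apply]
  funext u
  simp only [Finset.sum_apply, Pi.smul_apply, dl, Pi.single_apply]
  rw [Finset.sum_eq_single u]
  · simp only [if_true]; exact h1 (F u)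
  · intro b _ hb; simp [hb.symm]
  · simp

theorem dl_ext {V : Type*} [AddCommGroup V] [Module k V] {f f' : DV k G →ₗ[k] V}
    (h : ∀ u v, f (dl u v) = f' (dl u v)) : f = f' := by
  refine LinearMap.ext fun F => ?_
  conv_lhs => rw [eq_sum_dl F]
  conv_rhs => rw [eq_sum_dl F]
  simp only [map_sum, map_smul, h]

theorem onBasis_dl {V : Type*} [AddCommGroup V] [Module k V] (F : G → G → V) (g h : G) :
    onBasis F (dl g h : DV k G) = F g h := by
  simp only [onBasis, LinearMap.sum_apply, LinearMap.smulRight_apply, coord_dl, ite_smul, one_smul,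
    zero_smul]
  rw [Finset.sum_eq_single g]
  · simp
  · intro b _ hb; simp [hb.symm]
  · simp

theorem dl_apply (g h u : G) :
    (dl g h : DV k G) u = if u = g then MonoidAlgebra.single h 1 else 0 := by
  simp [dl, Pi.single_apply]

theorem dl_mul_dl (g h u v : G) :
    (dl g h * dl u v : DV k G) = if g = u then dl g (h * v) else 0 := by
  funext w
  by_cases hg : g = u
  · subst hg
    simp only [Pi.mul_apply, dl_apply, if_true]
    split_ifs <;> simp
  · simp only [Pi.mul_apply, dl_apply, hg, if_false, Pi.zero_apply]
    split_ifs with h1 h2 <;> simp_all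

theorem one_eq_sum_dl : (1 : DV k G) = ∑ g, dl g 1 := by
  funext u
  simp [Finset.sum_apply, dl_apply, MonoidAlgebra.one_def]

variable (k) in
/-- The character `δ_u ⊗ v ↦ δ_{g,u}` of `D^∨(G)`. -/
def aug (g : G) : DV k G →ₐ[k] k :=
  (MonoidAlgebra.lift k k G 1).comp (Pi.evalAlgHom k (fun _ : G => MonoidAlgebra k G) g)

theorem aug_dl (g u v : G) : aug k g (dl u v) = if u = g then 1 else 0 := by
  by_cases hg : u = g
  · subst hg; simp [aug, dl_apply]
  · simp [aug, dl_apply, hg, Ne.symm hg]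

theorem sum_coord (g : G) : (∑ h, coord g h : DV k G →ₗ[k] k) = (aug k g).toLinearMap := by
  refine dl_ext fun u v => ?_
  simp only [LinearMap.sum_apply, coord_dl, AlgHom.toLinearMap_apply, aug_dl]
  by_cases h : u = g <;> simp [h]

/-- The form separates its arguments: the first enters only through its `kG`-component at the unit
of `G`, the second only through characters. On a model this yields `R(a, b) = ε(a) α_m(b)`. -/
theorem DVdata_R (a b : DV k G) :
    (DVdata k G).R a b = ∑ f, coord 1 f a * aug k f b := by
  have : (DVdata k G).R =
      ∑ f, (LinearMap.mul k k).compl₁₂ (coord 1 f) (aug k f).toLinearMap := by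
    refine dl_ext fun g h => dl_ext fun u v => ?_
    simp only [DVdata, onBasis_dl, LinearMap.sum_apply, LinearMap.compl₁₂_apply,
      LinearMap.mul_apply', coord_dl, AlgHom.toLinearMap_apply, aug_dl]
    by_cases hg : g = 1 <;> simp [hg]
  simp [this]

theorem DVdata_counit : (DVdata k G).counit = (aug k (1 : G)).toLinearMap :=
  dl_ext fun u v => by simp [DVdata, onBasis_dl, aug_dl]

theorem DVdata_comul_dl (g h : G) : (DVdata k G).comul (dl g h) =
    ∑ f, dl f (f⁻¹ * g * h * g⁻¹ * f) ⊗ₜ[k] dl (f⁻¹ * g) h := by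
  simp [DVdata, onBasis_dl]

theorem DVdata_comul_mul (a b : DV k G) :
    (DVdata k G).comul (a * b) = (DVdata k G).comul a * (DVdata k G).comul b := by
  have : (LinearMap.mul k (DV k G)).compr₂ (DVdata k G).comul =
      (LinearMap.mul k (DV k G ⊗[k] DV k G)).compl₁₂ (DVdata k G).comul (DVdata k G).comul := by
    refine dl_ext fun g h => dl_ext fun u v => ?_
    simp only [LinearMap.compr₂_apply, LinearMap.mul_apply', LinearMap.compl₁₂_apply, dl_mul_dl,
      DVdata_comul_dl]
    rw [Finset.sum_mul_sum]
    -- The first tensor factors are supported at `f` and `f'`, so only the diagonal terms survive;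
    -- then `f⁻¹g = f⁻¹u` forces `g = u`.
    have h1 : ∀ f f' : G, (dl f (f⁻¹ * g * h * g⁻¹ * f) ⊗ₜ[k] dl (f⁻¹ * g) h) *
        (dl f' (f'⁻¹ * u * v * u⁻¹ * f') ⊗ₜ[k] dl (f'⁻¹ * u) v : DV k G ⊗[k] DV k G) =
        if f = f' then if g = u then
          dl f (f⁻¹ * g * (h * v) * g⁻¹ * f) ⊗ₜ[k] dl (f⁻¹ * g) (h * v) else 0 else 0 := by
      intro f f'
      rw [Algebra.TensorProduct.tmul_mul_tmul, dl_mul_dl, dl_mul_dl]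
      by_cases hf : f = f'
      · subst hf
        by_cases hg : g = u
        · subst hg
          simp [mul_assoc]
        · simp [hg]
      · simp [hf]
    simp only [h1, Finset.sum_ite_eq, Finset.mem_univ, if_true]
    by_cases hg : g = u <;> simp [hg, DVdata_comul_dl]
  exact LinearMap.congr_fun₂ this a b

theorem DVdata_comul_one : (DVdata k G).comul (1 : DV k G) = 1 := by
  rw [one_eq_sum_dl, map_sum]
  simp only [DVdata_comul_dl]
  rw [Algebra.TensorProduct.one_def, one_eq_sum_dl, TensorProduct.sum_tmul, Finset.sum_comm]
  refine Finset.sum_congr rfl fun f _ => ?_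
  rw [TensorProduct.tmul_sum, ← Equiv.sum_comp (Equiv.mulLeft f⁻¹) fun a => dl f 1 ⊗ₜ[k] dl a 1]
  simp [mul_assoc]

variable (k G) in
/-- The coproduct of `D^∨(G)` as a map of algebras. -/
def DVcomul : DV k G →ₐ[k] DV k G ⊗[k] DV k G :=
  AlgHom.ofLinearMap (DVdata k G).comul DVdata_comul_one DVdata_comul_mul

variable (k) in
/-- The left translation `δ_u ⊗ v ↦ δ_{gu} ⊗ v`. -/
def DVleft (g : G) : DV k G →ₐ[k] DV k G :=
  AlgHom.pi fun u => Pi.evalAlgHom k (fun _ : G => MonoidAlgebra k G) (g⁻¹ * u)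

theorem DVleft_dl (g u v : G) : DVleft k g (dl u v) = dl (g * u) v := by
  funext w
  simp [DVleft, dl_apply, inv_mul_eq_iff_eq_mul]

variable (k) in
/-- The action `δ_u ⊗ v ↦ δ_{gug⁻¹} ⊗ gvg⁻¹`. -/
def DVact (g : G) : DV k G →ₐ[k] DV k G :=
  AlgHom.pi fun u => (MonoidAlgebra.mapDomainAlgHom k k (MulAut.conj g).toMonoidHom).comp
    (Pi.evalAlgHom k (fun _ : G => MonoidAlgebra k G) (g⁻¹ * u * g))

theorem DVact_dl (g u v : G) : DVact k g (dl u v) = dl (g * u * g⁻¹) (g * v * g⁻¹) := by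
  funext w
  simp only [DVact, dl_apply, AlgHom.pi_apply, AlgHom.comp_apply, Pi.evalAlgHom_apply]
  have : g⁻¹ * w * g = u ↔ w = g * u * g⁻¹ := by
    constructor
    · rintro rfl; group
    · rintro rfl; group
  simp only [this]
  split_ifs <;> simp [MulAut.conj]

theorem BD_act (g : G) : (BD k G).act g = (DVact k g).toLinearMap :=
  dl_ext fun u v => by simp [BD, onBasis_dl, DVact_dl]

end Double
end QDouble
end

/-! ### Models of the FRT algebra: translations, gradings, antiendomorphism -/

noncomputable section

namespace QDouble

namespace Block

variable {k G : Type*} [Field k] [Group G] [Fintype G] [DecidableEq G] {D : Block k G}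

theorem hat_unit_eq (c : Matrix D.Idx D.Idx k) : hat unit c = c := by
  ext i j
  simp [hat_apply, unit, Matrix.sum_apply, Matrix.single_apply, ite_and]

theorem hat_ext {M : Type*} [AddCommGroup M] [Module k M] {f f' : Matrix D.Idx D.Idx k →ₗ[k] M}
    (h : ∀ x y, f (unit x y) = f' (unit x y)) : f = f' := by
  refine LinearMap.ext fun c => ?_
  rw [← hat_unit_eq c, map_hat, map_hat]
  simp only [h]

/-- An algebra generated by matrix elements `e x y = t_x{}^y` which satisfy the FRT relations,
with the matrix bialgebra structure, a map `φ` of algebras to `D^∨(G)` with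
`e x y ↦ r_x{}^y`, and an antiendomorphism `S` with `S t_{ai}{}^{bj} = t_{b⁻¹j}{}^{a⁻¹i}`. -/
structure FRTModel (hC : D.InvStable) (A : Type*) [Ring A] [Algebra k A] where
  e : D.Idx → D.Idx → A
  comul : A →ₐ[k] A ⊗[k] A
  counit : A →ₐ[k] k
  φ : A →ₐ[k] DV k G
  S : A →ₗ[k] A
  adjoin_e : Algebra.adjoin k {a | ∃ x y, a = e x y} = ⊤
  comul_e : ∀ x y, comul (e x y) = ∑ z, e x z ⊗ₜ[k] e z y
  counit_e : ∀ x y, counit (e x y) = if x = y then 1 else 0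
  φ_e : ∀ x y, φ (e x y) = fun g => MonoidAlgebra.single (y.1 : G)⁻¹ (D.rho g⁻¹ y x)
  S_one : S 1 = 1
  S_mul : ∀ a b, S (a * b) = S b * S a
  S_e : ∀ x y, S (e x y) = e (hC.iota y) (hC.iota x)
  frt : ∀ x y z w, e x y * hat e (D.rho x.1 * unit z w) = hat e (unit z w * D.rho y.1) * e x y

namespace FRTModel

variable {hC : D.InvStable} {A : Type*} [Ring A] [Algebra k A] (M : FRTModel hC A)

theorem algHom_ext {B : Type*} [Semiring B] [Algebra k B] {f f' : A →ₐ[k] B}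
    (h : ∀ x y, f (M.e x y) = f' (M.e x y)) : f = f' :=
  AlgHom.ext_of_adjoin_eq_top M.adjoin_e (by rintro _ ⟨x, y, rfl⟩; exact h x y)

theorem induction {P : A → Prop} (one : P 1) (gen : ∀ x y, P (M.e x y))
    (mul : ∀ a b, P a → P b → P (a * b)) (add : ∀ a b, P a → P b → P (a + b))
    (smul : ∀ (c : k) a, P a → P (c • a)) (a : A) : P a := by
  have ha : a ∈ Algebra.adjoin k {a | ∃ x y, a = M.e x y} := by rw [M.adjoin_e]; trivial
  induction ha using Algebra.adjoin_induction with
  | mem x hx => obtain ⟨x, y, rfl⟩ := hx; exact gen x y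
  | algebraMap r => rw [Algebra.algebraMap_eq_smul_one]; exact smul _ _ one
  | add x y _ _ hx hy => exact add _ _ hx hy
  | mul x y _ _ hx hy => exact mul _ _ hx hy

/-- The character of `A` given by evaluation at `g`. -/
def alpha (g : G) : A →ₐ[k] k := (aug k g).comp M.φ

/-- The map `A → kG` given by evaluation at the unit element of `k(G) ⊗ kG`. -/
def beta : A →ₐ[k] MonoidAlgebra k G :=
  (Pi.evalAlgHom k (fun _ : G => MonoidAlgebra k G) 1).comp M.φ

/-- Left translation by `g`. -/
def L (g : G) : A →ₐ[k] A :=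
  (Algebra.TensorProduct.lid k A).toAlgHom.comp
    ((Algebra.TensorProduct.map (M.alpha g⁻¹) (AlgHom.id k A)).comp M.comul)

/-- Right translation by `g`. -/
def R (g : G) : A →ₐ[k] A :=
  (Algebra.TensorProduct.rid k k A).toAlgHom.comp
    ((Algebra.TensorProduct.map (AlgHom.id k A) (M.alpha g)).comp M.comul)

/-- The action of `g` by left and right translation. -/
def act (g : G) : A →ₐ[k] A := (M.L g).comp (M.R g)

theorem alpha_e (g : G) (x y : D.Idx) : M.alpha g (M.e x y) = D.rho g⁻¹ y x := by
  simp [alpha, aug, φ_e]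

theorem beta_e (x y : D.Idx) :
    M.beta (M.e x y) = MonoidAlgebra.single (y.1 : G)⁻¹ (if x = y then 1 else 0) := by
  simp [beta, φ_e, Matrix.one_apply, eq_comm]

theorem L_e (g : G) (x y : D.Idx) : M.L g (M.e x y) = hat M.e (D.rho g * unit x y) := by
  simp [L, comul_e, alpha_e, hat_mul_unit]

theorem R_e (g : G) (x y : D.Idx) : M.R g (M.e x y) = hat M.e (unit x y * D.rho g⁻¹) := by
  simp [R, comul_e, alpha_e, hat_unit_mul]

theorem L_hat (g : G) (c : Matrix D.Idx D.Idx k) :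
    M.L g (hat M.e c) = hat M.e (D.rho g * c) := by
  have : (M.L g).toLinearMap ∘ₗ hat M.e = hat M.e ∘ₗ LinearMap.mulLeft k (D.rho g) :=
    hat_ext fun x y => by simp [hat_unit, L_e]
  exact LinearMap.congr_fun this c

theorem R_hat (g : G) (c : Matrix D.Idx D.Idx k) :
    M.R g (hat M.e c) = hat M.e (c * D.rho g⁻¹) := by
  have : (M.R g).toLinearMap ∘ₗ hat M.e = hat M.e ∘ₗ LinearMap.mulRight k (D.rho g⁻¹) :=
    hat_ext fun x y => by simp [hat_unit, R_e]
  exact LinearMap.congr_fun this c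

theorem act_hat (g : G) (c : Matrix D.Idx D.Idx k) :
    M.act g (hat M.e c) = hat M.e (D.rho g * c * D.rho g⁻¹) := by
  rw [act, AlgHom.comp_apply, R_hat, L_hat, mul_assoc]

theorem L_one : M.L 1 = AlgHom.id k A := M.algHom_ext fun x y => by simp [L_e, hat_unit]

theorem R_one : M.R 1 = AlgHom.id k A := M.algHom_ext fun x y => by simp [R_e, hat_unit]

theorem L_L (g h : G) (a : A) : M.L g (M.L h a) = M.L (g * h) a := by
  have : (M.L g).comp (M.L h) = M.L (g * h) :=
    M.algHom_ext fun x y => by simp [L_e, L_hat, mul_assoc]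
  exact DFunLike.congr_fun this a

theorem R_R (g h : G) (a : A) : M.R g (M.R h a) = M.R (g * h) a := by
  have : (M.R g).comp (M.R h) = M.R (g * h) :=
    M.algHom_ext fun x y => by simp only [AlgHom.comp_apply, R_e, R_hat, mul_inv_rev, map_mul,
      mul_assoc]
  exact DFunLike.congr_fun this a

theorem R_L (g h : G) (a : A) : M.R g (M.L h a) = M.L h (M.R g a) := by
  have : (M.R g).comp (M.L h) = (M.L h).comp (M.R g) :=
    M.algHom_ext fun x y => by simp only [AlgHom.comp_apply, R_e, L_e, L_hat, R_hat, mul_assoc]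
  exact DFunLike.congr_fun this a

theorem act_apply (g : G) (a : A) : M.act g a = M.L g (M.R g a) := rfl

theorem act_one : M.act 1 = AlgHom.id k A := by rw [act, L_one, R_one]; rfl

theorem act_act (g h : G) (a : A) : M.act g (M.act h a) = M.act (g * h) a := by
  simp only [act_apply, R_L, L_L, R_R]

theorem coassoc : (TensorProduct.assoc k A A A).toLinearMap ∘ₗ M.comul.toLinearMap.rTensor A ∘ₗ
    M.comul.toLinearMap = M.comul.toLinearMap.lTensor A ∘ₗ M.comul.toLinearMap := by
  have : ((Algebra.TensorProduct.assoc k k k A A A).toAlgHom.comp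
      (Algebra.TensorProduct.map M.comul (AlgHom.id k A))).comp M.comul =
      (Algebra.TensorProduct.map (AlgHom.id k A) M.comul).comp M.comul :=
    M.algHom_ext fun x y => by
      simp only [AlgHom.comp_apply, comul_e, map_sum, Algebra.TensorProduct.map_tmul,
        TensorProduct.sum_tmul, TensorProduct.tmul_sum, AlgHom.id_apply]
      rw [Finset.sum_comm]
      rfl
  exact congrArg AlgHom.toLinearMap this

theorem counit_comul (a : A) :
    TensorProduct.lid k A (M.counit.toLinearMap.rTensor A (M.comul a)) = a := by
  have : ((Algebra.TensorProduct.lid k A).toAlgHom.comp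
      (Algebra.TensorProduct.map M.counit (AlgHom.id k A))).comp M.comul = AlgHom.id k A :=
    M.algHom_ext fun x y => by simp [comul_e, counit_e]
  exact DFunLike.congr_fun this a

theorem comul_counit (a : A) :
    TensorProduct.rid k A (M.counit.toLinearMap.lTensor A (M.comul a)) = a := by
  have : ((Algebra.TensorProduct.rid k k A).toAlgHom.comp
      (Algebra.TensorProduct.map (AlgHom.id k A) M.counit)).comp M.comul = AlgHom.id k A :=
    M.algHom_ext fun x y => by simp [comul_e, counit_e]
  exact DFunLike.congr_fun this a

theorem comul_L (g : G) (a : A) :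
    M.comul (M.L g a) = Algebra.TensorProduct.map (M.L g) (AlgHom.id k A) (M.comul a) := by
  have : M.comul.comp (M.L g) =
      (Algebra.TensorProduct.map (M.L g) (AlgHom.id k A)).comp M.comul :=
    M.algHom_ext fun x y => by
      simp only [AlgHom.comp_apply, L_e, comul_e, map_sum, Algebra.TensorProduct.map_tmul,
        hat_mul_unit, map_smul, TensorProduct.sum_tmul, Finset.smul_sum, TensorProduct.smul_tmul',
        AlgHom.id_apply]
      rw [Finset.sum_comm]
  exact DFunLike.congr_fun this a

theorem comul_R (g : G) (a : A) :
    M.comul (M.R g a) = Algebra.TensorProduct.map (AlgHom.id k A) (M.R g) (M.comul a) := by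
  have : M.comul.comp (M.R g) =
      (Algebra.TensorProduct.map (AlgHom.id k A) (M.R g)).comp M.comul :=
    M.algHom_ext fun x y => by
      simp only [AlgHom.comp_apply, R_e, comul_e, map_sum, Algebra.TensorProduct.map_tmul,
        hat_unit_mul, map_smul, TensorProduct.tmul_sum, Finset.smul_sum, TensorProduct.tmul_smul,
        AlgHom.id_apply]
      rw [Finset.sum_comm]
  exact DFunLike.congr_fun this a

/-- The two translations act on the contracted middle index by `ρ(g⁻¹)` and `ρ(g)`, which cancel.
This freedom to insert translations in a coproduct drives `comul_act`, `Homog₂.tensorMul` and the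
left antipode identity. -/
theorem map_R_L_comul (g : G) (a : A) :
    Algebra.TensorProduct.map (M.R g) (M.L g) (M.comul a) = M.comul a := by
  have : (Algebra.TensorProduct.map (M.R g) (M.L g)).comp M.comul = M.comul :=
    M.algHom_ext fun x y => by
      simp only [AlgHom.comp_apply, R_e, L_e, comul_e, map_sum, Algebra.TensorProduct.map_tmul,
        hat_unit_mul, hat_mul_unit, TensorProduct.sum_tmul, TensorProduct.tmul_sum,
        TensorProduct.tmul_smul]
      rw [Finset.sum_comm]
      refine Finset.sum_congr rfl fun u _ => ?_
      simp only [Finset.smul_sum, TensorProduct.smul_tmul', smul_smul]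
      rw [Finset.sum_comm]
      simp only [← TensorProduct.sum_tmul, ← Finset.sum_smul, sum_rho_mul, mul_inv_cancel, map_one,
        Matrix.one_apply, ite_smul, one_smul, zero_smul, Finset.sum_ite_eq, Finset.mem_univ,
        if_true]
  exact DFunLike.congr_fun this a

theorem comul_act (g : G) (a : A) :
    M.comul (M.act g a) = TensorProduct.map (M.act g).toLinearMap (M.act g).toLinearMap
      (M.comul a) := by
  -- After the insertion, `act g` cancels `R g⁻¹` down to `L g` on the first leg, and `L g⁻¹` down
  -- to `R g` on the second.
  conv_rhs => rw [← M.map_R_L_comul g⁻¹ a]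
  rw [act_apply, comul_L, comul_R]
  induction M.comul a with
  | zero => simp
  | tmul b c => simp [act_apply, R_R, L_L, R_L, L_one, R_one]
  | add b c hb hc => simp only [map_add, hb, hc]

theorem counit_L (g : G) (a : A) : M.counit (M.L g a) = M.alpha g⁻¹ a := by
  have : M.counit.comp (M.L g) = M.alpha g⁻¹ :=
    M.algHom_ext fun x y => by simp [L_e, counit_e, alpha_e, hat_mul_unit]
  exact DFunLike.congr_fun this a

theorem counit_R (g : G) (a : A) : M.counit (M.R g a) = M.alpha g a := by
  have : M.counit.comp (M.R g) = M.alpha g :=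
    M.algHom_ext fun x y => by simp [R_e, counit_e, alpha_e, hat_unit_mul]
  exact DFunLike.congr_fun this a

theorem alpha_one : M.alpha 1 = M.counit :=
  AlgHom.ext fun a => by rw [← counit_R, R_one, AlgHom.id_apply]

theorem counit_act (g : G) (a : A) : M.counit (M.act g a) = M.counit a := by
  rw [act_apply, counit_L, ← counit_R, R_R, inv_mul_cancel, R_one, AlgHom.id_apply]

theorem S_S (a : A) : M.S (M.S a) = a := by
  induction a using M.induction with
  | one => simp [S_one]
  | gen x y => simp [S_e]
  | mul a b ha hb => rw [S_mul, S_mul, ha, hb]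
  | add a b ha hb => rw [map_add, map_add, ha, hb]
  | smul c a ha => rw [map_smul, map_smul, ha]

theorem counit_S (a : A) : M.counit (M.S a) = M.counit a := by
  induction a using M.induction with
  | one => simp [S_one]
  | gen x y => simp [S_e, counit_e, hC.iota_inj, eq_comm]
  | mul a b ha hb => rw [S_mul, map_mul, map_mul, ha, hb, mul_comm]
  | add a b ha hb => rw [map_add, map_add, map_add, ha, hb]
  | smul c a ha => rw [map_smul, map_smul, map_smul, ha]

/-- `S` exchanges the two indices and applies `ι`. Since `ρ(g⁻¹)` is the transpose of `ρ(g)` and `ρ`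
commutes with `ι`, it exchanges the two translations. Orthogonality and compatibility are both
needed here. -/
theorem S_R (hπ : D.IsOrthogonal) (hq : hC.Compatible) (g : G) (a : A) :
    M.S (M.R g a) = M.L g (M.S a) := by
  induction a using M.induction with
  | one => simp [S_one]
  | gen x y =>
    rw [S_e, R_e, L_e, hat_unit_mul, hat_mul_unit,
      ← hC.sum_iota fun v => D.rho g v (hC.iota y) • M.e v (hC.iota x)]
    simp only [map_sum, map_smul, S_e, hq.rho_iota, hπ.rho_inv]
  | mul a b ha hb => rw [map_mul, S_mul, S_mul, map_mul, ha, hb]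
  | add a b ha hb => simp only [map_add, ha, hb]
  | smul c a ha => simp only [map_smul, ha]

theorem S_L (hπ : D.IsOrthogonal) (hq : hC.Compatible) (g : G) (a : A) :
    M.S (M.L g a) = M.R g (M.S a) := by
  rw [← M.S_S (M.R g _), S_R M hπ hq, S_S]

theorem alpha_S (hπ : D.IsOrthogonal) (hq : hC.Compatible) (g : G) (a : A) :
    M.alpha g (M.S a) = M.alpha g⁻¹ a := by
  rw [← counit_R, ← S_L M hπ hq, counit_S, counit_L]

/-- For `b` a generator this is the FRT relation. It extends to all `b` because translations are
algebra maps. -/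
theorem quasi_comm_e (x y : D.Idx) (b : A) :
    M.e x y * M.L x.1 b = M.R (y.1 : G)⁻¹ b * M.e x y := by
  induction b using M.induction with
  | one => simp
  | gen z w => rw [L_e, R_e, inv_inv, frt]
  | mul a b ha hb => rw [map_mul, map_mul, ← mul_assoc, ha, mul_assoc, hb, mul_assoc]
  | add a b ha hb => rw [map_add, map_add, mul_add, add_mul, ha, hb]
  | smul c a ha => rw [map_smul, map_smul, mul_smul_comm, smul_mul_assoc, ha]

/-! ### The two gradings -/

/-- `a` is homogeneous for the two gradings of `A` by `G`, of degrees `l` and `m`. -/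
inductive Homog : G → G → A → Prop
  | zero (l m : G) : Homog l m 0
  | one : Homog 1 1 1
  | gen (x y : D.Idx) : Homog (x.1 : G)⁻¹ (y.1 : G)⁻¹ (M.e x y)
  | mul {l m l' m' a b} : Homog l m a → Homog l' m' b → Homog (l * l') (m * m') (a * b)
  | add {l m a b} : Homog l m a → Homog l m b → Homog l m (a + b)
  | smul {l m a} (c : k) : Homog l m a → Homog l m (c • a)

/-- `t ∈ A ⊗ A` is a sum of elements `a ⊗ b` with `a` of degrees `l` and `n` and `b` of degrees
`n` and `m`. -/
inductive Homog₂ : G → G → A ⊗[k] A → Prop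
  | zero (l m : G) : Homog₂ l m 0
  | tmul {l n m a b} : M.Homog l n a → M.Homog n m b → Homog₂ l m (a ⊗ₜ b)
  | add {l m s t} : Homog₂ l m s → Homog₂ l m t → Homog₂ l m (s + t)

variable {M}

theorem Homog.sum {ι : Type*} (s : Finset ι) {l m : G} {f : ι → A} (h : ∀ i ∈ s, M.Homog l m (f i)) :
    M.Homog l m (∑ i ∈ s, f i) :=
  Finset.sum_induction f (M.Homog l m) (fun _ _ => Homog.add) (Homog.zero l m) h

theorem Homog₂.sum {ι : Type*} (s : Finset ι) {l m : G} {f : ι → A ⊗[k] A}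
    (h : ∀ i ∈ s, M.Homog₂ l m (f i)) : M.Homog₂ l m (∑ i ∈ s, f i) :=
  Finset.sum_induction f (M.Homog₂ l m) (fun _ _ => Homog₂.add) (Homog₂.zero l m) h

theorem Homog.smul_gen {l m : G} {x y : D.Idx} {c : k}
    (h : c ≠ 0 → (x.1 : G)⁻¹ = l ∧ (y.1 : G)⁻¹ = m) : M.Homog l m (c • M.e x y) := by
  by_cases hc : c = 0
  · rw [hc, zero_smul]; exact Homog.zero _ _
  · obtain ⟨rfl, rfl⟩ := h hc
    exact (Homog.gen x y).smul c

variable (M) in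
theorem mem_closure_homog (a : A) : a ∈ AddSubmonoid.closure {a | ∃ l m, M.Homog l m a} := by
  induction a using M.induction with
  | one => exact AddSubmonoid.subset_closure ⟨_, _, Homog.one⟩
  | gen x y => exact AddSubmonoid.subset_closure ⟨_, _, Homog.gen x y⟩
  | add a b ha hb => exact add_mem ha hb
  | smul c a ha =>
    induction ha using AddSubmonoid.closure_induction with
    | mem a ha =>
      obtain ⟨l, m, ha⟩ := ha
      exact AddSubmonoid.subset_closure ⟨_, _, ha.smul c⟩
    | zero => rw [smul_zero]; exact zero_mem _
    | add a b _ _ ha hb => rw [smul_add]; exact add_mem ha hb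
  | mul a b ha hb =>
    induction ha using AddSubmonoid.closure_induction with
    | zero => rw [zero_mul]; exact zero_mem _
    | add a b _ _ ha hb => rw [add_mul]; exact add_mem ha hb
    | mem a ha =>
      induction hb using AddSubmonoid.closure_induction with
      | zero => rw [mul_zero]; exact zero_mem _
      | add a b _ _ ha hb => rw [mul_add]; exact add_mem ha hb
      | mem b hb =>
        obtain ⟨l, m, ha⟩ := ha
        obtain ⟨l', m', hb⟩ := hb
        exact AddSubmonoid.subset_closure ⟨_, _, ha.mul hb⟩

variable (M) in
theorem homog_induction {P : A → Prop} (homog : ∀ l m a, M.Homog l m a → P a)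
    (add : ∀ a b, P a → P b → P (a + b)) (a : A) : P a := by
  induction M.mem_closure_homog a using AddSubmonoid.closure_induction with
  | mem a ha => obtain ⟨l, m, ha⟩ := ha; exact homog l m a ha
  | zero => exact homog _ _ _ (Homog.zero 1 1)
  | add a b _ _ ha hb => exact add a b ha hb

theorem Homog.L {l m : G} {a : A} (h : M.Homog l m a) (g : G) :
    M.Homog (g * l * g⁻¹) m (M.L g a) := by
  induction h with
  | zero => rw [map_zero]; exact Homog.zero _ _
  | one => rw [map_one]; simpa using Homog.one
  | gen x y =>
    rw [L_e, hat_mul_unit]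
    refine Homog.sum _ fun v _ => Homog.smul_gen fun hv => ⟨?_, rfl⟩
    rw [rho_ne_zero hv]; group
  | @mul l m l' m' a b _ _ ha hb =>
    rw [map_mul]
    convert ha.mul hb using 1
    group
  | add _ _ ha hb => rw [map_add]; exact ha.add hb
  | smul c _ ha => rw [map_smul]; exact ha.smul c

theorem Homog.R {l m : G} {a : A} (h : M.Homog l m a) (g : G) :
    M.Homog l (g * m * g⁻¹) (M.R g a) := by
  induction h with
  | zero => rw [map_zero]; exact Homog.zero _ _
  | one => rw [map_one]; simpa using Homog.one
  | gen x y =>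
    rw [R_e, hat_unit_mul]
    refine Homog.sum _ fun v _ => Homog.smul_gen fun hv => ⟨rfl, ?_⟩
    rw [rho_ne_zero hv]; group
  | @mul l m l' m' a b _ _ ha hb =>
    rw [map_mul]
    convert ha.mul hb using 1
    group
  | add _ _ ha hb => rw [map_add]; exact ha.add hb
  | smul c _ ha => rw [map_smul]; exact ha.smul c

theorem Homog.act {l m : G} {a : A} (h : M.Homog l m a) (g : G) :
    M.Homog (g * l * g⁻¹) (g * m * g⁻¹) (M.act g a) := (h.R g).L g

theorem Homog.S {l m : G} {a : A} (h : M.Homog l m a) : M.Homog m⁻¹ l⁻¹ (M.S a) := by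
  induction h with
  | zero => rw [map_zero]; exact Homog.zero _ _
  | one => rw [S_one]; simpa using Homog.one
  | gen x y => rw [S_e]; simpa using Homog.gen (M := M) (hC.iota y) (hC.iota x)
  | mul _ _ ha hb => rw [S_mul, mul_inv_rev, mul_inv_rev]; exact hb.mul ha
  | add _ _ ha hb => rw [map_add]; exact ha.add hb
  | smul c _ ha => rw [map_smul]; exact ha.smul c

theorem Homog₂.mul {l m l' m' : G} {s t : A ⊗[k] A} (hs : M.Homog₂ l m s) (ht : M.Homog₂ l' m' t) :
    M.Homog₂ (l * l') (m * m') (s * t) := by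
  induction hs with
  | zero => rw [zero_mul]; exact Homog₂.zero _ _
  | add _ _ h1 h2 => rw [add_mul]; exact h1.add h2
  | tmul ha hb =>
    induction ht with
    | zero => rw [mul_zero]; exact Homog₂.zero _ _
    | add _ _ h1 h2 => rw [mul_add]; exact h1.add h2
    | tmul ha' hb' =>
      rw [Algebra.TensorProduct.tmul_mul_tmul]
      exact Homog₂.tmul (ha.mul ha') (hb.mul hb')

theorem Homog₂.smul {l m : G} {s : A ⊗[k] A} (c : k) (hs : M.Homog₂ l m s) :
    M.Homog₂ l m (c • s) := by
  induction hs with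
  | zero => rw [smul_zero]; exact Homog₂.zero _ _
  | add _ _ h1 h2 => rw [smul_add]; exact h1.add h2
  | tmul ha hb => rw [TensorProduct.smul_tmul']; exact Homog₂.tmul (ha.smul c) hb

theorem Homog.comul {l m : G} {a : A} (h : M.Homog l m a) : M.Homog₂ l m (M.comul a) := by
  induction h with
  | zero => rw [map_zero]; exact Homog₂.zero _ _
  | one => rw [map_one]; exact Homog₂.tmul Homog.one Homog.one
  | gen x y =>
    rw [comul_e]
    exact Homog₂.sum _ fun z _ => Homog₂.tmul (Homog.gen x z) (Homog.gen z y)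
  | mul _ _ ha hb => rw [map_mul]; exact ha.mul hb
  | add _ _ ha hb => rw [map_add]; exact ha.add hb
  | smul c _ ha =>
    rw [map_smul]
    exact ha.smul c

/-- This lets a linear functional on the `kG`-component detect the right degree, and gives the
closed forms of `R` and of the grading projections. -/
theorem Homog.beta {l m : G} {a : A} (h : M.Homog l m a) :
    M.beta a = MonoidAlgebra.single m (M.counit a) := by
  induction h with
  | zero => simp
  | one => simp [MonoidAlgebra.one_def]
  | gen x y => rw [beta_e, counit_e]
  | mul _ _ ha hb => simp [ha, hb]
  | add _ _ ha hb => simp [ha, hb]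
  | smul c _ ha => simp [ha]

theorem Homog.counit_eq_zero {l m : G} {a : A} (h : M.Homog l m a) (hlm : l ≠ m) :
    M.counit a = 0 := by
  -- Equality of these two elements of `kG` is multiplicative in `a`, hence provable by induction.
  -- On a generator either `ε = 0` or the two labels agree.
  have : MonoidAlgebra.single l (M.counit a) = MonoidAlgebra.single m (M.counit a) := by
    clear hlm
    induction h with
    | zero => simp
    | one => simp
    | gen x y =>
      rw [counit_e]
      split_ifs with hxy
      · rw [hxy]
      · simp
    | mul _ _ ha hb =>
      rw [map_mul, ← MonoidAlgebra.single_mul_single, ha, hb, MonoidAlgebra.single_mul_single]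
    | add _ _ ha hb => rw [map_add, MonoidAlgebra.single_add, MonoidAlgebra.single_add, ha, hb]
    | smul c _ ha => rw [map_smul, ← MonoidAlgebra.smul_single, ← MonoidAlgebra.smul_single, ha]
  by_contra h0
  have := congrArg (fun b => b.coeff l) this
  simp [hlm.symm, h0] at this

/-- The coordinate-free form of the FRT relations. It passes to products of homogeneous elements
because left and right translations commute. -/
theorem Homog.mul_L {l m : G} {a : A} (h : M.Homog l m a) (b : A) :
    a * M.L l⁻¹ b = M.R m b * a := by
  induction h generalizing b with
  | zero => simp
  | one => simp [L_one, R_one]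
  | gen x y => rw [inv_inv, quasi_comm_e]
  | @mul l m l' m' a a' _ _ ha ha' =>
    rw [mul_assoc, mul_inv_rev, ← L_L, ha', R_L, ← mul_assoc, ha, R_R, mul_assoc]
  | add _ _ ha hb => rw [add_mul, mul_add, ha, hb]
  | smul c _ ha => rw [smul_mul_assoc, mul_smul_comm, ha]

theorem span_dl_mul {l m l' m' : G} {F F' : DV k G}
    (ha : F ∈ Submodule.span k {F | ∃ u v : G, u * v * u⁻¹ = l ∧ v = m ∧ F = dl u v})
    (hb : F' ∈ Submodule.span k {F | ∃ u v : G, u * v * u⁻¹ = l' ∧ v = m' ∧ F = dl u v}) :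
    F * F' ∈ Submodule.span k
      {F | ∃ u v : G, u * v * u⁻¹ = l * l' ∧ v = m * m' ∧ F = dl u v} := by
  induction ha using Submodule.span_induction with
  | zero => rw [zero_mul]; exact zero_mem _
  | add _ _ _ _ h1 h2 => rw [add_mul]; exact add_mem h1 h2
  | smul c _ _ h1 => rw [smul_mul_assoc]; exact Submodule.smul_mem _ _ h1
  | mem F hF =>
    induction hb using Submodule.span_induction with
    | zero => rw [mul_zero]; exact zero_mem _
    | add _ _ _ _ h1 h2 => rw [mul_add]; exact add_mem h1 h2
    | smul c _ _ h1 => rw [mul_smul_comm]; exact Submodule.smul_mem _ _ h1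
    | mem F' hF' =>
      obtain ⟨u, v, rfl, rfl, rfl⟩ := hF
      obtain ⟨u', v', rfl, rfl, rfl⟩ := hF'
      rw [dl_mul_dl]
      split_ifs with hu
      · subst hu
        exact Submodule.subset_span ⟨u, _, by group, rfl, rfl⟩
      · exact zero_mem _

/-- The element `δ_u ⊗ v` of `D^∨(G)` carries the degrees `(uvu⁻¹, v)`, and `φ` respects them. The
crossed degree `l⁻¹m` then becomes `uv⁻¹u⁻¹v`, the degree used in `BD(G)`. -/
theorem Homog.φ_mem {l m : G} {a : A} (h : M.Homog l m a) :
    M.φ a ∈ Submodule.span k {F | ∃ u v : G, u * v * u⁻¹ = l ∧ v = m ∧ F = dl u v} := by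
  induction h with
  | zero => rw [map_zero]; exact zero_mem _
  | one =>
    rw [map_one, one_eq_sum_dl]
    exact sum_mem fun g _ => Submodule.subset_span ⟨g, 1, by simp, rfl, rfl⟩
  | gen x y =>
    have : M.φ (M.e x y) = ∑ g, D.rho g⁻¹ y x • dl g (y.1 : G)⁻¹ := by
      rw [φ_e]
      funext u
      simp [Finset.sum_apply, dl_apply]
    rw [this]
    refine sum_mem fun g _ => ?_
    by_cases hg : D.rho g⁻¹ y x = 0
    · rw [hg, zero_smul]; exact zero_mem _
    · refine Submodule.smul_mem _ _ (Submodule.subset_span ⟨g, _, ?_, rfl, rfl⟩)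
      rw [rho_ne_zero hg]; group
  | mul _ _ ha hb =>
    rw [map_mul]
    exact span_dl_mul ha hb
  | add _ _ ha hb => rw [map_add]; exact add_mem ha hb
  | smul c _ ha => rw [map_smul]; exact Submodule.smul_mem _ _ ha

end FRTModel

end Block
end QDouble
end

/-! ### The coquasitriangular structure of a model -/

noncomputable section

namespace QDouble

namespace Block

variable {k G : Type*} [Field k] [Group G] [Fintype G] [DecidableEq G] {D : Block k G}

namespace FRTModel

variable {hC : D.InvStable} {A : Type*} [Ring A] [Algebra k A] (M : FRTModel hC A)

/-- The coquasitriangular structure of `A`, pulled back from `D^∨(G)`. -/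
def coquasi : CoquasiData k A where
  comul := M.comul.toLinearMap
  counit := M.counit.toLinearMap
  R := (DVdata k G).R.compl₁₂ M.φ.toLinearMap M.φ.toLinearMap

theorem coord_φ (f : G) (a : A) : coord 1 f (M.φ a) = (M.beta a).coeff f := rfl

theorem coquasi_R (a b : A) : M.coquasi.R a b = ∑ f, (M.beta a).coeff f * M.alpha f b := by
  simp only [coquasi, LinearMap.compl₁₂_apply, AlgHom.toLinearMap_apply, DVdata_R, coord_φ]
  rfl

variable {M}

/-- When the two degrees differ, both sides vanish. So either degree may be used to evaluate `R(a,
·)`, as in `Homog.R_right` and `Homog.R_left`. -/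
theorem Homog.beta' {l m : G} {a : A} (h : M.Homog l m a) :
    M.beta a = MonoidAlgebra.single l (M.counit a) := by
  rw [h.beta]
  by_cases hlm : l = m
  · rw [hlm]
  · rw [h.counit_eq_zero hlm]; simp

theorem Homog.R_right {l m : G} {a : A} (h : M.Homog l m a) (b : A) :
    M.coquasi.R a b = M.counit a * M.alpha m b := by
  rw [coquasi_R, h.beta]
  simp [Finsupp.single_apply]

theorem Homog.R_left {l m : G} {a : A} (h : M.Homog l m a) (b : A) :
    M.coquasi.R a b = M.counit a * M.alpha l b := by
  rw [coquasi_R, h.beta']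
  simp [Finsupp.single_apply]

variable (M)

theorem alpha_mul (f h : G) (a : A) :
    TensorProduct.lid k k (TensorProduct.map (M.alpha f).toLinearMap (M.alpha h).toLinearMap
      (M.comul a)) = M.alpha (f * h) a := by
  have : ((Algebra.TensorProduct.lid k k).toAlgHom.comp
      (Algebra.TensorProduct.map (M.alpha f) (M.alpha h))).comp M.comul = M.alpha (f * h) :=
    M.algHom_ext fun x y => by
      simp only [AlgHom.comp_apply, comul_e, map_sum, Algebra.TensorProduct.map_tmul, alpha_e,
        mul_inv_rev, ← sum_rho_mul]
      refine Finset.sum_congr rfl fun z _ => ?_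
      exact mul_comm _ _
  exact DFunLike.congr_fun this a

theorem counit_mul_counit (a : A) :
    TensorProduct.lid k k (TensorProduct.map M.counit.toLinearMap M.counit.toLinearMap
      (M.comul a)) = M.counit a := by
  have := M.alpha_mul 1 1 a
  rwa [mul_one, alpha_one] at this

theorem L_apply (g : G) (a : A) : M.L g a =
    TensorProduct.lid k A (TensorProduct.map (M.alpha g⁻¹).toLinearMap LinearMap.id (M.comul a)) :=
  rfl

theorem R_apply (g : G) (a : A) : M.R g a =
    TensorProduct.rid k A (TensorProduct.map LinearMap.id (M.alpha g).toLinearMap (M.comul a)) :=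
  rfl

variable {M} in
theorem Homog₂.R_flip {l m : G} {s : A ⊗[k] A} (hs : M.Homog₂ l m s) (b c : A) :
    TensorProduct.lid k k (TensorProduct.map (M.coquasi.R.flip c) (M.coquasi.R.flip b) s) =
      TensorProduct.lid k k (TensorProduct.map M.counit.toLinearMap M.counit.toLinearMap s) *
        M.alpha m (b * c) := by
  induction hs with
  | zero => simp
  | add _ _ h1 h2 => rw [map_add, map_add, h1, h2, map_add, map_add, add_mul]
  | @tmul n m a a' ha ha' =>
    simp only [TensorProduct.map_tmul, LinearMap.flip_apply, TensorProduct.lid_tmul, smul_eq_mul,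
      AlgHom.toLinearMap_apply, ha.R_right, ha'.R_right, map_mul]
    by_cases hn : n = m
    · rw [hn]; ring
    · rw [ha'.counit_eq_zero hn]; ring

variable {M} in
-- A bilinear form of the shape `ε(a) f_m(b)` convolves only in its second argument. Arbitrary
-- families `f`, `f'` are allowed so that both orders of the product of `R` with its inverse are
-- covered.
theorem Homog₂.conv {l m : G} {s : A ⊗[k] A} (hs : M.Homog₂ l m s) {R R' : A →ₗ[k] A →ₗ[k] k}
    {f f' : G → A →ₗ[k] k} (hR : ∀ l m a b, M.Homog l m a → R a b = M.counit a * f m b)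
    (hR' : ∀ l m a b, M.Homog l m a → R' a b = M.counit a * f' m b) (t : A ⊗[k] A) :
    TensorProduct.lid k k (TensorProduct.map (TensorProduct.lift R) (TensorProduct.lift R')
        (TensorProduct.tensorTensorTensorComm k A A A A (s ⊗ₜ t))) =
      TensorProduct.lid k k (TensorProduct.map M.counit.toLinearMap M.counit.toLinearMap s) *
        TensorProduct.lid k k (TensorProduct.map (f m) (f' m) t) := by
  induction hs with
  | zero => simp
  | add _ _ h1 h2 =>
    rw [TensorProduct.add_tmul, map_add, map_add, map_add, h1, h2, map_add, map_add, add_mul]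
  | @tmul n m a a' ha ha' =>
    induction t with
    | zero => simp
    | add t t' h1 h2 =>
      rw [TensorProduct.tmul_add, map_add, map_add, map_add, h1, h2, map_add, map_add, mul_add]
    | tmul b b' =>
      simp only [TensorProduct.tensorTensorTensorComm_tmul, TensorProduct.map_tmul,
        TensorProduct.lift.tmul, TensorProduct.lid_tmul, smul_eq_mul, AlgHom.toLinearMap_apply,
        hR l n a b ha, hR' n m a' b' ha']
      -- The first form is evaluated at the middle degree `n`; it may be replaced by `m` because `ε`
      -- kills the second leg when `n ≠ m`.
      by_cases hn : n = m
      · rw [hn]; ring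
      · rw [ha'.counit_eq_zero hn]; ring

variable {M} in
-- The first leg of `s` always has left degree `l`, whatever the middle degree, so `α_l` factors
-- out. In `Homog₂.quasi_right` the right degree `m` of the second leg plays the same part.
theorem Homog₂.quasi_left {l m : G} {s : A ⊗[k] A} (hs : M.Homog₂ l m s) (t : A ⊗[k] A) :
    TensorProduct.lid k A (TensorProduct.map (TensorProduct.lift M.coquasi.R)
        (TensorProduct.lift (LinearMap.mul k A))
        (TensorProduct.tensorTensorTensorComm k A A A A (s ⊗ₜ t))) =
      TensorProduct.lid k A (M.counit.toLinearMap.rTensor A s) *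
        TensorProduct.lid k A (TensorProduct.map (M.alpha l).toLinearMap LinearMap.id t) := by
  induction hs with
  | zero => simp
  | add _ _ h1 h2 =>
    rw [TensorProduct.add_tmul, map_add, map_add, map_add, h1, h2, map_add, map_add, add_mul]
  | @tmul n m a a' ha ha' =>
    induction t with
    | zero => simp
    | add t t' h1 h2 =>
      rw [TensorProduct.tmul_add, map_add, map_add, map_add, h1, h2, map_add, map_add, mul_add]
    | tmul b b' =>
      simp [ha.R_left, smul_smul, mul_comm]

variable {M} in
theorem Homog₂.quasi_right {l m : G} {s : A ⊗[k] A} (hs : M.Homog₂ l m s) (t : A ⊗[k] A) :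
    TensorProduct.rid k A (TensorProduct.map (TensorProduct.lift (LinearMap.mul k A).flip)
        (TensorProduct.lift M.coquasi.R)
        (TensorProduct.tensorTensorTensorComm k A A A A (s ⊗ₜ t))) =
      TensorProduct.rid k A (TensorProduct.map LinearMap.id (M.alpha m).toLinearMap t) *
        TensorProduct.rid k A (M.counit.toLinearMap.lTensor A s) := by
  induction hs with
  | zero => simp
  | add _ _ h1 h2 =>
    rw [TensorProduct.add_tmul, map_add, map_add, map_add, h1, h2, map_add, map_add, mul_add]
  | @tmul n m a a' ha ha' =>
    induction t with
    | zero => simp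
    | add t t' h1 h2 =>
      rw [TensorProduct.tmul_add, map_add, map_add, map_add, h1, h2, map_add, map_add, add_mul]
    | tmul b b' =>
      simp [ha'.R_right, smul_smul]

theorem isCoquasiBialgebra (hπ : D.IsOrthogonal) (hq : hC.Compatible) :
    IsCoquasiBialgebra M.coquasi where
  coassoc := M.coassoc
  counit_comul := M.counit_comul
  comul_counit := M.comul_counit
  comul_mul := map_mul M.comul
  comul_one := map_one M.comul
  counit_mul := map_mul M.counit
  counit_one := map_one M.counit
  invertible := by
    have hR : ∀ l m a b, M.Homog l m a →
        M.coquasi.R a b = M.counit a * (M.alpha m).toLinearMap b := fun l m a b h => h.R_right b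
    have hR' : ∀ l m a b, M.Homog l m a →
        M.coquasi.R.compl₂ M.S a b = M.counit a * (M.alpha m⁻¹).toLinearMap b := by
      intro l m a b h
      rw [LinearMap.compl₂_apply, h.R_right, alpha_S M hπ hq]
      rfl
    -- The inverse of `R` is `R(a, S b)`, because `α_m ∘ S = α_{m⁻¹}` is the convolution inverse of
    -- `α_m`. That `S` be an antipode is not required.
    refine ⟨M.coquasi.R.compl₂ M.S, fun a b => ?_⟩
    induction a using M.homog_induction with
    | homog l m a ha =>
      have h1 := ha.comul.conv hR hR' (M.comul b)
      have h2 := ha.comul.conv hR' hR (M.comul b)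
      rw [counit_mul_counit, alpha_mul] at h1 h2
      rw [mul_inv_cancel, alpha_one] at h1
      rw [inv_mul_cancel, alpha_one] at h2
      exact ⟨h1, h2⟩
    | add a a' h1 h2 =>
      simp only [CoquasiData.conv, CoquasiData.comul₂, map_add, TensorProduct.add_tmul,
        add_mul] at h1 h2 ⊢
      exact ⟨by rw [h1.1, h2.1], by rw [h1.2, h2.2]⟩
  R_mul_left a b c := by
    induction a using M.homog_induction with
    | add a a' h1 h2 => simp only [add_mul, map_add, LinearMap.add_apply, h1, h2,
        TensorProduct.map_add_left]
    | homog l m a ha =>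
      induction b using M.homog_induction with
      | add b b' h1 h2 => simp only [mul_add, map_add, LinearMap.add_apply, h1, h2,
          TensorProduct.map_add_right]
      | homog l' m' b hb =>
        have h1 : M.coquasi.R a = M.counit a • (M.alpha m).toLinearMap :=
          LinearMap.ext fun c => ha.R_right c
        have h2 : M.coquasi.R b = M.counit b • (M.alpha m').toLinearMap :=
          LinearMap.ext fun c => hb.R_right c
        rw [h1, h2, (ha.mul hb).R_right, ← alpha_mul, TensorProduct.map_smul_left,
          TensorProduct.map_smul_right, map_mul]
        simp only [LinearMap.smul_apply, map_smul, smul_eq_mul, mul_assoc]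
        rfl
  R_mul_right a b c := by
    induction a using M.homog_induction with
    | add a a' h1 h2 => simp only [map_add, LinearMap.add_apply, h1, h2]
    | homog l m a ha =>
      have := ha.comul.R_flip b c
      rw [counit_mul_counit, ← ha.R_right] at this
      exact this.symm
  quasi_comm a b := by
    induction a using M.homog_induction with
    | add a a' h1 h2 =>
      simp only [CoquasiData.comul₂, map_add, TensorProduct.add_tmul] at h1 h2 ⊢
      rw [h1, h2]
    | homog l m a ha =>
      have h1 := ha.comul.quasi_left (M.comul b)
      have h2 := ha.comul.quasi_right (M.comul b)
      -- The two sides of quasi-commutativity are `a · L_{l⁻¹}(b)` and `R_m(b) · a`.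
      have h3 := ha.mul_L b
      rw [L_apply, inv_inv, R_apply] at h3
      rw [counit_comul, h3] at h1
      rw [comul_counit] at h2
      exact h1.trans h2.symm

theorem isMatrixCoquasi (hπ : D.IsOrthogonal) (hq : hC.Compatible) :
    D.IsMatrixCoquasi M.e M.coquasi where
  toIsCoquasiBialgebra := M.isCoquasiBialgebra hπ hq
  comul_gen := M.comul_e
  counit_gen := M.counit_e
  R_gen x y z w := by
    rw [(Homog.gen x y).R_right, alpha_e, counit_e, inv_inv, Rmat_eq]
    simp [eq_comm]

theorem isCoquasiMap : IsCoquasiMap M.coquasi (DVdata k G) M.φ where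
  map_comul a := by
    have : (DVcomul k G).comp M.φ = (Algebra.TensorProduct.map M.φ M.φ).comp M.comul :=
      M.algHom_ext fun x y => by
        have hφ : ∀ x y, M.φ (M.e x y) = ∑ g, D.rho g⁻¹ y x • dl g (y.1 : G)⁻¹ := by
          intro x y
          rw [φ_e]
          funext u
          simp [Finset.sum_apply, dl_apply]
        -- The sum over `g` is reindexed by `g = f h`, so that the coefficient is an entry of a
        -- product of two `ρ`-matrices.
        have hl : DVcomul k G (M.φ (M.e x y)) = ∑ f, ∑ h, D.rho (f * h)⁻¹ y x •
            (dl f (h * (y.1 : G)⁻¹ * h⁻¹) ⊗ₜ[k] dl h (y.1 : G)⁻¹) := by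
          simp only [hφ, map_sum, map_smul, DVcomul, AlgHom.ofLinearMap_apply, DVdata_comul_dl,
            Finset.smul_sum]
          rw [Finset.sum_comm]
          refine Finset.sum_congr rfl fun f _ => ?_
          rw [← Equiv.sum_comp (Equiv.mulLeft f)]
          refine Finset.sum_congr rfl fun h _ => ?_
          simp [mul_assoc]
        have hr : ∀ z f h, (D.rho f⁻¹ z x • dl f (z.1 : G)⁻¹) ⊗ₜ[k]
            (D.rho h⁻¹ y z • dl h (y.1 : G)⁻¹) = (D.rho h⁻¹ y z * D.rho f⁻¹ z x) •
            (dl f (h * (y.1 : G)⁻¹ * h⁻¹) ⊗ₜ[k] dl h (y.1 : G)⁻¹ : DV k G ⊗[k] DV k G) := by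
          intro z f h
          rw [TensorProduct.smul_tmul_smul, mul_comm]
          -- A nonzero entry forces `y = h⁻¹zh`, that is `z⁻¹ = h y⁻¹ h⁻¹`.
          by_cases h0 : D.rho h⁻¹ y z = 0
          · rw [h0, zero_mul, zero_smul, zero_smul]
          · rw [rho_ne_zero h0]
            congr 3
            group
        simp only [AlgHom.comp_apply]
        rw [hl]
        simp only [comul_e, map_sum, Algebra.TensorProduct.map_tmul, hφ, TensorProduct.sum_tmul,
          TensorProduct.tmul_sum, hr]
        rw [Finset.sum_comm_cycle]
        refine Finset.sum_congr rfl fun f _ => ?_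
        rw [Finset.sum_comm]
        refine Finset.sum_congr rfl fun h _ => ?_
        rw [← Finset.sum_smul, sum_rho_mul, mul_inv_rev]
    exact DFunLike.congr_fun this a
  map_counit a := by
    rw [DVdata_counit]
    have := DFunLike.congr_fun M.alpha_one a
    exact this
  map_R a b := rfl

/-! ### Adjoint coaction and transmuted product in closed form -/

/-- The right adjoint coaction `x₂ ⊗ (S x₁) x₃`. -/
def adR : A →ₗ[k] A ⊗[k] A := M.coquasi.adR M.S

theorem adR_apply (a : A) : M.adR a =
    (TensorProduct.lift (LinearMap.mul k A) ∘ₗ M.S.rTensor A).lTensor A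
      (TensorProduct.leftComm k A A A (M.comul.toLinearMap.lTensor A (M.comul a))) := rfl

/-- The factor `α_g(S x₁) = α_{g⁻¹}(x₁)` produces the left translation by `g`, and `α_g(x₃)` the
right one. -/
theorem adR_alpha (hπ : D.IsOrthogonal) (hq : hC.Compatible) (g : G) (a : A) :
    TensorProduct.rid k A ((M.alpha g).toLinearMap.lTensor A (M.adR a)) = M.act g a := by
  rw [act_apply, L_apply, comul_R, adR_apply]
  induction M.comul a with
  | zero => simp
  | add s t hs ht => simp only [map_add, hs, ht]
  | tmul b c =>
    rw [LinearMap.lTensor_tmul, Algebra.TensorProduct.map_tmul, TensorProduct.map_tmul, R_apply,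
      AlgHom.toLinearMap_apply]
    induction M.comul c with
    | zero => simp
    | add s t hs ht => simp only [map_add, TensorProduct.tmul_add, hs, ht]
    | tmul c c' => simp [alpha_S M hπ hq, smul_smul, mul_comm]

variable {M} in
-- If `x₁` has left degree `l`, then `S x₁` has right degree `l⁻¹`, and `x₃` has right degree `m`.
-- The right degree of `(S x₁) x₃` is thus `l⁻¹m` in every term; only its left degree varies.
theorem Homog.adR {l m : G} {a : A} (ha : M.Homog l m a) :
    M.adR a ∈ Submodule.span k {u | ∃ p b c, M.Homog p (l⁻¹ * m) c ∧ u = b ⊗ₜ[k] c} := by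
  rw [adR_apply]
  have h := ha.comul
  revert h
  generalize M.comul a = s
  intro h
  clear ha
  induction h with
  | zero => rw [map_zero, map_zero, map_zero]; exact zero_mem _
  | add _ _ h1 h2 => rw [map_add, map_add, map_add]; exact add_mem h1 h2
  | @tmul n m b c hb hc =>
    rw [LinearMap.lTensor_tmul, AlgHom.toLinearMap_apply]
    have h := hc.comul
    revert h
    generalize M.comul c = s
    intro h
    clear hc
    induction h with
    | zero => rw [TensorProduct.tmul_zero, map_zero, map_zero]; exact zero_mem _
    | add _ _ h1 h2 =>
      rw [TensorProduct.tmul_add, map_add, map_add]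
      exact add_mem h1 h2
    | tmul hc hc' => exact Submodule.subset_span ⟨_, _, _, hb.S.mul hc', rfl⟩

/-- The transmutation of `A`. -/
def trans : BraidedData k G A := transmutation M.coquasi M.S M.φ

theorem trans_comul : M.trans.comul = M.comul.toLinearMap := rfl

theorem trans_counit : M.trans.counit = M.counit.toLinearMap := rfl

theorem trans_act (hπ : D.IsOrthogonal) (hq : hC.Compatible) (g : G) :
    M.trans.act g = (M.act g).toLinearMap := by
  refine LinearMap.ext fun a => ?_
  rw [AlgHom.toLinearMap_apply, ← M.adR_alpha hπ hq]
  simp only [trans, transmutation, sum_coord]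
  rfl

variable {M} in
theorem Homog.trans_proj {l m : G} {a : A} (ha : M.Homog l m a) (hπ : D.IsOrthogonal)
    (hq : hC.Compatible) (f : G) : M.trans.proj f a = if l⁻¹ * m = f then a else 0 := by
  have h1 : M.trans.proj f a = TensorProduct.rid k A
      ((coord 1 f ∘ₗ M.φ.toLinearMap).lTensor A (M.adR a)) := rfl
  -- Counitality of the coaction, obtained from `adR_alpha` at `g = 1`. It reduces the claim to a
  -- comparison on each term of `adR a`.
  have h2 : a = TensorProduct.rid k A (M.counit.toLinearMap.lTensor A (M.adR a)) := by
    have := M.adR_alpha hπ hq 1 a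
    rw [alpha_one, act_one] at this
    exact this.symm
  rw [h1]
  conv_rhs => rw [h2]
  have h3 := ha.adR
  revert h3
  generalize M.adR a = u
  intro h3
  induction h3 using Submodule.span_induction with
  | zero => simp
  | add u v _ _ hu hv =>
    simp only [map_add, hu, hv]
    split_ifs <;> simp
  | smul c u _ hu =>
    simp only [map_smul, hu]
    split_ifs <;> simp
  | mem u hu =>
    obtain ⟨p, b, c, hc, rfl⟩ := hu
    simp only [LinearMap.lTensor_tmul, LinearMap.comp_apply, AlgHom.toLinearMap_apply, coord_φ,
      hc.beta, TensorProduct.rid_tmul]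
    by_cases h : l⁻¹ * m = f
    · simp [h]
    · simp [h]

variable {M} in
-- Every term `(S a₁) a₃` has right degree `l⁻¹m`, so `R((S a₁) a₃, S b₁)` is its counit times
-- `α_{(l⁻¹m)⁻¹}(b₁)`. This last factor is the one defining `L_{l⁻¹m}(b)`.
theorem Homog.trans_mul {l m : G} {a : A} (ha : M.Homog l m a) (hπ : D.IsOrthogonal)
    (hq : hC.Compatible) (b : A) : M.trans.mul a b = a * M.L (l⁻¹ * m) b := by
  have h1 : M.trans.mul a b = TensorProduct.rid k A
      (TensorProduct.map₂ (LinearMap.mul k A) (M.coquasi.R.compl₂ M.S) (M.adR a)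
        (TensorProduct.comm k A A (M.comul b))) := rfl
  have h2 : a = TensorProduct.rid k A (M.counit.toLinearMap.lTensor A (M.adR a)) := by
    have := M.adR_alpha hπ hq 1 a
    rw [alpha_one, act_one] at this
    exact this.symm
  rw [h1]
  conv_rhs => rw [h2]
  rw [L_apply]
  have h3 := ha.adR
  revert h3
  generalize M.adR a = u
  intro h3
  induction h3 using Submodule.span_induction with
  | zero => simp
  | add u v _ _ hu hv => simp only [map_add, LinearMap.add_apply, hu, hv, add_mul]
  | smul c u _ hu => simp only [map_smul, LinearMap.smul_apply, hu, smul_mul_assoc]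
  | mem u hu =>
    obtain ⟨p, b', c, hc, rfl⟩ := hu
    induction M.comul b with
    | zero => simp
    | add s t hs ht => simp only [map_add, hs, ht, mul_add]
    | tmul x y => simp [hc.R_right, alpha_S M hπ hq, smul_smul, mul_comm (M.counit c)]

variable {M} in
-- The FRT relation moves `a` past `L_{l⁻¹}(L_m b)`. The product thus becomes the opposite product
-- of `A` twisted by the action.
theorem Homog.trans_mul' {l m : G} {a : A} (ha : M.Homog l m a) (hπ : D.IsOrthogonal)
    (hq : hC.Compatible) (b : A) : M.trans.mul a b = M.act m b * a := by
  rw [ha.trans_mul hπ hq, act_apply, ← R_L, ← ha.mul_L, L_L]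

end FRTModel

end Block
end QDouble
end

/-! ### The transmutation is a braided bialgebra -/

noncomputable section

namespace QDouble

namespace Block

variable {k G : Type*} [Field k] [Group G] [Fintype G] [DecidableEq G] {D : Block k G}

namespace FRTModel

variable {hC : D.InvStable} {A : Type*} [Ring A] [Algebra k A] (M : FRTModel hC A)

variable {M} in
-- The left degree of a transmuted product is twisted, and precisely so that the crossed degree
-- `l⁻¹m` is multiplicative.
theorem Homog.trans_mul_homog {l m l' m' : G} {a b : A} (ha : M.Homog l m a)
    (hb : M.Homog l' m' b) (hπ : D.IsOrthogonal) (hq : hC.Compatible) :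
    M.Homog (m * l' * m⁻¹ * l) (m * m') (M.trans.mul a b) := by
  rw [ha.trans_mul hπ hq]
  convert ha.mul (hb.L (l⁻¹ * m)) using 1
  group

variable {M} in
theorem Homog₂.sum_proj {l m : G} {s : A ⊗[k] A} (hs : M.Homog₂ l m s) (hπ : D.IsOrthogonal)
    (hq : hC.Compatible) (g : G) :
    ∑ f, TensorProduct.map (M.trans.proj f) (M.trans.proj (f⁻¹ * g)) s =
      if l⁻¹ * m = g then s else 0 := by
  induction hs with
  | zero => simp
  | add _ _ h1 h2 =>
    simp only [map_add, Finset.sum_add_distrib, h1, h2]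
    split_ifs <;> simp
  | @tmul n m a b ha hb =>
    simp only [TensorProduct.map_tmul, ha.trans_proj hπ hq, hb.trans_proj hπ hq]
    rw [Finset.sum_eq_single (l⁻¹ * n)]
    · have : n⁻¹ * m = (l⁻¹ * n)⁻¹ * g ↔ l⁻¹ * m = g := by
        rw [eq_inv_mul_iff_mul_eq, mul_assoc, mul_inv_cancel_left]
      by_cases h : l⁻¹ * m = g
      · rw [if_pos rfl, if_pos (this.2 h), if_pos h]
      · rw [if_neg fun h' => h (this.1 h'), if_neg h, TensorProduct.tmul_zero]
    · intro f _ hf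
      rw [if_neg hf.symm, TensorProduct.zero_tmul]
    · simp

theorem tensorMul_tmul {V : Type*} [AddCommGroup V] [Module k V] (X : BraidedData k G V)
    (a b c d : V) : X.tensorMul (a ⊗ₜ b) (c ⊗ₜ d) =
      ∑ g, X.mul a (X.act g c) ⊗ₜ X.mul (X.proj g b) d := by
  simp [BraidedData.tensorMul, LinearMap.sum_apply]

variable {M} in
-- For legs of degrees `(l, n)` and `(n, m)`, the translation `R ⊗ L` by `n⁻¹m`, which fixes the
-- coproduct of `b`, supplies the twist of the second product and completes the braiding in the
-- first. The middle degree then cancels from `(l⁻¹n)(n⁻¹m)`. Multiplicativity of the transmuted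
-- coproduct is thereby reduced to that of the ordinary one.
theorem Homog₂.tensorMul {l m : G} {s : A ⊗[k] A} (hs : M.Homog₂ l m s) (hπ : D.IsOrthogonal)
    (hq : hC.Compatible) (b : A) : M.trans.tensorMul s (M.comul b) =
      s * M.comul (M.L (l⁻¹ * m) b) := by
  induction hs with
  | zero => simp
  | add _ _ h1 h2 => rw [map_add, LinearMap.add_apply, h1, h2, add_mul]
  | @tmul n m a a' ha ha' =>
    rw [comul_L]
    conv_rhs => rw [← M.map_R_L_comul (n⁻¹ * m) b]
    induction M.comul b with
    | zero => simp
    | add t t' h1 h2 => simp only [map_add, h1, h2, mul_add]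
    | tmul c d =>
      rw [tensorMul_tmul, Finset.sum_eq_single (n⁻¹ * m)]
      · rw [ha'.trans_proj hπ hq, if_pos rfl, ha.trans_mul hπ hq, ha'.trans_mul hπ hq,
          trans_act M hπ hq, AlgHom.toLinearMap_apply, act_apply, L_L]
        simp [mul_assoc]
      · intro g _ hg
        rw [ha'.trans_proj hπ hq, if_neg hg.symm]
        simp
      · simp

theorem trans_isBraidedBialgebra (hπ : D.IsOrthogonal) (hq : hC.Compatible) :
    IsBraidedBialgebra M.trans where
  act_one := by rw [trans_act M hπ hq, act_one]; rfl
  act_mul g h := by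
    rw [trans_act M hπ hq, trans_act M hπ hq, trans_act M hπ hq]
    exact LinearMap.ext fun a => (M.act_act g h a).symm
  proj_proj g h := by
    refine LinearMap.ext fun a => ?_
    induction a using M.homog_induction with
    | add a b ha hb => rw [map_add, map_add, ha, hb]
    | homog l m a ha =>
      rw [LinearMap.comp_apply, ha.trans_proj hπ hq]
      by_cases hg : g = h
      · subst hg
        rw [if_pos rfl, ha.trans_proj hπ hq]
        split_ifs with h1
        · rw [ha.trans_proj hπ hq, if_pos h1]
        · simp
      · rw [if_neg hg]
        split_ifs with h1
        · rw [ha.trans_proj hπ hq, if_neg fun h2 => hg (h2.symm.trans h1)]; rfl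
        · simp
  sum_proj := by
    refine LinearMap.ext fun a => ?_
    induction a using M.homog_induction with
    | add a b ha hb => rw [map_add, map_add, ha, hb]
    | homog l m a ha => simp [LinearMap.sum_apply, ha.trans_proj hπ hq]
  act_proj h g := by
    refine LinearMap.ext fun a => ?_
    induction a using M.homog_induction with
    | add a b ha hb => rw [map_add, map_add, ha, hb]
    | homog l m a ha =>
      simp only [LinearMap.comp_apply, trans_act M hπ hq, AlgHom.toLinearMap_apply,
        ha.trans_proj hπ hq, (ha.act h).trans_proj hπ hq]
      have : (h * l * h⁻¹)⁻¹ * (h * m * h⁻¹) = h * g * h⁻¹ ↔ l⁻¹ * m = g := by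
        have h1 : (h * l * h⁻¹)⁻¹ * (h * m * h⁻¹) = h * (l⁻¹ * m) * h⁻¹ := by group
        rw [h1, mul_left_inj, mul_right_inj]
      by_cases hg : l⁻¹ * m = g
      · rw [if_pos hg, if_pos (this.2 hg)]
      · rw [if_neg hg, if_neg fun h' => hg (this.1 h'), map_zero]
  mul_assoc x y z := by
    induction x using M.homog_induction with
    | add a b ha hb => simp only [map_add, LinearMap.add_apply, ha, hb]
    | homog l m a ha =>
      induction y using M.homog_induction with
      | add a b ha hb => simp only [map_add, LinearMap.add_apply, ha, hb]
      | homog l' m' b hb =>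
        -- Both bracketings equal `(mm' ▷ z) · (m ▷ b) · a` in the ordinary product.
        rw [(ha.trans_mul_homog hb hπ hq).trans_mul' hπ hq, ha.trans_mul' hπ hq,
          ha.trans_mul' hπ hq, hb.trans_mul' hπ hq, map_mul, act_act, mul_assoc]
  one_mul x := by
    change M.trans.mul 1 x = x
    rw [Homog.one.trans_mul' hπ hq, act_one, mul_one, AlgHom.id_apply]
  mul_one x := by
    change M.trans.mul x 1 = x
    induction x using M.homog_induction with
    | add a b ha hb => simp only [map_add, LinearMap.add_apply, ha, hb]
    | homog l m a ha => rw [ha.trans_mul' hπ hq, map_one, one_mul]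
  coassoc := M.coassoc
  counit_comul := M.counit_comul
  comul_counit := M.comul_counit
  act_mul_map g x y := by
    rw [trans_act M hπ hq]
    simp only [AlgHom.toLinearMap_apply]
    induction x using M.homog_induction with
    | add a b ha hb => simp only [map_add, LinearMap.add_apply, ha, hb]
    | homog l m a ha =>
      rw [ha.trans_mul' hπ hq, (ha.act g).trans_mul' hπ hq, map_mul, act_act, act_act]
      simp
  proj_mul_map g x y := by
    induction x using M.homog_induction with
    | add a b ha hb => simp only [map_add, LinearMap.add_apply, ha, hb, Finset.sum_add_distrib]
    | homog l m a ha =>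
      induction y using M.homog_induction with
      | add a b ha hb => simp only [map_add, ha, hb, Finset.sum_add_distrib]
      | homog l' m' b hb =>
        rw [(ha.trans_mul_homog hb hπ hq).trans_proj hπ hq, Finset.sum_eq_single (l⁻¹ * m)]
        · rw [ha.trans_proj hπ hq, hb.trans_proj hπ hq, if_pos rfl]
          have : (m * l' * m⁻¹ * l)⁻¹ * (m * m') = g ↔ l'⁻¹ * m' = (l⁻¹ * m)⁻¹ * g := by
            rw [eq_inv_mul_iff_mul_eq]
            have h1 : (m * l' * m⁻¹ * l)⁻¹ * (m * m') = l⁻¹ * m * (l'⁻¹ * m') := by group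
            rw [h1]
          by_cases h : l'⁻¹ * m' = (l⁻¹ * m)⁻¹ * g
          · rw [if_pos h, if_pos (this.2 h)]
          · rw [if_neg h, if_neg fun h' => h (this.1 h'), map_zero]
        · intro f _ hf
          rw [ha.trans_proj hπ hq, if_neg hf.symm, map_zero, LinearMap.zero_apply]
        · simp
  act_one_map g := by
    rw [trans_act M hπ hq]
    exact map_one (M.act g)
  proj_one_map := by
    change M.trans.proj 1 1 = 1
    rw [Homog.one.trans_proj hπ hq]
    simp
  comul_act g x := by
    rw [trans_act M hπ hq]
    exact M.comul_act g x
  comul_proj g x := by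
    rw [trans_comul, AlgHom.toLinearMap_apply, AlgHom.toLinearMap_apply]
    induction x using M.homog_induction with
    | add a b ha hb => simp only [map_add, ha, hb, Finset.sum_add_distrib]
    | homog l m a ha =>
      rw [ha.comul.sum_proj hπ hq, ha.trans_proj hπ hq]
      split_ifs <;> simp
  counit_act g x := by
    rw [trans_act M hπ hq]
    exact M.counit_act g x
  counit_proj g x := by
    rw [trans_counit, AlgHom.toLinearMap_apply, AlgHom.toLinearMap_apply]
    induction x using M.homog_induction with
    | add a b ha hb =>
      simp only [map_add, ha, hb]
      split_ifs <;> simp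
    | homog l m a ha =>
      rw [ha.trans_proj hπ hq]
      by_cases hlm : l = m
      · subst hlm
        rw [inv_mul_cancel]
        by_cases hg : g = 1
        · rw [if_pos hg, if_pos hg.symm]
        · rw [if_neg hg, if_neg (Ne.symm hg), map_zero]
      · rw [ha.counit_eq_zero hlm]
        split_ifs
        · exact ha.counit_eq_zero hlm
        · exact ha.counit_eq_zero hlm
        all_goals exact map_zero _
  comul_mul x y := by
    rw [trans_comul]
    simp only [AlgHom.toLinearMap_apply]
    induction x using M.homog_induction with
    | add a b ha hb => simp only [map_add, LinearMap.add_apply, ha, hb]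
    | homog l m a ha => rw [ha.trans_mul hπ hq, map_mul, ha.comul.tensorMul hπ hq]
  comul_one := map_one M.comul
  counit_mul x y := by
    rw [trans_counit]
    simp only [AlgHom.toLinearMap_apply]
    induction x using M.homog_induction with
    | add a b ha hb => simp only [map_add, LinearMap.add_apply, ha, hb, add_mul]
    | homog l m a ha =>
      rw [ha.trans_mul hπ hq, map_mul]
      -- If the degrees agree, the translation is trivial; otherwise `ε(a) = 0`.
      by_cases hlm : l = m
      · rw [hlm, inv_mul_cancel, L_one, AlgHom.id_apply]
      · rw [ha.counit_eq_zero hlm, zero_mul, zero_mul]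
  counit_one := map_one M.counit

/-! ### The braided antipode -/

/-- The braided antipode of the transmutation of `A`. -/
def brS : A →ₗ[k] A := ∑ f, M.S ∘ₗ (M.R f).toLinearMap ∘ₗ M.trans.proj f

variable {M}

theorem Homog.brS_eq {l m : G} {a : A} (ha : M.Homog l m a) (hπ : D.IsOrthogonal)
    (hq : hC.Compatible) : M.brS a = M.S (M.R (l⁻¹ * m) a) := by
  rw [brS, LinearMap.sum_apply, Finset.sum_eq_single (l⁻¹ * m)]
  · simp [ha.trans_proj hπ hq]
  · intro f _ hf
    simp [ha.trans_proj hπ hq, hf.symm]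
  · simp

theorem Homog.brS {l m : G} {a : A} (ha : M.Homog l m a) (hπ : D.IsOrthogonal)
    (hq : hC.Compatible) : M.Homog (l⁻¹ * m⁻¹ * l) l⁻¹ (M.brS a) := by
  rw [ha.brS_eq hπ hq]
  convert (ha.R (l⁻¹ * m)).S using 1
  group

variable (M)

theorem brS_isCrossedEnd (hπ : D.IsOrthogonal) (hq : hC.Compatible) :
    IsCrossedEnd M.trans M.brS where
  map_act g x := by
    rw [trans_act M hπ hq, AlgHom.toLinearMap_apply, AlgHom.toLinearMap_apply]
    induction x using M.homog_induction with
    | add a b ha hb => simp only [map_add, ha, hb]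
    | homog l m a ha =>
      rw [ha.brS_eq hπ hq, (ha.act g).brS_eq hπ hq, act_apply, act_apply, ← S_L M hπ hq,
        ← S_R M hπ hq, R_L, R_R, R_L, R_R]
      congr 3
      group
  map_proj g x := by
    induction x using M.homog_induction with
    | add a b ha hb => simp only [map_add, ha, hb]
    | homog l m a ha =>
      rw [ha.trans_proj hπ hq, (ha.brS hπ hq).trans_proj hπ hq]
      have : (l⁻¹ * m⁻¹ * l)⁻¹ * l⁻¹ = l⁻¹ * m := by group
      rw [this]
      split_ifs <;> simp

theorem brS_isBraidedAntiAlgMap (hπ : D.IsOrthogonal) (hq : hC.Compatible) :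
    IsBraidedAntiAlgMap M.trans M.brS where
  toIsCrossedEnd := M.brS_isCrossedEnd hπ hq
  map_one := by
    change M.brS 1 = 1
    rw [Homog.one.brS_eq hπ hq, map_one, S_one]
  map_mul x y := by
    simp only [BraidedData.braiding, LinearMap.comp_apply, LinearEquiv.coe_coe,
      TensorProduct.comm_tmul, LinearMap.sum_apply, TensorProduct.map_tmul, map_sum,
      TensorProduct.lift.tmul, trans_act M hπ hq, AlgHom.toLinearMap_apply]
    induction x using M.homog_induction with
    | add a b ha hb =>
      simp only [map_add, LinearMap.add_apply, ha, hb, Finset.sum_add_distrib]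
    | homog l m a ha =>
      induction y using M.homog_induction with
      | add a b ha hb =>
        simp only [map_add, LinearMap.add_apply, ha, hb, Finset.sum_add_distrib]
      | homog l' m' b hb =>
        have h1 : (l⁻¹ * m⁻¹ * l)⁻¹ * l⁻¹ = l⁻¹ * m := by group
        rw [(ha.trans_mul_homog hb hπ hq).brS_eq hπ hq, Finset.sum_eq_single (l⁻¹ * m)]
        · rw [(ha.brS hπ hq).trans_proj hπ hq, if_pos h1,
            ((hb.brS hπ hq).act (l⁻¹ * m)).trans_mul hπ hq, ha.trans_mul hπ hq,
            ha.brS_eq hπ hq, hb.brS_eq hπ hq, map_mul, S_mul, act_apply, ← S_L M hπ hq,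
            ← S_R M hπ hq, ← S_R M hπ hq, R_R]
          simp only [R_L, R_R]
          -- Both sides have been brought to a product `S(·) S(·)` of a translate of `b` and a
          -- translate of `a`; only the translating group elements are left to compare.
          congr 4 <;> group
        · intro f _ hf
          rw [(ha.brS hπ hq).trans_proj hπ hq, h1, if_neg hf.symm, map_zero]
        · simp

/-- The projection of `A` onto its component of right degree `n`. -/
def projRight (n : G) : A →ₗ[k] A :=
  (TensorProduct.rid k A).toLinearMap ∘ₗ
    (coord 1 n ∘ₗ M.φ.toLinearMap).lTensor A ∘ₗ M.comul.toLinearMap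

variable {M} in
theorem Homog.projRight_eq {l m : G} {a : A} (ha : M.Homog l m a) (n : G) :
    M.projRight n a = if m = n then a else 0 := by
  have h1 : M.projRight n a = TensorProduct.rid k A
    ((coord 1 n ∘ₗ M.φ.toLinearMap).lTensor A (M.comul a)) := rfl
  rw [h1]
  conv_rhs => rw [← M.comul_counit a]
  have h2 := ha.comul
  revert h2
  generalize M.comul a = s
  intro h2
  clear ha h1
  induction h2 with
  | zero => simp
  | add _ _ h1 h2 =>
    simp only [map_add, h1, h2]
    split_ifs <;> simp
  | tmul ha hb =>
    simp only [LinearMap.lTensor_tmul, LinearMap.comp_apply, AlgHom.toLinearMap_apply, coord_φ,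
      hb.beta, TensorProduct.rid_tmul]
    split_ifs with h <;> simp [h]

theorem sum_projRight (a : A) : ∑ n, M.projRight n a = a := by
  induction a using M.homog_induction with
  | add a b ha hb => simp only [map_add, Finset.sum_add_distrib, ha, hb]
  | homog l m a ha => simp [ha.projRight_eq]

variable {M}

/-- For a first leg of degrees `(l, n)`, the twist in `brS` and the twist in the product are
translations by the same element `l⁻¹n`, one by `R` and one by `L`. This element depends on the
term, so terms are sorted by the right degree `l⁻¹nl` that the first leg has after translation. On a
coproduct each such pair of translations disappears by `map_R_L_comul`. -/
theorem Homog₂.antipode_left {l m : G} {s : A ⊗[k] A} (hs : M.Homog₂ l m s)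
    (hπ : D.IsOrthogonal) (hq : hC.Compatible) :
    TensorProduct.lift M.trans.mul (M.brS.rTensor A s) =
      ∑ n, TensorProduct.lift (LinearMap.mul k A) ((M.S ∘ₗ M.projRight n).rTensor A
        (Algebra.TensorProduct.map (M.R (n * l⁻¹)) (M.L (n * l⁻¹)) s)) := by
  induction hs with
  | zero => simp
  | add _ _ h1 h2 => simp only [map_add, h1, h2, Finset.sum_add_distrib]
  | @tmul n m a b ha hb =>
    rw [Finset.sum_eq_single (l⁻¹ * n * l)]
    · have h1 : (l⁻¹ * n⁻¹ * l)⁻¹ * l⁻¹ = l⁻¹ * n := by group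
      have h2 : l⁻¹ * n * l * l⁻¹ = l⁻¹ * n := by group
      have h3 : l⁻¹ * n * n * (l⁻¹ * n)⁻¹ = l⁻¹ * n * l := by group
      rw [h2]
      simp only [LinearMap.rTensor_tmul, TensorProduct.lift.tmul, Algebra.TensorProduct.map_tmul,
        LinearMap.comp_apply, (ha.R (l⁻¹ * n)).projRight_eq, LinearMap.mul_apply']
      rw [if_pos h3, (ha.brS hπ hq).trans_mul hπ hq, h1, ha.brS_eq hπ hq]
    · intro f _ hf
      simp only [LinearMap.rTensor_tmul, TensorProduct.lift.tmul, Algebra.TensorProduct.map_tmul,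
        LinearMap.comp_apply, (ha.R (f * l⁻¹)).projRight_eq, LinearMap.mul_apply']
      rw [if_neg, map_zero, zero_mul]
      intro h
      apply hf
      have h4 : n = l * f * l⁻¹ := by
        rw [← mul_left_inj (f * l⁻¹)⁻¹, ← mul_right_inj (f * l⁻¹), ← mul_assoc, h]
        group
      rw [h4]; group
    · simp

/-- The twist `L_{l⁻¹n}` of the product passes through `S` as `R_{l⁻¹n}` and combines with the
`R_{n⁻¹m}` of `brS`. The middle degree cancels. -/
theorem Homog₂.antipode_right {l m : G} {s : A ⊗[k] A} (hs : M.Homog₂ l m s)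
    (hπ : D.IsOrthogonal) (hq : hC.Compatible) :
    TensorProduct.lift M.trans.mul (M.brS.lTensor A s) =
      TensorProduct.lift (LinearMap.mul k A) (M.S.lTensor A
        (Algebra.TensorProduct.map (AlgHom.id k A) (M.R (l⁻¹ * m)) s)) := by
  induction hs with
  | zero => simp
  | add _ _ h1 h2 => simp only [map_add, h1, h2]
  | @tmul n m a b ha hb =>
    simp only [LinearMap.lTensor_tmul, TensorProduct.lift.tmul, Algebra.TensorProduct.map_tmul,
      LinearMap.mul_apply', AlgHom.id_apply]
    rw [ha.trans_mul hπ hq, hb.brS_eq hπ hq, ← S_R M hπ hq, R_R]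
    congr 4
    group

variable (M)

/-- On coproducts the sum over right degrees in `Homog₂.antipode_left` reassembles `S`, since the
projections add up to the identity. -/
theorem lift_brS_rTensor (hπ : D.IsOrthogonal) (hq : hC.Compatible) (a : A) :
    TensorProduct.lift M.trans.mul (M.brS.rTensor A (M.comul a)) =
      TensorProduct.lift (LinearMap.mul k A) (M.S.rTensor A (M.comul a)) := by
  induction a using M.homog_induction with
  | add a b ha hb => simp only [map_add, ha, hb]
  | homog l m a ha =>
    have h1 := ha.comul.antipode_left hπ hq
    simp only [map_R_L_comul] at h1
    have h2 : ∑ n, M.S ∘ₗ M.projRight n = M.S :=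
      LinearMap.ext fun a => by
        rw [LinearMap.sum_apply]
        simp only [LinearMap.comp_apply]
        rw [← map_sum, sum_projRight]
    have h3 : (M.S.rTensor A : A ⊗[k] A →ₗ[k] A ⊗[k] A) =
        ∑ n, (M.S ∘ₗ M.projRight n).rTensor A := by
      conv_lhs => rw [← h2]
      exact map_sum (LinearMap.rTensorHom A) _ _
    rw [h1, h3, LinearMap.sum_apply, map_sum]

variable {M} in
theorem Homog.lift_brS_lTensor (hπ : D.IsOrthogonal) (hq : hC.Compatible) {l m : G} {a : A}
    (ha : M.Homog l m a) : TensorProduct.lift M.trans.mul (M.brS.lTensor A (M.comul a)) =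
      TensorProduct.lift (LinearMap.mul k A) (M.S.lTensor A (M.comul (M.R (l⁻¹ * m) a))) := by
  rw [ha.comul.antipode_right hπ hq, comul_R]

variable {M} in
-- The translate has degrees `(l, gmg⁻¹)`, so outside the case `l = m` both counits vanish for
-- degree reasons.
theorem Homog.counit_R_eq {l m : G} {a : A} (ha : M.Homog l m a) {g : G}
    (h : g * m * g⁻¹ = l → l = m) (hg : l = m → g = 1) :
    M.counit (M.R g a) = M.counit a := by
  by_cases hlm : l = m
  · rw [hg hlm, R_one, AlgHom.id_apply]
  · rw [ha.counit_eq_zero hlm, (ha.R g).counit_eq_zero fun h' => hlm (h h'.symm)]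

theorem brS_isBraidedAntipode (hπ : D.IsOrthogonal) (hq : hC.Compatible)
    (hS : IsAntipode M.coquasi M.S) : IsBraidedAntipode M.trans M.brS where
  toIsCrossedEnd := M.brS_isCrossedEnd hπ hq
  antipode_left x := (M.lift_brS_rTensor hπ hq x).trans (hS.antipode_left x)
  antipode_right x := by
    induction x using M.homog_induction with
    | add a b ha hb => simp only [map_add, ha, hb, add_smul]
    | homog l m a ha =>
      refine (ha.lift_brS_lTensor hπ hq).trans ((hS.antipode_right (M.R (l⁻¹ * m) a)).trans ?_)
      change M.counit (M.R (l⁻¹ * m) a) • (1 : A) = M.counit a • 1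
      have h1 : l⁻¹ * m * m * (l⁻¹ * m)⁻¹ = l → l = m := by
        intro h
        have h4 : l⁻¹ * m * m * (l⁻¹ * m)⁻¹ = l⁻¹ * m * l := by group
        rw [h4, ← mul_left_inj l⁻¹, mul_assoc _ l l⁻¹, mul_inv_cancel, mul_one,
          eq_comm, eq_inv_mul_iff_mul_eq, mul_one] at h
        exact h
      rw [ha.counit_R_eq h1 fun h => by rw [h, inv_mul_cancel]]

/-- Since `S` is an involution exchanging the translations, the two twists leave one left and one
right translation by `|a|`. The square of the braided antipode is thus the action of an element's
own degree, which is invertible. -/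
theorem brS_brS (hπ : D.IsOrthogonal) (hq : hC.Compatible) {l m : G} {a : A}
    (ha : M.Homog l m a) : M.brS (M.brS a) = M.act (l⁻¹ * m) a := by
  rw [(ha.brS hπ hq).brS_eq hπ hq, ha.brS_eq hπ hq, S_R M hπ hq, S_S, act_apply]
  congr 2
  group

theorem brS_bijective (hπ : D.IsOrthogonal) (hq : hC.Compatible) : Function.Bijective M.brS := by
  set θ : A →ₗ[k] A := ∑ g, (M.act g⁻¹).toLinearMap ∘ₗ M.trans.proj g with hθ
  have hθ' : ∀ {l m a}, M.Homog l m a → θ a = M.act (l⁻¹ * m)⁻¹ a := by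
    intro l m a ha
    rw [hθ, LinearMap.sum_apply, Finset.sum_eq_single (l⁻¹ * m)]
    · simp [ha.trans_proj hπ hq]
    · intro f _ hf
      simp [ha.trans_proj hπ hq, hf.symm]
    · simp
  have h1 : ∀ a, θ (M.brS (M.brS a)) = a := by
    intro a
    induction a using M.homog_induction with
    | add a b ha hb => simp only [map_add, ha, hb]
    | homog l m a ha =>
      rw [brS_brS M hπ hq ha, hθ' (ha.act _), act_act]
      -- The action of its own degree leaves the degree of `a` unchanged.
      have : (l⁻¹ * m * l * (l⁻¹ * m)⁻¹)⁻¹ * (l⁻¹ * m * m * (l⁻¹ * m)⁻¹) = l⁻¹ * m := by group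
      rw [this, inv_mul_cancel, act_one, AlgHom.id_apply]
  have h2 : ∀ a, M.brS (M.brS (θ a)) = a := by
    intro a
    induction a using M.homog_induction with
    | add a b ha hb => simp only [map_add, ha, hb]
    | homog l m a ha =>
      rw [hθ' ha, brS_brS M hπ hq (ha.act _), act_act]
      have : ((l⁻¹ * m)⁻¹ * l * (l⁻¹ * m)⁻¹⁻¹)⁻¹ * ((l⁻¹ * m)⁻¹ * m * (l⁻¹ * m)⁻¹⁻¹) =
        l⁻¹ * m := by group
      rw [this, mul_inv_cancel, act_one, AlgHom.id_apply]
  exact ⟨fun a b h => by rw [← h1 a, h, h1], fun a => ⟨_, h2 a⟩⟩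

theorem brS_e (hπ : D.IsOrthogonal) (hq : hC.Compatible) (x y : D.Idx) :
    M.brS (M.e x y) = hC.brAntipodeGen M.e x y := by
  rw [(Homog.gen x y).brS_eq hπ hq, R_e, hat_unit_mul, hC.brAntipodeGen_eq]
  simp [S_e]

theorem trans_proj_e (hπ : D.IsOrthogonal) (hq : hC.Compatible) (g : G) (x y : D.Idx) :
    M.trans.proj g (M.e x y) = if (x.1 : G) * (y.1 : G)⁻¹ = g then M.e x y else 0 := by
  rw [(Homog.gen x y).trans_proj hπ hq, inv_inv]

/-! ### Maps between models -/

section Map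

variable {M} {A' : Type*} [Ring A'] [Algebra k A'] {M' : FRTModel hC A'} {f : A →ₐ[k] A'}

theorem map_comul (hf : ∀ x y, f (M.e x y) = M'.e x y) (a : A) :
    M'.comul (f a) = TensorProduct.map f.toLinearMap f.toLinearMap (M.comul a) := by
  have : M'.comul.comp f = (Algebra.TensorProduct.map f f).comp M.comul :=
    M.algHom_ext fun x y => by simp [comul_e, hf]
  exact DFunLike.congr_fun this a

theorem map_counit (hf : ∀ x y, f (M.e x y) = M'.e x y) (a : A) :
    M'.counit (f a) = M.counit a := by
  have : M'.counit.comp f = M.counit := M.algHom_ext fun x y => by simp [counit_e, hf]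
  exact DFunLike.congr_fun this a

theorem map_φ (hf : ∀ x y, f (M.e x y) = M'.e x y) : M'.φ.comp f = M.φ :=
  M.algHom_ext fun x y => by rw [AlgHom.comp_apply, hf, φ_e, φ_e]

theorem map_L (hf : ∀ x y, f (M.e x y) = M'.e x y) (g : G) (a : A) :
    f (M.L g a) = M'.L g (f a) := by
  have : f.comp (M.L g) = (M'.L g).comp f :=
    M.algHom_ext fun x y => by simp [L_e, hf, hat_mul_unit]
  exact DFunLike.congr_fun this a

theorem map_R (hf : ∀ x y, f (M.e x y) = M'.e x y) (g : G) (a : A) :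
    f (M.R g a) = M'.R g (f a) := by
  have : f.comp (M.R g) = (M'.R g).comp f :=
    M.algHom_ext fun x y => by simp [R_e, hf, hat_unit_mul]
  exact DFunLike.congr_fun this a

theorem map_S (hf : ∀ x y, f (M.e x y) = M'.e x y) (a : A) : f (M.S a) = M'.S (f a) := by
  induction a using M.induction with
  | one => simp [S_one]
  | gen x y => rw [S_e, hf, hf, S_e]
  | mul a b ha hb => rw [S_mul, map_mul, map_mul, S_mul, ha, hb]
  | add a b ha hb => simp only [map_add, ha, hb]
  | smul c a ha => simp only [map_smul, ha]

theorem Homog.map (hf : ∀ x y, f (M.e x y) = M'.e x y) {l m : G} {a : A} (h : M.Homog l m a) :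
    M'.Homog l m (f a) := by
  induction h with
  | zero => rw [map_zero]; exact Homog.zero _ _
  | one => rw [map_one]; exact Homog.one
  | gen x y => rw [hf]; exact Homog.gen x y
  | mul _ _ ha hb => rw [map_mul]; exact ha.mul hb
  | add _ _ ha hb => rw [map_add]; exact ha.add hb
  | smul c _ ha => rw [map_smul]; exact ha.smul c

theorem isCoquasiMap_map (hf : ∀ x y, f (M.e x y) = M'.e x y) :
    IsCoquasiMap M.coquasi M'.coquasi f where
  map_comul := map_comul hf
  map_counit := map_counit hf
  map_R a b := by
    have h (a : A) : M'.φ (f a) = M.φ a := DFunLike.congr_fun (map_φ hf) a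
    simp [coquasi, h]

theorem isBraidedMap_map (hπ : D.IsOrthogonal) (hq : hC.Compatible)
    (hf : ∀ x y, f (M.e x y) = M'.e x y) : IsBraidedMap M.trans M'.trans f.toLinearMap where
  map_act g x := by
    rw [trans_act M hπ hq, trans_act M' hπ hq]
    simp only [AlgHom.toLinearMap_apply, act_apply, map_L hf, map_R hf]
  map_proj g x := by
    simp only [AlgHom.toLinearMap_apply]
    induction x using M.homog_induction with
    | add a b ha hb => simp only [map_add, ha, hb]
    | homog l m a ha =>
      rw [ha.trans_proj hπ hq, (ha.map hf).trans_proj hπ hq]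
      split_ifs <;> simp
  map_mul x y := by
    simp only [AlgHom.toLinearMap_apply]
    induction x using M.homog_induction with
    | add a b ha hb => simp only [map_add, LinearMap.add_apply, ha, hb]
    | homog l m a ha =>
      rw [ha.trans_mul hπ hq, (ha.map hf).trans_mul hπ hq, map_mul, map_L hf]
  map_one := map_one f
  map_comul := map_comul hf
  map_counit := map_counit hf

theorem map_brS (hπ : D.IsOrthogonal) (hq : hC.Compatible)
    (hf : ∀ x y, f (M.e x y) = M'.e x y) (a : A) : f (M.brS a) = M'.brS (f a) := by
  induction a using M.homog_induction with
  | add a b ha hb => simp only [map_add, ha, hb]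
  | homog l m a ha =>
    rw [ha.brS_eq hπ hq, (ha.map hf).brS_eq hπ hq, map_S hf, map_R hf]

end Map

/-! ### The map to `BD(G)` -/

theorem single_finsetSum {ι : Type*} (g : G) (s : Finset ι) (f : ι → k) :
    MonoidAlgebra.single g (∑ i ∈ s, f i) = ∑ i ∈ s, MonoidAlgebra.single g (f i) :=
  map_sum (MonoidAlgebra.singleAddHom g) f s

theorem φ_L (g : G) (a : A) : M.φ (M.L g a) = DVleft k g (M.φ a) := by
  have : M.φ.comp (M.L g) = (DVleft k g).comp M.φ := M.algHom_ext fun x y => by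
    funext u
    simp only [AlgHom.comp_apply, L_e, hat_mul_unit, map_sum, map_smul, φ_e, DVleft,
      AlgHom.pi_apply, Pi.evalAlgHom_apply, Finset.sum_apply, Pi.smul_apply,
      MonoidAlgebra.smul_single, smul_eq_mul, mul_inv_rev, inv_inv, ← sum_rho_mul,
      single_finsetSum, mul_comm]
  exact DFunLike.congr_fun this a

/-- On `D^∨(G)` the right translation is `δ_u ⊗ v ↦ δ_{ug⁻¹} ⊗ gvg⁻¹`, written here as conjugation
after a left translation. The group element is conjugated because the label of a nonzero entry of
`ρ(g⁻¹)` is determined by conjugation. -/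
theorem φ_R (g : G) (a : A) : M.φ (M.R g a) = DVact k g (DVleft k g⁻¹ (M.φ a)) := by
  have : M.φ.comp (M.R g) = ((DVact k g).comp (DVleft k g⁻¹)).comp M.φ :=
    M.algHom_ext fun x y => by
      funext u
      have h : ∀ b, D.rho g⁻¹ y b • MonoidAlgebra.single (b.1 : G)⁻¹ (D.rho u⁻¹ b x) =
          MonoidAlgebra.single (g * (y.1 : G)⁻¹ * g⁻¹) (D.rho g⁻¹ y b * D.rho u⁻¹ b x) := by
        intro b
        rw [MonoidAlgebra.smul_single, smul_eq_mul]
        by_cases h0 : D.rho g⁻¹ y b = 0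
        · simp [h0]
        · rw [rho_ne_zero h0]
          congr 1
          group
      simp only [AlgHom.comp_apply, R_e, hat_unit_mul, map_sum, map_smul, φ_e, DVleft, DVact,
        AlgHom.pi_apply, Pi.evalAlgHom_apply, Finset.sum_apply, Pi.smul_apply, h]
      rw [← single_finsetSum, sum_rho_mul]
      simp [mul_assoc]
  exact DFunLike.congr_fun this a

theorem φ_act (g : G) (a : A) : M.φ (M.act g a) = DVact k g (M.φ a) := by
  rw [act_apply, φ_L, φ_R]
  funext u
  simp [DVleft, DVact, mul_assoc]

theorem isBraidedMap_φ (hπ : D.IsOrthogonal) (hq : hC.Compatible) :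
    IsBraidedMap M.trans (BD k G) M.φ.toLinearMap where
  map_act g x := by
    rw [trans_act M hπ hq, BD_act]
    exact M.φ_act g x
  map_proj g x := by
    simp only [AlgHom.toLinearMap_apply]
    induction x using M.homog_induction with
    | add a b ha hb => simp only [map_add, ha, hb]
    | homog l m a ha =>
      rw [ha.trans_proj hπ hq]
      have h1 : M.φ (if l⁻¹ * m = g then a else 0) = if l⁻¹ * m = g then M.φ a else 0 := by
        split_ifs <;> simp
      rw [h1]
      have h2 := ha.φ_mem
      revert h2
      generalize M.φ a = F
      intro h2
      induction h2 using Submodule.span_induction with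
      | zero => simp
      | add u v _ _ hu hv =>
        rw [map_add, ← hu, ← hv]
        split_ifs <;> simp
      | smul c u _ hu =>
        rw [map_smul, ← hu]
        split_ifs <;> simp
      | mem u hu =>
        obtain ⟨u, v, rfl, rfl, rfl⟩ := hu
        have : (u * v * u⁻¹)⁻¹ * v = u * v⁻¹ * u⁻¹ * v := by group
        simp only [BD, onBasis_dl]
        rw [this]
  map_mul x y := by
    simp only [AlgHom.toLinearMap_apply]
    induction x using M.homog_induction with
    | add a b ha hb => simp only [map_add, LinearMap.add_apply, ha, hb]
    | homog l m a ha =>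
      rw [ha.trans_mul hπ hq, map_mul, φ_L]
      have h2 := ha.φ_mem
      revert h2
      generalize M.φ a = F
      generalize M.φ y = F'
      intro h2
      induction h2 using Submodule.span_induction with
      | zero => simp
      | add u v _ _ hu hv => rw [map_add, LinearMap.add_apply, ← hu, ← hv, add_mul]
      | smul c u _ hu => rw [map_smul, LinearMap.smul_apply, ← hu, smul_mul_assoc]
      | mem u hu =>
        obtain ⟨u, v, rfl, rfl, rfl⟩ := hu
        -- For `a ↦ δ_u ⊗ v` one has `l = uvu⁻¹` and `m = v`, and the translated product in `D^∨(G)`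
        -- is the product of `BD(G)`.
        have : LinearMap.mulLeft k (dl u v) ∘ₗ
            (DVleft k ((u * v * u⁻¹)⁻¹ * v)).toLinearMap = (BD k G).mul (dl u v) := by
          refine dl_ext fun u' v' => ?_
          simp only [LinearMap.comp_apply, AlgHom.toLinearMap_apply, DVleft_dl,
            LinearMap.mulLeft_apply, dl_mul_dl, BD, onBasis_dl]
          have h3 : u = (u * v * u⁻¹)⁻¹ * v * u' ↔ u = v * u' * v⁻¹ := by
            rw [mul_assoc, eq_inv_mul_iff_mul_eq, eq_mul_inv_iff_mul_eq, inv_mul_cancel_right]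
          simp only [h3]
        exact LinearMap.congr_fun this F'
  map_one := by
    change M.φ 1 = _
    rw [map_one, one_eq_sum_dl]
    rfl
  map_comul := M.isCoquasiMap.map_comul
  map_counit := M.isCoquasiMap.map_counit

end FRTModel

end Block
end QDouble
end

/-! ### Universal properties of `A` and `H` -/

noncomputable section

namespace QDouble

namespace Block

variable {k G : Type*} [Field k] [Group G] [Fintype G] [DecidableEq G] {D : Block k G}

section Relations

variable {B : Type*} [Ring B] [Algebra k B] (e : D.Idx → D.Idx → B)

/-- The elements `e x y` satisfy the FRT relations. -/
def IsFRT : Prop := ∀ x y z w,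
  e x y * hat e (D.rho x.1 * unit z w) = hat e (unit z w * D.rho y.1) * e x y

/-- The elements `e x y` satisfy the antipode relations. -/
structure InvStable.IsInvertible (hC : D.InvStable) : Prop where
  right : ∀ x y, ∑ z, e x z * e (hC.iota y) (hC.iota z) = if x = y then 1 else 0
  left : ∀ x y, ∑ z, e (hC.iota z) (hC.iota x) * e z y = if x = y then 1 else 0

variable {e}

/-- The delta functions in `R` remove one of the two sums on each side, leaving a single matrix `ρ`
acting on one generator. -/
theorem ARel_iff (f : FreeAlgebra k (D.Idx × D.Idx) →ₐ[k] B) (x y z w : D.Idx) :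
    f (∑ u, ∑ g, D.Rmat u x g z • (D.genT u y * D.genT g w)) =
      f (∑ u, ∑ g, D.Rmat y u w g • (D.genT z g * D.genT x u)) ↔
    f (D.genT x y) * hat (fun x y => f (D.genT x y)) (D.rho x.1 * unit z w) =
      hat (fun x y => f (D.genT x y)) (unit z w * D.rho y.1) * f (D.genT x y) := by
  have h1 : ∀ (u g : D.Idx) (b : B), (if u = x then D.rho u.1 g z else 0) • b =
      if u = x then D.rho u.1 g z • b else 0 := by
    intro u g b; split_ifs <;> simp
  have h2 : ∀ (u g : D.Idx) (b : B), (if y = u then D.rho y.1 w g else 0) • b =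
      if y = u then D.rho y.1 w g • b else 0 := by
    intro u g b; split_ifs <;> simp
  simp only [map_sum, map_smul, map_mul, Rmat_eq, h1, h2, hat_mul_unit, hat_unit_mul,
    Finset.mul_sum, Finset.sum_mul, mul_smul_comm, smul_mul_assoc]
  rw [Finset.sum_comm]
  conv_lhs => rhs; rw [Finset.sum_comm]
  simp

/-- The relation is applied in the left tensor factor on one side and in the right factor on the
other. Both sides then contract the middle indices through the same matrix `ρ(a)`, with `a` the
class label of a middle index. -/
theorem IsFRT.comul (h : IsFRT e) :
    IsFRT fun x y => ∑ z, e x z ⊗ₜ[k] e z y := by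
  intro x y z w
  have h1 : hat (fun x y => ∑ z, e x z ⊗ₜ[k] e z y) (D.rho x.1 * unit z w) =
      ∑ s, hat e (D.rho x.1 * unit z s) ⊗ₜ[k] e s w := by
    simp only [hat_mul_unit, TensorProduct.sum_tmul, Finset.smul_sum, TensorProduct.smul_tmul']
    exact Finset.sum_comm
  have h2 : hat (fun x y => ∑ z, e x z ⊗ₜ[k] e z y) (unit z w * D.rho y.1) =
      ∑ s, e z s ⊗ₜ[k] hat e (unit s w * D.rho y.1) := by
    simp only [hat_unit_mul, TensorProduct.tmul_sum, Finset.smul_sum, TensorProduct.tmul_smul]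
    exact Finset.sum_comm
  simp only [h1, h2, Finset.sum_mul_sum, Algebra.TensorProduct.tmul_mul_tmul, h x _ z _,
    ← h _ y _ w]
  simp only [hat_unit_mul, hat_mul_unit, Finset.sum_mul, Finset.mul_sum, TensorProduct.sum_tmul,
    TensorProduct.tmul_sum, smul_mul_assoc, mul_smul_comm, TensorProduct.tmul_smul,
    TensorProduct.smul_tmul']
  rw [Finset.sum_comm_cycle]

variable (D) in
theorem isFRT_counit : IsFRT fun x y : D.Idx => if x = y then (1 : k) else 0 := by
  intro x y z w
  rw [hat_mul_unit, hat_unit_mul]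
  by_cases h : x = y
  · simp [h]
  · simp [h]

variable (D) in
-- At `g`, a nonzero entry `ρ(g⁻¹)_{yx}` forces `y = g⁻¹xg`. Then `ρ(g⁻¹) ρ(x) = ρ(y) ρ(g⁻¹)`, which
-- is the relation between coefficients; the group elements agree because `ρ(y)_{wv} ≠ 0` forces `w
-- = yvy⁻¹`.
theorem isFRT_φ : IsFRT fun (x y : D.Idx) (g : G) =>
    MonoidAlgebra.single (y.1 : G)⁻¹ (D.rho g⁻¹ y x) := by
  intro x y z w
  rw [hat_mul_unit, hat_unit_mul]
  funext g
  simp only [Pi.mul_apply, Finset.sum_apply, Pi.smul_apply, Finset.mul_sum, Finset.sum_mul,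
    MonoidAlgebra.single_mul_single, MonoidAlgebra.smul_single,
    smul_eq_mul]
  have h1 : ∀ v, MonoidAlgebra.single ((v.1 : G)⁻¹ * (y.1 : G)⁻¹)
      (D.rho y.1 w v * D.rho g⁻¹ v z * D.rho g⁻¹ y x) =
      MonoidAlgebra.single ((y.1 : G)⁻¹ * (w.1 : G)⁻¹)
      (D.rho y.1 w v * D.rho g⁻¹ v z * D.rho g⁻¹ y x) := by
    intro v
    by_cases h0 : D.rho y.1 w v = 0
    · simp [h0]
    · rw [rho_ne_zero h0]
      congr 1
      group
  have h2 : ∀ v, D.rho g⁻¹ y x * (D.rho x.1 v z * D.rho g⁻¹ w v) =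
      D.rho g⁻¹ w v * D.rho x.1 v z * D.rho g⁻¹ y x := fun v => by ring
  simp only [h1, h2]
  rw [← FRTModel.single_finsetSum, ← FRTModel.single_finsetSum, ← Finset.sum_mul, ← Finset.sum_mul,
    sum_rho_mul, sum_rho_mul]
  congr 1
  by_cases h0 : D.rho g⁻¹ y x = 0
  · rw [h0, mul_zero, mul_zero]
  · rw [rho_ne_zero h0]
    congr 3
    group

/-- Exchanging the indices through `ι` reverses the relation, as `ρ(a⁻¹)` is the transpose of
`ρ(a)`. This provides `S` as an algebra map into the opposite algebra, already on `A`. -/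
theorem IsFRT.op (h : IsFRT e) (hC : D.InvStable) (hπ : D.IsOrthogonal) (hq : hC.Compatible) :
    IsFRT fun x y => MulOpposite.op (e (hC.iota y) (hC.iota x)) := by
  intro x y z w
  have h1 := h (hC.iota y) (hC.iota x) (hC.iota w) (hC.iota z)
  have hs : ∀ {g : G} {x y : D.Idx}, D.rho g⁻¹ x y = D.rho g y x := hπ.rho_inv _ _ _
  rw [hat_mul_unit, hat_unit_mul,
    ← hC.sum_iota fun v => D.rho (hC.iota y).1 v (hC.iota w) • e v (hC.iota z),
    ← hC.sum_iota fun v => D.rho (hC.iota x).1 (hC.iota z) v • e (hC.iota w) v] at h1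
  simp only [hq.rho_iota, hC.coe_iota, hs] at h1
  rw [hat_mul_unit, hat_unit_mul]
  simp only [← MulOpposite.op_smul, ← Finset.op_sum, ← MulOpposite.op_mul]
  rw [h1]

variable {hC : D.InvStable}

theorem InvStable.IsInvertible.comul (h : hC.IsInvertible e) :
    hC.IsInvertible fun x y => ∑ z, e x z ⊗ₜ[k] e z y where
  right x y := by
    have h1 : ∀ z, ∑ v, e (hC.iota y) v ⊗ₜ[k] e v (hC.iota z) =
        ∑ v, e (hC.iota y) (hC.iota v) ⊗ₜ[k] e (hC.iota v) (hC.iota z) := fun z =>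
      (hC.sum_iota fun v => e (hC.iota y) v ⊗ₜ[k] e v (hC.iota z)).symm
    simp only [h1, Finset.sum_mul_sum, Algebra.TensorProduct.tmul_mul_tmul]
    rw [Finset.sum_comm]
    simp_rw [Finset.sum_comm (s := Finset.univ (α := D.Idx)) (γ := D.Idx)
      (f := fun z v => (e x _ * e (hC.iota y) (hC.iota v)) ⊗ₜ[k] (e _ z * e (hC.iota v) (hC.iota z)))]
    simp only [← TensorProduct.tmul_sum, h.right, TensorProduct.tmul_ite,
      Finset.sum_ite_eq, Finset.mem_univ, if_true, ← TensorProduct.sum_tmul]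
    split_ifs
    · rfl
    · simp
  left x y := by
    have h1 : ∀ z, ∑ v, e (hC.iota z) v ⊗ₜ[k] e v (hC.iota x) =
        ∑ v, e (hC.iota z) (hC.iota v) ⊗ₜ[k] e (hC.iota v) (hC.iota x) := fun z =>
      (hC.sum_iota fun v => e (hC.iota z) v ⊗ₜ[k] e v (hC.iota x)).symm
    simp only [h1, Finset.sum_mul_sum, Algebra.TensorProduct.tmul_mul_tmul]
    rw [Finset.sum_comm]
    simp_rw [Finset.sum_comm (s := Finset.univ (α := D.Idx)) (γ := D.Idx)
      (f := fun z u => (e (hC.iota z) (hC.iota _) * e z u) ⊗ₜ[k] (e (hC.iota _) (hC.iota x) * e u y))]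
    simp only [← TensorProduct.sum_tmul, h.left, TensorProduct.ite_tmul,
      Finset.sum_ite_eq, Finset.mem_univ, if_true, ← TensorProduct.tmul_sum]
    split_ifs
    · rfl
    · simp

variable (hC) in
theorem InvStable.isInvertible_counit :
    hC.IsInvertible fun x y : D.Idx => if x = y then (1 : k) else 0 where
  right x y := by
    by_cases h : x = y
    · simp [h, hC.iota_inj]
    · simp [h, hC.iota_inj]
  left x y := by
    by_cases h : x = y
    · simp [h, hC.iota_inj]
    · simp [h, Ne.symm h, hC.iota_inj]

theorem InvStable.Compatible.isInvertible_φ (hq : hC.Compatible) (hπ : D.IsOrthogonal) :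
    hC.IsInvertible fun (x y : D.Idx) (g : G) =>
      MonoidAlgebra.single (y.1 : G)⁻¹ (D.rho g⁻¹ y x) where
  right x y := by
    funext g
    simp only [Finset.sum_apply, Pi.mul_apply, MonoidAlgebra.single_mul_single, hC.coe_iota,
      inv_inv, inv_mul_cancel, hq.rho_iota]
    simp_rw [hπ.rho_inv g _ x]
    rw [← FRTModel.single_finsetSum, sum_rho_mul, mul_inv_cancel, map_one, Matrix.one_apply]
    split_ifs <;> simp [MonoidAlgebra.one_def]
  left x y := by
    funext g
    simp only [Finset.sum_apply, Pi.mul_apply, MonoidAlgebra.single_mul_single, hC.coe_iota,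
      inv_inv, hq.rho_iota]
    simp_rw [hπ.rho_inv g x, mul_comm (D.rho g _ x)]
    rw [← FRTModel.single_finsetSum, sum_rho_mul, inv_mul_cancel, map_one, Matrix.one_apply]
    by_cases h : x = y
    · simp [h, MonoidAlgebra.one_def]
    · simp [h, Ne.symm h]

/-- Passing to the opposite algebra through `ι` exchanges the left and right antipode relations, so
`S` descends to `H`. -/
theorem InvStable.IsInvertible.op (h : hC.IsInvertible e) :
    hC.IsInvertible fun x y => MulOpposite.op (e (hC.iota y) (hC.iota x)) where
  right x y := by
    have := h.left (hC.iota y) (hC.iota x)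
    rw [← hC.sum_iota] at this
    simp only [hC.iota_iota, hC.iota_inj] at this ⊢
    simp only [← MulOpposite.op_mul, ← Finset.op_sum, this]
    simp only [eq_comm (a := y)]
    split_ifs <;> rfl
  left x y := by
    have := h.right (hC.iota y) (hC.iota x)
    rw [← hC.sum_iota] at this
    simp only [hC.iota_iota, hC.iota_inj] at this ⊢
    simp only [← MulOpposite.op_mul, ← Finset.op_sum, this]
    simp only [eq_comm (a := y)]
    split_ifs <;> rfl

/-- The algebra map from the FRT algebra given by matrix elements which satisfy its relations. -/
def IsFRT.lift (h : IsFRT e) : D.A →ₐ[k] B :=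
  RingQuot.liftAlgHom k ⟨FreeAlgebra.lift k fun p => e p.1 p.2, by
    rintro _ _ ⟨x, y, z, w⟩
    rw [ARel_iff]
    simpa [genT] using h x y z w⟩

theorem IsFRT.lift_t (h : IsFRT e) (x y : D.Idx) : h.lift (D.t x y) = e x y := by
  simp [IsFRT.lift, t, genT]

variable (D) in
theorem isFRT_t : IsFRT D.t := by
  intro x y z w
  have := RingQuot.mkAlgHom_rel k (ARel.mk (D := D) x y z w)
  rwa [ARel_iff] at this

theorem InvStable.HRel_iff (hC : D.InvStable) (f : D.A →ₐ[k] B) :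
    (∀ a b, hC.HRel a b → f a = f b) ↔ hC.IsInvertible fun x y => f (D.t x y) := by
  have h1 : ∀ x y : D.Idx, f (if x = y then 1 else 0) = if x = y then 1 else 0 := by
    intro x y; split_ifs <;> simp
  constructor
  · intro h
    constructor
    · intro x y
      have := h _ _ (HRel.right x y)
      rw [h1] at this
      simpa [hC.antipodeGen_eq] using this
    · intro x y
      have := h _ _ (HRel.left x y)
      rw [h1] at this
      simpa [hC.antipodeGen_eq] using this
  · rintro h _ _ (⟨x, y⟩ | ⟨x, y⟩)
    · rw [h1, ← h.right]
      simp [hC.antipodeGen_eq]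
    · rw [h1, ← h.left]
      simp [hC.antipodeGen_eq]

variable (hC) in
/-- The generators `t_{ai}{}^{bj}` of `H_{𝒞,π}`. -/
def InvStable.tH (x y : D.Idx) : hC.H := hC.mkH (D.t x y)

variable (hC) in
theorem InvStable.isInvertible_tH : hC.IsInvertible hC.tH :=
  show hC.IsInvertible fun x y => hC.mkH (D.t x y) from
    (hC.HRel_iff (B := hC.H) hC.mkH).1 fun _ _ h => RingQuot.mkAlgHom_rel k h

theorem IsFRT.map {B' : Type*} [Ring B'] [Algebra k B'] (h : IsFRT e) (f : B →ₐ[k] B') :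
    IsFRT fun x y => f (e x y) := by
  intro x y z w
  have h1 := congrArg f (h x y z w)
  have h2 : ∀ c, f (hat e c) = hat (fun x y => f (e x y)) c := map_hat e f.toLinearMap
  rwa [map_mul f, map_mul f, h2, h2] at h1

variable (hC) in
theorem InvStable.isFRT_tH : IsFRT hC.tH :=
  show IsFRT fun x y => hC.mkH (D.t x y) from
    (isFRT_t D).map (B' := hC.H) hC.mkH

/-- The algebra map from `H_{𝒞,π}` given by matrix elements which satisfy its relations. -/
def InvStable.IsInvertible.lift (h' : hC.IsInvertible e) (h : IsFRT e) : hC.H →ₐ[k] B :=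
  RingQuot.liftAlgHom k ⟨h.lift, by
    simpa only [hC.HRel_iff, h.lift_t] using h'⟩

theorem InvStable.IsInvertible.lift_tH (h' : hC.IsInvertible e) (h : IsFRT e) (x y : D.Idx) :
    h'.lift h (hC.tH x y) = e x y := by
  simp [InvStable.IsInvertible.lift, InvStable.tH, InvStable.mkH, h.lift_t]

end Relations

variable {hC : D.InvStable}

theorem adjoin_map_eq_top {R R' ι : Type*} [Semiring R] [Algebra k R] [Semiring R'] [Algebra k R']
    {e : ι → ι → R} (f : R →ₐ[k] R') (hf : Function.Surjective f)
    (h : Algebra.adjoin k {a | ∃ x y, a = e x y} = ⊤) :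
    Algebra.adjoin k {a | ∃ x y, a = f (e x y)} = ⊤ := by
  have h1 : {a | ∃ x y, a = f (e x y)} = f '' {a | ∃ x y, a = e x y} := by
    ext a
    constructor
    · rintro ⟨x, y, rfl⟩; exact ⟨_, ⟨x, y, rfl⟩, rfl⟩
    · rintro ⟨_, ⟨x, y, rfl⟩, rfl⟩; exact ⟨x, y, rfl⟩
  rw [h1, ← AlgHom.map_adjoin, h, Algebra.map_top, AlgHom.range_eq_top]
  exact hf

variable (D) in
theorem adjoin_genT : Algebra.adjoin k {a | ∃ x y, a = D.genT x y} = ⊤ := by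
  rw [← FreeAlgebra.adjoin_range_ι]
  congr 1
  ext a
  simp [genT, eq_comm]

variable (D) in
theorem adjoin_t : Algebra.adjoin k {a | ∃ x y, a = D.t x y} = ⊤ :=
  adjoin_map_eq_top (e := D.genT) (RingQuot.mkAlgHom k D.ARel)
    (RingQuot.mkAlgHom_surjective k _) D.adjoin_genT

theorem InvStable.mkH_surjective (hC : D.InvStable) : Function.Surjective hC.mkH :=
  RingQuot.mkAlgHom_surjective k _

theorem InvStable.adjoin_tH (hC : D.InvStable) :
    Algebra.adjoin k {a | ∃ x y, a = hC.tH x y} = ⊤ :=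
  adjoin_map_eq_top (e := D.t) hC.mkH hC.mkH_surjective D.adjoin_t

/-- The FRT algebra `A_{𝒞,π}` as a model. -/
def InvStable.modelA (hC : D.InvStable) (hπ : D.IsOrthogonal) (hq : hC.Compatible) :
    FRTModel hC D.A where
  e := D.t
  comul := (isFRT_t D).comul.lift
  counit := (isFRT_counit D).lift
  φ := (isFRT_φ D).lift
  S := (MulOpposite.opLinearEquiv k).symm.toLinearMap ∘ₗ
    ((isFRT_t D).op hC hπ hq).lift.toLinearMap
  adjoin_e := D.adjoin_t
  comul_e := IsFRT.lift_t _
  counit_e := IsFRT.lift_t _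
  φ_e := IsFRT.lift_t _
  S_one := by simp
  S_mul := by simp
  S_e x y := by simp [IsFRT.lift_t]
  frt := isFRT_t D

/-- The quotient `H_{𝒞,π}` of the FRT algebra as a model. -/
def InvStable.modelH (hC : D.InvStable) (hπ : D.IsOrthogonal) (hq : hC.Compatible) :
    FRTModel hC hC.H where
  e := hC.tH
  comul := hC.isInvertible_tH.comul.lift hC.isFRT_tH.comul
  counit := hC.isInvertible_counit.lift (isFRT_counit D)
  φ := (hq.isInvertible_φ hπ).lift (isFRT_φ D)
  S := (MulOpposite.opLinearEquiv k).symm.toLinearMap ∘ₗ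
    (hC.isInvertible_tH.op.lift (hC.isFRT_tH.op hC hπ hq)).toLinearMap
  adjoin_e := hC.adjoin_tH
  comul_e := InvStable.IsInvertible.lift_tH _ _
  counit_e := InvStable.IsInvertible.lift_tH _ _
  φ_e := InvStable.IsInvertible.lift_tH _ _
  S_one := by simp
  S_mul := by simp
  S_e x y := by simp [InvStable.IsInvertible.lift_tH]
  frt := hC.isFRT_tH

/-- On generators the antipode identities are the defining relations of `H`. They pass to products
because `S` is antimultiplicative and the inner contraction in `S(b₁) (S(a₁) a₂) b₂` is a scalar; on
the other side the inner contraction is `b₁ S(b₂)`. -/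
theorem InvStable.isAntipode_modelH (hC : D.InvStable) (hπ : D.IsOrthogonal)
    (hq : hC.Compatible) : IsAntipode (hC.modelH hπ hq).coquasi (hC.modelH hπ hq).S where
  antipode_left x := by
    set M := hC.modelH hπ hq
    change TensorProduct.lift (LinearMap.mul k hC.H) (M.S.rTensor hC.H (M.comul x)) =
      M.counit x • 1
    induction x using M.induction with
    | one => simp [M.S_one, Algebra.TensorProduct.one_def]
    | gen x y =>
      rw [M.comul_e, M.counit_e]
      simp only [map_sum, LinearMap.rTensor_tmul, M.S_e, TensorProduct.lift.tmul,
        LinearMap.mul_apply']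
      have h1 : (if x = y then (1 : k) else 0) • (1 : hC.H) = if x = y then 1 else 0 := by
        split_ifs <;> simp
      rw [h1]
      exact hC.isInvertible_tH.left x y
    | add a b ha hb => simp only [map_add, ha, hb, add_smul]
    | smul c a ha => simp only [map_smul, ha, smul_assoc]
    | mul a b ha hb =>
      have : ∀ s t : hC.H ⊗[k] hC.H,
          TensorProduct.lift (LinearMap.mul k hC.H) (M.S.rTensor hC.H s) = M.counit a • 1 →
          TensorProduct.lift (LinearMap.mul k hC.H) (M.S.rTensor hC.H (s * t)) =
          M.counit a • TensorProduct.lift (LinearMap.mul k hC.H) (M.S.rTensor hC.H t) := by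
        intro s t hs
        induction t with
        | zero => simp
        | add t t' h1 h2 => simp only [mul_add, map_add, h1, h2, smul_add]
        | tmul c d =>
          have h1 : TensorProduct.lift (LinearMap.mul k hC.H) (M.S.rTensor hC.H (s * c ⊗ₜ d)) =
              M.S c * TensorProduct.lift (LinearMap.mul k hC.H) (M.S.rTensor hC.H s) * d := by
            clear hs
            induction s with
            | zero => simp
            | add t t' h1 h2 => simp only [add_mul, mul_add, map_add, h1, h2]
            | tmul a b => simp [M.S_mul, mul_assoc]
          rw [h1, hs]
          simp
      rw [map_mul, this _ _ ha, hb, map_mul, mul_smul]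
  antipode_right x := by
    set M := hC.modelH hπ hq
    change TensorProduct.lift (LinearMap.mul k hC.H) (M.S.lTensor hC.H (M.comul x)) =
      M.counit x • 1
    induction x using M.induction with
    | one => simp [M.S_one, Algebra.TensorProduct.one_def]
    | gen x y =>
      rw [M.comul_e, M.counit_e]
      simp only [map_sum, LinearMap.lTensor_tmul, M.S_e, TensorProduct.lift.tmul,
        LinearMap.mul_apply']
      have h1 : (if x = y then (1 : k) else 0) • (1 : hC.H) = if x = y then 1 else 0 := by
        split_ifs <;> simp
      rw [h1]
      exact hC.isInvertible_tH.right x y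
    | add a b ha hb => simp only [map_add, ha, hb, add_smul]
    | smul c a ha => simp only [map_smul, ha, smul_assoc]
    | mul a b ha hb =>
      have : ∀ s t : hC.H ⊗[k] hC.H,
          TensorProduct.lift (LinearMap.mul k hC.H) (M.S.lTensor hC.H t) = M.counit b • 1 →
          TensorProduct.lift (LinearMap.mul k hC.H) (M.S.lTensor hC.H (s * t)) =
          M.counit b • TensorProduct.lift (LinearMap.mul k hC.H) (M.S.lTensor hC.H s) := by
        intro s t ht
        induction s with
        | zero => simp
        | add t t' h1 h2 => simp only [add_mul, map_add, h1, h2, smul_add]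
        | tmul c d =>
          have h1 : TensorProduct.lift (LinearMap.mul k hC.H) (M.S.lTensor hC.H (c ⊗ₜ d * t)) =
              c * TensorProduct.lift (LinearMap.mul k hC.H) (M.S.lTensor hC.H t) * M.S d := by
            clear ht
            induction t with
            | zero => simp
            | add t t' h1 h2 => simp only [add_mul, mul_add, map_add, h1, h2]
            | tmul a b => simp [M.S_mul, mul_assoc]
          rw [h1, ht]
          simp
      rw [map_mul, this _ _ hb, ha, map_mul, smul_smul, mul_comm]

end Block
end QDouble
end

/-! ### Transport of braided structures along linear isomorphisms -/

noncomputable section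

namespace QDouble

section Transport

variable {k G V W Z : Type*} [Field k] [Group G] [Fintype G] [DecidableEq G]
  [AddCommGroup V] [Module k V] [AddCommGroup W] [Module k W] [AddCommGroup Z] [Module k Z]
  {X : BraidedData k G V} {Y : BraidedData k G W} {T : BraidedData k G Z}

/-- The structure maps on `V` obtained from those on `W` by a linear isomorphism. -/
def BraidedData.transport (Y : BraidedData k G W) (f : V ≃ₗ[k] W) : BraidedData k G V where
  act g := f.symm.toLinearMap ∘ₗ Y.act g ∘ₗ f.toLinearMap
  proj g := f.symm.toLinearMap ∘ₗ Y.proj g ∘ₗ f.toLinearMap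
  mul := (Y.mul.compl₁₂ f.toLinearMap f.toLinearMap).compr₂ f.symm.toLinearMap
  one := f.symm Y.one
  comul := TensorProduct.map f.symm.toLinearMap f.symm.toLinearMap ∘ₗ Y.comul ∘ₗ f.toLinearMap
  counit := Y.counit ∘ₗ f.toLinearMap

theorem map_map_symm (f : V ≃ₗ[k] W) (t : W ⊗[k] W) :
    TensorProduct.map f.toLinearMap f.toLinearMap
      (TensorProduct.map f.symm.toLinearMap f.symm.toLinearMap t) = t :=
  (TensorProduct.congr f f).apply_symm_apply t

theorem map_equiv_injective (f : V ≃ₗ[k] W) :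
    Function.Injective (TensorProduct.map f.toLinearMap f.toLinearMap) :=
  (TensorProduct.congr f f).injective

theorem isBraidedMap_transport (Y : BraidedData k G W) (f : V ≃ₗ[k] W) :
    IsBraidedMap (Y.transport f) Y f.toLinearMap where
  map_act g x := by simp [BraidedData.transport]
  map_proj g x := by simp [BraidedData.transport]
  map_mul x y := by simp [BraidedData.transport]
  map_one := by simp [BraidedData.transport]
  map_comul x := (map_map_symm f _).symm
  map_counit x := rfl

theorem IsBraidedMap.comp {f : V →ₗ[k] W} {g : W →ₗ[k] Z} (hg : IsBraidedMap Y T g)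
    (hf : IsBraidedMap X Y f) : IsBraidedMap X T (g ∘ₗ f) where
  map_act h x := by simp [hf.map_act, hg.map_act]
  map_proj h x := by simp [hf.map_proj, hg.map_proj]
  map_mul x y := by simp [hf.map_mul, hg.map_mul]
  map_one := by simp [hf.map_one, hg.map_one]
  map_comul x := by
    rw [LinearMap.comp_apply, hg.map_comul, hf.map_comul, TensorProduct.map_comp]
    rfl
  map_counit x := by simp [hf.map_counit, hg.map_counit]

theorem IsBraidedMap.symm {f : V ≃ₗ[k] W} (hf : IsBraidedMap X Y f.toLinearMap) :
    IsBraidedMap Y X f.symm.toLinearMap where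
  map_act g x := by
    have := hf.map_act g (f.symm x)
    apply f.injective
    simpa using this.symm
  map_proj g x := by
    have := hf.map_proj g (f.symm x)
    apply f.injective
    simpa using this.symm
  map_mul x y := by
    have := hf.map_mul (f.symm x) (f.symm y)
    apply f.injective
    simpa using this.symm
  map_one := by
    apply f.injective
    simpa using hf.map_one.symm
  map_comul x := by
    apply map_equiv_injective f
    rw [map_map_symm]
    have := hf.map_comul (f.symm x)
    simpa using this.symm
  map_counit x := by
    have := hf.map_counit (f.symm x)
    simpa using this.symm

theorem IsBraidedMap.lift_rTensor {f : V →ₗ[k] W} (hf : IsBraidedMap X Y f) {S : V →ₗ[k] V}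
    {S' : W →ₗ[k] W} (hS : ∀ x, f (S x) = S' (f x)) (t : V ⊗[k] V) :
    f (TensorProduct.lift X.mul (S.rTensor V t)) =
      TensorProduct.lift Y.mul (S'.rTensor W (TensorProduct.map f f t)) := by
  induction t with
  | zero => simp
  | add s t hs ht => simp only [map_add, hs, ht]
  | tmul a b => simp [hf.map_mul, hS]

theorem IsBraidedMap.lift_lTensor {f : V →ₗ[k] W} (hf : IsBraidedMap X Y f) {S : V →ₗ[k] V}
    {S' : W →ₗ[k] W} (hS : ∀ x, f (S x) = S' (f x)) (t : V ⊗[k] V) :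
    f (TensorProduct.lift X.mul (S.lTensor V t)) =
      TensorProduct.lift Y.mul (S'.lTensor W (TensorProduct.map f f t)) := by
  induction t with
  | zero => simp
  | add s t hs ht => simp only [map_add, hs, ht]
  | tmul a b => simp [hf.map_mul, hS]

theorem IsBraidedMap.tensorMul {f : V →ₗ[k] W} (hf : IsBraidedMap X Y f) (s t : V ⊗[k] V) :
    TensorProduct.map f f (X.tensorMul s t) =
      Y.tensorMul (TensorProduct.map f f s) (TensorProduct.map f f t) := by
  induction s with
  | zero => simp
  | add s s' hs hs' => simp only [map_add, LinearMap.add_apply, hs, hs']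
  | tmul a b =>
    induction t with
    | zero => simp
    | add s t hs ht => simp only [map_add, hs, ht]
    | tmul c d =>
      simp [Block.FRTModel.tensorMul_tmul, hf.map_mul, hf.map_act, hf.map_proj]

theorem IsBraidedMap.isCrossedEnd {f : V ≃ₗ[k] W} (hf : IsBraidedMap X Y f.toLinearMap)
    {S : V →ₗ[k] V} {S' : W →ₗ[k] W} (hS : ∀ x, f (S x) = S' (f x)) (h : IsCrossedEnd Y S') :
    IsCrossedEnd X S where
  map_act g x := by
    apply f.injective
    have h1 := hf.map_act g x
    have h2 := hf.map_act g (S x)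
    simp only [LinearEquiv.coe_coe] at h1 h2
    rw [hS, h1, h2, hS, h.map_act]
  map_proj g x := by
    apply f.injective
    have h1 := hf.map_proj g x
    have h2 := hf.map_proj g (S x)
    simp only [LinearEquiv.coe_coe] at h1 h2
    rw [hS, h1, h2, hS, h.map_proj]

theorem IsBraidedMap.isBraidedAntipode {f : V ≃ₗ[k] W} (hf : IsBraidedMap X Y f.toLinearMap)
    {S : V →ₗ[k] V} {S' : W →ₗ[k] W} (hS : ∀ x, f (S x) = S' (f x))
    (h : IsBraidedAntipode Y S') : IsBraidedAntipode X S where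
  toIsCrossedEnd := hf.isCrossedEnd hS h.toIsCrossedEnd
  antipode_left x := by
    apply f.injective
    have h1 := hf.lift_rTensor hS (X.comul x)
    rw [← hf.map_comul, h.antipode_left, hf.map_counit, ← hf.map_one] at h1
    simpa using h1
  antipode_right x := by
    apply f.injective
    have h1 := hf.lift_lTensor hS (X.comul x)
    rw [← hf.map_comul, h.antipode_right, hf.map_counit, ← hf.map_one] at h1
    simpa using h1

theorem lift_braiding_tmul (X : BraidedData k G V) (x y : V) :
    TensorProduct.lift X.mul (X.braiding (x ⊗ₜ y)) = ∑ g, X.mul (X.act g y) (X.proj g x) := by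
  simp [BraidedData.braiding]

theorem IsBraidedMap.isBraidedAntiAlgMap {f : V ≃ₗ[k] W} (hf : IsBraidedMap X Y f.toLinearMap)
    {S : V →ₗ[k] V} {S' : W →ₗ[k] W} (hS : ∀ x, f (S x) = S' (f x))
    (h : IsBraidedAntiAlgMap Y S') : IsBraidedAntiAlgMap X S where
  toIsCrossedEnd := hf.isCrossedEnd hS h.toIsCrossedEnd
  map_one := by
    apply f.injective
    have h1 := hf.map_one
    simp only [LinearEquiv.coe_coe] at h1
    rw [hS, h1, h.map_one]
  map_mul x y := by
    apply f.injective
    have h1 := hf.map_mul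
    have h2 := hf.map_act
    have h3 := hf.map_proj
    simp only [LinearEquiv.coe_coe] at h1 h2 h3
    simp only [hS, h1, h.map_mul, lift_braiding_tmul, map_sum, h2, h3]

theorem map_map_assoc (f : V →ₗ[k] W) (t : (V ⊗[k] V) ⊗[k] V) :
    TensorProduct.map f (TensorProduct.map f f) (TensorProduct.assoc k V V V t) =
      TensorProduct.assoc k W W W (TensorProduct.map (TensorProduct.map f f) f t) := by
  induction t with
  | zero => simp
  | add s t hs ht => simp only [map_add, hs, ht]
  | tmul a b =>
    induction a with
    | zero => simp
    | add s t hs ht => simp only [TensorProduct.add_tmul, map_add, hs, ht]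
    | tmul a c => simp

theorem IsBraidedMap.isBraidedBialgebra {f : V ≃ₗ[k] W} (hf : IsBraidedMap X Y f.toLinearMap)
    (h : IsBraidedBialgebra Y) : IsBraidedBialgebra X := by
  have h1 : ∀ x y, f (X.mul x y) = Y.mul (f x) (f y) := hf.map_mul
  have h2 : ∀ g x, f (X.act g x) = Y.act g (f x) := hf.map_act
  have h3 : ∀ g x, f (X.proj g x) = Y.proj g (f x) := hf.map_proj
  have h4 : f X.one = Y.one := hf.map_one
  have h5 : ∀ x, TensorProduct.map f.toLinearMap f.toLinearMap (X.comul x) = Y.comul (f x) :=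
    fun x => (hf.map_comul x).symm
  have h6 : ∀ x, X.counit x = Y.counit (f x) := fun x => (hf.map_counit x).symm
  refine { act_one := ?_, act_mul := ?_, proj_proj := ?_, sum_proj := ?_, act_proj := ?_,
           mul_assoc := ?_, one_mul := ?_, mul_one := ?_, coassoc := ?_, counit_comul := ?_,
           comul_counit := ?_, act_mul_map := ?_, proj_mul_map := ?_, act_one_map := ?_,
           proj_one_map := ?_, comul_act := ?_, comul_proj := ?_, counit_act := ?_,
           counit_proj := ?_, comul_mul := ?_, comul_one := ?_, counit_mul := ?_,
           counit_one := ?_ }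
  · refine LinearMap.ext fun x => f.injective ?_
    rw [h2, h.act_one]; rfl
  · refine fun g g' => LinearMap.ext fun x => f.injective ?_
    rw [h2, h.act_mul, LinearMap.comp_apply, LinearMap.comp_apply, h2, h2]
  · refine fun g g' => LinearMap.ext fun x => f.injective ?_
    have := LinearMap.congr_fun (h.proj_proj g g') (f x)
    rw [LinearMap.comp_apply, h3, h3]
    refine this.trans ?_
    split_ifs
    · exact (h3 _ _).symm
    · simp
  · refine LinearMap.ext fun x => f.injective ?_
    have := LinearMap.congr_fun h.sum_proj (f x)
    rw [LinearMap.sum_apply] at this ⊢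
    rw [map_sum]
    simp only [h3]
    exact this
  · refine fun g g' => LinearMap.ext fun x => f.injective ?_
    have := LinearMap.congr_fun (h.act_proj g g') (f x)
    simpa only [LinearMap.comp_apply, h2, h3] using this
  · exact fun x y z => f.injective (by rw [h1, h1, h1, h1, h.mul_assoc])
  · exact fun x => f.injective (by rw [h1, h4, h.one_mul])
  · exact fun x => f.injective (by rw [h1, h4, h.mul_one])
  · refine LinearMap.ext fun x => ?_
    apply (TensorProduct.congr f (TensorProduct.congr f f)).injective
    have h7 := LinearMap.congr_fun h.coassoc (f x)
    simp only [LinearMap.comp_apply, LinearEquiv.coe_coe, ← h5] at h7 ⊢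
    change TensorProduct.map f.toLinearMap (TensorProduct.map f.toLinearMap f.toLinearMap) _ =
      TensorProduct.map f.toLinearMap (TensorProduct.map f.toLinearMap f.toLinearMap) _
    rw [map_map_assoc]
    have h8 : ∀ t : V ⊗[k] V, TensorProduct.map
        (TensorProduct.map f.toLinearMap f.toLinearMap) f.toLinearMap (X.comul.rTensor V t) =
        Y.comul.rTensor W (TensorProduct.map f.toLinearMap f.toLinearMap t) := by
      intro t
      induction t with
      | zero => simp
      | add s t hs ht => simp only [map_add, hs, ht]
      | tmul a b => simp [h5]
    have h9 : ∀ t : V ⊗[k] V, TensorProduct.map f.toLinearMap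
        (TensorProduct.map f.toLinearMap f.toLinearMap) (X.comul.lTensor V t) =
        Y.comul.lTensor W (TensorProduct.map f.toLinearMap f.toLinearMap t) := by
      intro t
      induction t with
      | zero => simp
      | add s t hs ht => simp only [map_add, hs, ht]
      | tmul a b => simp [h5]
    rw [h8, h9, h7]
  · intro x
    apply f.injective
    rw [← h.counit_comul (f x), ← h5]
    induction X.comul x with
    | zero => simp
    | add s t hs ht => simp only [map_add, hs, ht]
    | tmul a b => simp [h6]
  · intro x
    apply f.injective
    rw [← h.comul_counit (f x), ← h5]
    induction X.comul x with
    | zero => simp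
    | add s t hs ht => simp only [map_add, hs, ht]
    | tmul a b => simp [h6]
  · exact fun g x y => f.injective (by rw [h2, h1, h1, h2, h2, h.act_mul_map])
  · exact fun g x y => f.injective (by
      rw [h3, h1, h.proj_mul_map, map_sum]
      simp only [h1, h3])
  · exact fun g => f.injective (by rw [h2, h4, h.act_one_map])
  · exact f.injective (by rw [h3, h4, h.proj_one_map])
  · intro g x
    apply map_equiv_injective f
    rw [h5, h2, h.comul_act, ← h5]
    induction X.comul x with
    | zero => simp
    | add s t hs ht => simp only [map_add, hs, ht]
    | tmul a b => simp [h2]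
  · intro g x
    apply map_equiv_injective f
    rw [h5, h3, h.comul_proj, ← h5, map_sum]
    refine Finset.sum_congr rfl fun g' _ => ?_
    induction X.comul x with
    | zero => simp
    | add s t hs ht => simp only [map_add, hs, ht]
    | tmul a b => simp [h3]
  · exact fun g x => by rw [h6, h2, h.counit_act, h6]
  · exact fun g x => by rw [h6, h3, h.counit_proj, h6]
  · intro x y
    apply map_equiv_injective f
    rw [h5, h1, h.comul_mul, hf.tensorMul, h5, h5]
  · apply map_equiv_injective f
    rw [h5, h4, h.comul_one]
    simp [h4]
  · exact fun x y => by rw [h6, h1, h.counit_mul, h6, h6]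
  · rw [h6, h4, h.counit_one]

end Transport
end QDouble
end

/-! ### Identification of an algebra with the transmutation of a model -/

noncomputable section

namespace QDouble

namespace Block

variable {k G : Type*} [Field k] [Group G] [Fintype G] [DecidableEq G] {D : Block k G}
  {hC : D.InvStable} {A : Type*} [Ring A] [Algebra k A]

theorem FRTModel.induction_right (M : FRTModel hC A) {P : A → Prop}
    (one : P 1) (gen : ∀ x y a, P a → P (a * M.e x y))
    (add : ∀ a b, P a → P b → P (a + b)) (smul : ∀ (c : k) a, P a → P (c • a)) (a : A) : P a := by
  have : ∀ b, P b → P (b * a) := by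
    induction a using M.induction with
    | one => intro b hb; rwa [mul_one]
    | gen x y => exact gen x y
    | mul a a' ha ha' => intro b hb; rw [← mul_assoc]; exact ha' _ (ha _ hb)
    | add a a' ha ha' => intro b hb; rw [mul_add]; exact add _ _ (ha _ hb) (ha' _ hb)
    | smul c a ha => intro b hb; rw [mul_smul_comm]; exact smul _ _ (ha _ hb)
  simpa using this 1 one

/-- An algebra `U` generated by elements `E x y`, with the action of `G` on `U` by algebra maps
which extends that on `End(V_{𝒞,π})`. -/
structure Covariant (D : Block k G) (U : Type*) [Ring U] [Algebra k U] where
  E : D.Idx → D.Idx → U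
  adjoin_E : Algebra.adjoin k {u | ∃ x y, u = E x y} = ⊤
  σ : G → U →ₐ[k] U
  σ_E : ∀ g x y, σ g (E x y) = hat E (D.rho g * unit x y * D.rho g⁻¹)

namespace Covariant

variable {U : Type*} [Ring U] [Algebra k U] (C : Covariant D U)

theorem σ_hat (g : G) (c : Matrix D.Idx D.Idx k) :
    C.σ g (hat C.E c) = hat C.E (D.rho g * c * D.rho g⁻¹) := by
  have : (C.σ g).toLinearMap ∘ₗ hat C.E =
      hat C.E ∘ₗ LinearMap.mulRight k (D.rho g⁻¹) ∘ₗ LinearMap.mulLeft k (D.rho g) :=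
    hat_ext fun x y => by simp [hat_unit, σ_E]
  exact LinearMap.congr_fun this c

theorem σ_σ (g h : G) (u : U) : C.σ g (C.σ h u) = C.σ (g * h) u := by
  have : (C.σ g).comp (C.σ h) = C.σ (g * h) :=
    AlgHom.ext_of_adjoin_eq_top C.adjoin_E (by
      rintro _ ⟨x, y, rfl⟩
      simp only [AlgHom.comp_apply, σ_E, σ_hat, map_mul, mul_inv_rev, mul_assoc])
  exact DFunLike.congr_fun this u

theorem σ_one (u : U) : C.σ 1 u = u := by
  have : C.σ 1 = AlgHom.id k U :=
    AlgHom.ext_of_adjoin_eq_top C.adjoin_E (by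
      rintro _ ⟨x, y, rfl⟩
      simp [σ_E, hat_unit])
  exact DFunLike.congr_fun this u

end Covariant

/-- An algebra `U` generated by elements `E x y` which acts on `A` through the transmuted product,
and on which `A` acts through the inverse of the transmutation of the product. -/
structure Twist (M : FRTModel hC A) (U : Type*) [Ring U] [Algebra k U] extends Covariant D U where
  ψ : U →ₐ[k] Module.End k A
  ψ_E : ∀ x y, ψ (E x y) = M.trans.mul (M.e x y)
  χ : A →ₐ[k] (Module.End k U)ᵐᵒᵖ
  χ_e : ∀ x y, χ (M.e x y) =
    MulOpposite.op (LinearMap.mulLeft k (E x y) ∘ₗ (σ y.1).toLinearMap)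

namespace Twist

variable {M : FRTModel hC A} {U : Type*} [Ring U] [Algebra k U] (T : Twist M U)

theorem induction {P : U → Prop} (one : P 1) (gen : ∀ x y, P (T.E x y))
    (mul : ∀ a b, P a → P b → P (a * b)) (add : ∀ a b, P a → P b → P (a + b))
    (smul : ∀ (c : k) a, P a → P (c • a)) (a : U) : P a := by
  have ha : a ∈ Algebra.adjoin k {a | ∃ x y, a = T.E x y} := by rw [T.adjoin_E]; trivial
  induction ha using Algebra.adjoin_induction with
  | mem x hx => obtain ⟨x, y, rfl⟩ := hx; exact gen x y
  | algebraMap r => rw [Algebra.algebraMap_eq_smul_one]; exact smul _ _ one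
  | add x y _ _ hx hy => exact add _ _ hx hy
  | mul x y _ _ hx hy => exact mul _ _ hx hy

theorem induction_left {P : U → Prop} (one : P 1) (gen : ∀ x y a, P a → P (T.E x y * a))
    (add : ∀ a b, P a → P b → P (a + b)) (smul : ∀ (c : k) a, P a → P (c • a)) (a : U) : P a := by
  have : ∀ b, P b → P (a * b) := by
    induction a using T.induction with
    | one => intro b hb; rwa [one_mul]
    | gen x y => exact gen x y
    | mul a a' ha ha' => intro b hb; rw [mul_assoc]; exact ha _ (ha' _ hb)
    | add a a' ha ha' => intro b hb; rw [add_mul]; exact add _ _ (ha _ hb) (ha' _ hb)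
    | smul c a ha => intro b hb; rw [smul_mul_assoc]; exact smul _ _ (ha _ hb)
  simpa using this 1 one

/-- The map `U → A`, as a linear map. -/
def toFun : U →ₗ[k] A := LinearMap.applyₗ 1 ∘ₗ T.ψ.toLinearMap

/-- The map `A → U`, as a linear map. -/
def invFun : A →ₗ[k] U :=
  LinearMap.applyₗ 1 ∘ₗ (MulOpposite.opLinearEquiv k).symm.toLinearMap ∘ₗ T.χ.toLinearMap

theorem toFun_apply (u : U) : T.toFun u = T.ψ u 1 := rfl

theorem invFun_apply (a : A) : T.invFun a = (T.χ a).unop 1 := rfl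

theorem toFun_one : T.toFun 1 = 1 := by simp [toFun_apply]

theorem invFun_one : T.invFun 1 = 1 := by simp [invFun_apply]

variable (hπ : D.IsOrthogonal) (hq : hC.Compatible)
include hπ hq

theorem toFun_E (x y : D.Idx) : T.toFun (T.E x y) = M.e x y := by
  rw [toFun_apply, ψ_E]
  exact (M.trans_isBraidedBialgebra hπ hq).mul_one _

theorem toFun_E_mul (x y : D.Idx) (u : U) :
    T.toFun (T.E x y * u) = M.trans.mul (M.e x y) (T.toFun u) := by
  rw [toFun_apply, map_mul, ψ_E]
  rfl

theorem toFun_mul (u v : U) : T.toFun (u * v) = M.trans.mul (T.toFun u) (T.toFun v) := by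
  have hM := M.trans_isBraidedBialgebra hπ hq
  induction u using T.induction_left with
  | one => rw [one_mul, toFun_one]; exact (hM.one_mul _).symm
  | gen x y a ha =>
    rw [mul_assoc, T.toFun_E_mul hπ hq, T.toFun_E_mul hπ hq, ha, hM.mul_assoc]
  | add a b ha hb => rw [add_mul, map_add, map_add, map_add, LinearMap.add_apply, ha, hb]
  | smul c a ha => rw [smul_mul_assoc, map_smul, map_smul, map_smul, LinearMap.smul_apply, ha]

theorem toFun_hat (c : Matrix D.Idx D.Idx k) : T.toFun (hat T.E c) = hat M.e c := by
  rw [map_hat]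
  simp only [T.toFun_E hπ hq]

theorem toFun_σ (g : G) (u : U) : T.toFun (T.σ g u) = M.act g (T.toFun u) := by
  have hM := M.trans_isBraidedBialgebra hπ hq
  induction u using T.induction with
  | one => rw [map_one, toFun_one, map_one]
  | gen x y => rw [T.σ_E, T.toFun_hat hπ hq, T.toFun_E hπ hq, ← M.act_hat, hat_unit]
  | mul a b ha hb =>
    have h1 := hM.act_mul_map g (T.toFun a) (T.toFun b)
    simp only [M.trans_act hπ hq, AlgHom.toLinearMap_apply] at h1
    rw [map_mul, T.toFun_mul hπ hq, T.toFun_mul hπ hq, ha, hb, h1]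
  | add a b ha hb => simp only [map_add, ha, hb]
  | smul c a ha => simp only [map_smul, ha]

omit hπ hq in
-- This mirrors the identity `a · e = e • (y ▷ a)` in the model, with `e = e x y`, and explains both
-- the form of `χ` and the opposite algebra in its target.
theorem invFun_mul_e (a : A) (x y : D.Idx) :
    T.invFun (a * M.e x y) = T.E x y * T.σ y.1 (T.invFun a) := by
  rw [invFun_apply, map_mul, χ_e]
  rfl

theorem toFun_invFun (a : A) : T.toFun (T.invFun a) = a := by
  induction a using M.induction_right with
  | one => rw [invFun_one, toFun_one]
  | gen x y a ha =>
    -- The transmuted product with `e x y` acts by `y⁻¹` on the other factor, which undoes the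
    -- action of `y` built into `χ`.
    rw [invFun_mul_e, T.toFun_E_mul hπ hq, T.toFun_σ hπ hq, ha,
      (FRTModel.Homog.gen x y).trans_mul' hπ hq, M.act_act, inv_mul_cancel, M.act_one,
      AlgHom.id_apply]
  | add a b ha hb => simp only [map_add, ha, hb]
  | smul c a ha => simp only [map_smul, ha]

omit hπ hq in
theorem invFun_act (g : G) (a : A) : T.invFun (M.act g a) = T.σ g (T.invFun a) := by
  induction a using M.induction_right with
  | one => rw [map_one, invFun_one, map_one]
  | gen x y a ha =>
    -- Only labels with `j = gyg⁻¹` contribute, and for those `σ_j σ_g = σ_{gy}`.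
    have h1 : ∀ i j, (D.rho g * unit x y * D.rho g⁻¹) i j •
        (T.E i j * T.σ j.1 (T.σ g (T.invFun a))) =
        (D.rho g * unit x y * D.rho g⁻¹) i j • (T.E i j * T.σ (g * y.1) (T.invFun a)) := by
      intro i j
      rw [mul_unit_mul]
      by_cases h0 : D.rho g⁻¹ y j = 0
      · rw [h0, mul_zero, zero_smul, zero_smul]
      · rw [T.σ_σ]
        congr 4
        rw [rho_ne_zero h0]
        group
    rw [map_mul, ← hat_unit M.e x y, M.act_hat, hat_apply]
    simp only [Finset.mul_sum, mul_smul_comm, map_sum, map_smul, invFun_mul_e, ha, h1]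
    rw [hat_unit, invFun_mul_e, map_mul, T.σ_E, hat_apply, T.σ_σ]
    simp only [Finset.sum_mul, smul_mul_assoc]
  | add a b ha hb => simp only [map_add, ha, hb]
  | smul c a ha => simp only [map_smul, ha]

theorem invFun_toFun (u : U) : T.invFun (T.toFun u) = u := by
  induction u using T.induction_left with
  | one => rw [toFun_one, invFun_one]
  | gen x y a ha =>
    rw [T.toFun_E_mul hπ hq, (FRTModel.Homog.gen x y).trans_mul' hπ hq, invFun_mul_e,
      invFun_act, ha, T.σ_σ, mul_inv_cancel, T.σ_one]
  | add a b ha hb => simp only [map_add, ha, hb]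
  | smul c a ha => simp only [map_smul, ha]

/-- The linear isomorphism `U ≃ A` with `E x y ↦ e x y`. -/
def equiv : U ≃ₗ[k] A :=
  { T.toFun with
    invFun := T.invFun
    left_inv := T.invFun_toFun hπ hq
    right_inv := T.toFun_invFun hπ hq }

theorem equiv_apply (u : U) : T.equiv hπ hq u = T.toFun u := rfl

theorem equiv_E (x y : D.Idx) : T.equiv hπ hq (T.E x y) = M.e x y := T.toFun_E hπ hq x y

/-- The braided bialgebra structure of `U`. -/
def braided : BraidedData k G U := M.trans.transport (T.equiv hπ hq)

theorem isBraidedMap_equiv :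
    IsBraidedMap (T.braided hπ hq) M.trans (T.equiv hπ hq).toLinearMap :=
  isBraidedMap_transport _ _

theorem braided_act (g : G) : (T.braided hπ hq).act g = (T.σ g).toLinearMap := by
  refine LinearMap.ext fun u => (T.equiv hπ hq).injective ?_
  have := (T.isBraidedMap_equiv hπ hq).map_act g u
  refine this.trans ?_
  rw [M.trans_act hπ hq]
  exact (T.toFun_σ hπ hq g u).symm

theorem braided_mul : (T.braided hπ hq).mul = LinearMap.mul k U := by
  refine LinearMap.ext₂ fun u v => (T.equiv hπ hq).injective ?_
  have := (T.isBraidedMap_equiv hπ hq).map_mul u v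
  exact this.trans (T.toFun_mul hπ hq u v).symm

theorem isMatrixBraided : D.IsMatrixBraided T.E (T.braided hπ hq) where
  toIsBraidedBialgebra :=
    (T.isBraidedMap_equiv hπ hq).isBraidedBialgebra (M.trans_isBraidedBialgebra hπ hq)
  mul_eq := T.braided_mul hπ hq
  one_eq := by
    apply (T.equiv hπ hq).injective
    exact (T.isBraidedMap_equiv hπ hq).map_one.trans (T.toFun_one).symm
  act_gen g x y := by
    rw [T.braided_act hπ hq, actGen_eq_hat]
    exact T.σ_E g x y
  proj_gen g x y := by
    apply (T.equiv hπ hq).injective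
    refine ((T.isBraidedMap_equiv hπ hq).map_proj g _).trans ?_
    rw [LinearEquiv.coe_coe, T.equiv_E, M.trans_proj_e hπ hq]
    split_ifs
    · rw [T.equiv_E]
    · rw [map_zero]
  comul_gen x y := by
    apply map_equiv_injective (T.equiv hπ hq)
    refine ((T.isBraidedMap_equiv hπ hq).map_comul _).symm.trans ?_
    rw [LinearEquiv.coe_coe, T.equiv_E]
    refine (M.comul_e x y).trans ?_
    simp [T.equiv_E]
  counit_gen x y := by
    refine ((T.isBraidedMap_equiv hπ hq).map_counit _).symm.trans ?_
    rw [LinearEquiv.coe_coe, T.equiv_E]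
    exact M.counit_e x y

/-- The braided antipode of `U`. -/
def antipode : U →ₗ[k] U :=
  (T.equiv hπ hq).symm.toLinearMap ∘ₗ M.brS ∘ₗ (T.equiv hπ hq).toLinearMap

theorem equiv_antipode (u : U) :
    T.equiv hπ hq (T.antipode hπ hq u) = M.brS (T.equiv hπ hq u) := by
  simp [antipode]

theorem antipode_E (x y : D.Idx) :
    T.antipode hπ hq (T.E x y) = hC.brAntipodeGen T.E x y := by
  apply (T.equiv hπ hq).injective
  rw [T.equiv_antipode, T.equiv_E, M.brS_e hπ hq, hC.brAntipodeGen_eq, hC.brAntipodeGen_eq]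
  simp [T.equiv_E]

theorem isBraidedAntiAlgMap :
    IsBraidedAntiAlgMap (T.braided hπ hq) (T.antipode hπ hq) :=
  (T.isBraidedMap_equiv hπ hq).isBraidedAntiAlgMap (T.equiv_antipode hπ hq)
    (M.brS_isBraidedAntiAlgMap hπ hq)

theorem antipode_unique (S : U →ₗ[k] U) (hS : IsBraidedAntiAlgMap (T.braided hπ hq) S)
    (hE : ∀ x y, S (T.E x y) = hC.brAntipodeGen T.E x y) : S = T.antipode hπ hq := by
  have h1 := T.isBraidedAntiAlgMap hπ hq
  have h2 : (T.braided hπ hq).one = 1 := (T.isMatrixBraided hπ hq).one_eq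
  have h3 := hS.map_mul
  have h4 := h1.map_mul
  simp only [T.braided_mul hπ hq, LinearMap.mul_apply'] at h3 h4
  refine LinearMap.ext fun u => ?_
  induction u using T.induction with
  | one => rw [← h2, hS.map_one, h1.map_one]
  | gen x y => rw [hE, T.antipode_E]
  | mul a b ha hb => rw [h3, h4, ha, hb]
  | add a b ha hb => rw [map_add, map_add, ha, hb]
  | smul c a ha => rw [map_smul, map_smul, ha]

theorem antipode_bijective : Function.Bijective (T.antipode hπ hq) :=
  ((T.equiv hπ hq).symm.bijective.comp (M.brS_bijective hπ hq)).comp (T.equiv hπ hq).bijective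

theorem isBraidedAntipode (hS : IsAntipode M.coquasi M.S) :
    IsBraidedAntipode (T.braided hπ hq) (T.antipode hπ hq) :=
  (T.isBraidedMap_equiv hπ hq).isBraidedAntipode (T.equiv_antipode hπ hq)
    (M.brS_isBraidedAntipode hπ hq hS)

end Twist

end Block
end QDouble
end

/-! ### The relations of the braided enveloping algebra -/

noncomputable section

namespace QDouble

namespace Block

variable {k G : Type*} [Field k] [Group G] [Fintype G] [DecidableEq G] {D : Block k G}

theorem map_congr_of_support {M : Type*} [AddCommGroup M] [Module k M]
    (f f' : Matrix D.Idx D.Idx k →ₗ[k] M) (c : Matrix D.Idx D.Idx k)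
    (h : ∀ i j, c i j ≠ 0 → f (unit i j) = f' (unit i j)) : f c = f' c := by
  conv_lhs => rw [← hat_unit_eq c]
  conv_rhs => rw [← hat_unit_eq c]
  rw [map_hat, map_hat, hat_apply, hat_apply]
  refine Finset.sum_congr rfl fun i _ => Finset.sum_congr rfl fun j _ => ?_
  by_cases h0 : c i j = 0
  · rw [h0, zero_smul, zero_smul]
  · rw [h i j h0]

theorem rho_inv_mul_cancel (g : G) : D.rho g⁻¹ * D.rho g = 1 := by
  rw [← map_mul, inv_mul_cancel, map_one]

theorem rho_mul_inv_cancel (g : G) : D.rho g * D.rho g⁻¹ = 1 := by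
  rw [← map_mul, mul_inv_cancel, map_one]

theorem rho_inv_mul_cancel_left (g : G) (c : Matrix D.Idx D.Idx k) :
    D.rho g⁻¹ * (D.rho g * c) = c := by
  rw [← mul_assoc, rho_inv_mul_cancel, one_mul]

theorem conj_unit_support {g : G} {x y i j : D.Idx}
    (h : (D.rho g * unit x y * D.rho g⁻¹) i j ≠ 0) :
    (i.1 : G) = g * x.1 * g⁻¹ ∧ (j.1 : G) = g * y.1 * g⁻¹ := by
  rw [mul_unit_mul] at h
  refine ⟨rho_ne_zero (left_ne_zero_of_mul h), ?_⟩
  rw [rho_ne_zero (right_ne_zero_of_mul h)]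
  group

section Relations

variable {B : Type*} [Ring B] [Algebra k B] (E : D.Idx → D.Idx → B)

/-- The elements `E x y` satisfy the relations `· ∘ Ψ̃ = ·`. -/
def IsURel : Prop := ∀ x y z w,
  hat E (D.rho (y.1 : G)⁻¹ * unit z w * D.rho (y.1 : G)⁻¹⁻¹) *
    hat E (D.rho ((y.1 : G)⁻¹ * (w.1 : G) * (z.1 : G)⁻¹ * (y.1 : G)) * unit x y) = E x y * E z w

variable {E}

/-- The relation for a pair of generators depends on the labels only through the upper label `m` of
the first and the crossed degree `γ` of the second. It therefore extends bilinearly to matrices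
homogeneous in this sense. -/
theorem IsURel.hat_mul_hat (h : IsURel E) {c d : Matrix D.Idx D.Idx k} {m γ : G}
    (hc : ∀ i j, c i j ≠ 0 → (j.1 : G) = m) (hd : ∀ i j, d i j ≠ 0 → (i.1 : G) * (j.1 : G)⁻¹ = γ) :
    hat E (D.rho m⁻¹ * d * D.rho m) * hat E (D.rho (m⁻¹ * γ⁻¹ * m) * c) = hat E c * hat E d := by
  refine map_congr_of_support
    (LinearMap.mulLeft k (hat E (D.rho m⁻¹ * d * D.rho m)) ∘ₗ hat E ∘ₗ
      LinearMap.mulLeft k (D.rho (m⁻¹ * γ⁻¹ * m)))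
    (LinearMap.mulRight k (hat E d) ∘ₗ hat E) c fun x y hxy => ?_
  obtain rfl := hc x y hxy
  refine map_congr_of_support
    (LinearMap.mulRight k (hat E (D.rho ((y.1 : G)⁻¹ * γ⁻¹ * y.1) * unit x y)) ∘ₗ hat E ∘ₗ
      LinearMap.mulRight k (D.rho y.1) ∘ₗ LinearMap.mulLeft k (D.rho (y.1 : G)⁻¹))
    (LinearMap.mulLeft k (hat E (unit x y)) ∘ₗ hat E) d fun z w hzw => ?_
  obtain rfl := hd z w hzw
  have := h x y z w
  rw [inv_inv] at this
  simp only [LinearMap.comp_apply, LinearMap.mulLeft_apply, LinearMap.mulRight_apply, hat_unit,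
    mul_inv_rev, inv_inv, ← mul_assoc]
  simpa only [mul_assoc] using this

theorem hat_conj (g : G) (c : Matrix D.Idx D.Idx k) :
    hat (fun x y => hat E (D.rho g * unit x y * D.rho g⁻¹)) c =
      hat E (D.rho g * c * D.rho g⁻¹) :=
  map_congr_of_support _
    (hat E ∘ₗ LinearMap.mulRight k (D.rho g⁻¹) ∘ₗ LinearMap.mulLeft k (D.rho g)) c
    fun x y _ => by rw [hat_unit]; rfl

/-- The braiding is equivariant: conjugating both generators conjugates `m` and `γ`. This gives the
action of `G` on `U` by algebra maps. -/
theorem IsURel.conj (h : IsURel E) (g : G) :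
    IsURel fun x y => hat E (D.rho g * unit x y * D.rho g⁻¹) := by
  intro x y z w
  rw [hat_conj, hat_conj, ← h.hat_mul_hat (c := D.rho g * unit x y * D.rho g⁻¹)
    (d := D.rho g * unit z w * D.rho g⁻¹) (m := g * y.1 * g⁻¹)
    (γ := g * (z.1 * (w.1 : G)⁻¹) * g⁻¹) (fun i j hij => (conj_unit_support hij).2)
    (fun i j hij => by
      rw [(conj_unit_support hij).1, (conj_unit_support hij).2]; group)]
  simp only [mul_inv_rev, inv_inv, map_mul, mul_assoc, rho_inv_mul_cancel_left]

theorem map_hat_algHom {B' : Type*} [Ring B'] [Algebra k B'] (f : B →ₐ[k] B')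
    (c : Matrix D.Idx D.Idx k) : f (hat E c) = hat (fun x y => f (E x y)) c :=
  map_hat E f.toLinearMap c

theorem URel_iff (f : FreeAlgebra k (D.Idx × D.Idx) →ₐ[k] B) (x y z w : D.Idx) :
    f (D.actGen D.genT (y.1 : G)⁻¹ z w *
        D.actLow D.genT ((y.1 : G)⁻¹ * (w.1 : G) * (z.1 : G)⁻¹ * (y.1 : G)) x y) =
      f (D.genT x y * D.genT z w) ↔
    hat (fun x y => f (D.genT x y)) (D.rho (y.1 : G)⁻¹ * unit z w * D.rho (y.1 : G)⁻¹⁻¹) *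
      hat (fun x y => f (D.genT x y))
        (D.rho ((y.1 : G)⁻¹ * (w.1 : G) * (z.1 : G)⁻¹ * (y.1 : G)) * unit x y) =
      f (D.genT x y) * f (D.genT z w) := by
  rw [actGen_eq_hat, actLow_eq_hat, map_mul f, map_mul f, map_hat_algHom, map_hat_algHom]

/-- The algebra map from `U(𝓛_{𝒞,π})` given by elements which satisfy its relations. -/
def IsURel.lift (h : IsURel E) : D.U →ₐ[k] B :=
  RingQuot.liftAlgHom k ⟨FreeAlgebra.lift k fun p => E p.1 p.2, by
    rintro _ _ ⟨x, y, z, w⟩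
    rw [URel_iff]
    simpa [genT] using h x y z w⟩

theorem IsURel.lift_E (h : IsURel E) (x y : D.Idx) : h.lift (D.E x y) = E x y := by
  simp [IsURel.lift, Block.E, genT]

variable (D) in
theorem isURel_E : IsURel D.E := by
  intro x y z w
  have := RingQuot.mkAlgHom_rel k (URel.mk (D := D) x y z w)
  rwa [URel_iff] at this

variable (D) in
theorem adjoin_E : Algebra.adjoin k {a | ∃ x y, a = D.E x y} = ⊤ :=
  adjoin_map_eq_top (e := D.genT) (RingQuot.mkAlgHom k D.URel)
    (RingQuot.mkAlgHom_surjective k _) D.adjoin_genT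

end Relations

variable {hC : D.InvStable}

/-- With `F = y⁻¹ ▷ e z w`, both transmuted products equal the ordinary product `F · e x y`. On one
side the twist `L_{|F|}` cancels the translation by `|F|⁻¹`; on the other this is
`Homog.trans_mul'`. -/
theorem FRTModel.isURel {A : Type*} [Ring A] [Algebra k A] (M : FRTModel hC A)
    (hπ : D.IsOrthogonal) (hq : hC.Compatible) :
    IsURel fun x y => (M.trans.mul (M.e x y) : Module.End k A) := by
  intro x y z w
  have hM := M.trans_isBraidedBialgebra hπ hq
  have h1 : ∀ c, hat (fun x y => (M.trans.mul (M.e x y) : Module.End k A)) c =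
      M.trans.mul (hat M.e c) := fun c => (map_hat M.e M.trans.mul c).symm
  have h2 : ∀ a b : A, (M.trans.mul a * M.trans.mul b : Module.End k A) =
      M.trans.mul (M.trans.mul a b) := fun a b =>
    LinearMap.ext fun u => (hM.mul_assoc a b u).symm
  rw [h1, h1, h2, h2, ← M.act_hat, hat_unit, ← M.L_e]
  have h3 := (FRTModel.Homog.gen (M := M) z w).act (y.1 : G)⁻¹
  rw [h3.trans_mul hπ hq, (FRTModel.Homog.gen x y).trans_mul' hπ hq, M.L_L]
  have h4 : ((y.1 : G)⁻¹ * (z.1 : G)⁻¹ * (y.1 : G)⁻¹⁻¹)⁻¹ *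
      ((y.1 : G)⁻¹ * (w.1 : G)⁻¹ * (y.1 : G)⁻¹⁻¹) *
      ((y.1 : G)⁻¹ * (w.1 : G) * (z.1 : G)⁻¹ * (y.1 : G)) = 1 := by group
  rw [h4, M.L_one, AlgHom.id_apply]

/-- The maps `u ↦ E x y (|y| ▷ u)`, in the opposite of the algebra of endomorphisms. -/
def Covariant.op {U : Type*} [Ring U] [Algebra k U] (C : Covariant D U) (x y : D.Idx) :
    (Module.End k U)ᵐᵒᵖ :=
  MulOpposite.op (LinearMap.mulLeft k (C.E x y) ∘ₗ (C.σ y.1).toLinearMap)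

theorem Covariant.isFRT_op {U : Type*} [Ring U] [Algebra k U] (C : Covariant D U)
    (h : IsURel C.E) : IsFRT C.op := by
  intro x y z w
  rw [hat_mul_unit, hat_unit_mul]
  simp only [op, ← MulOpposite.op_smul, ← Finset.op_sum, ← MulOpposite.op_mul]
  congr 1
  refine LinearMap.ext fun u => ?_
  have hl : ∀ v, D.rho x.1 v z • (C.E v w * C.σ w.1 (C.E x y * C.σ y.1 u)) =
      (D.rho x.1 v z • C.E v w) * (C.σ w.1 (C.E x y) * C.σ (w.1 * y.1) u) := by
    intro v
    rw [map_mul, C.σ_σ, smul_mul_assoc]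
  have hr : ∀ v, D.rho y.1 w v • (C.E x y * C.σ y.1 (C.E z v * C.σ v.1 u)) =
      C.E x y * ((D.rho y.1 w v • C.σ y.1 (C.E z v)) * C.σ (w.1 * y.1) u) := by
    intro v
    rw [map_mul, C.σ_σ, smul_mul_assoc, mul_smul_comm]
    by_cases h0 : D.rho y.1 w v = 0
    · rw [h0, zero_smul, zero_smul]
    · rw [rho_ne_zero h0, inv_mul_cancel_right]
  have h1 : ∑ v, D.rho y.1 w v • C.σ y.1 (C.E z v) = hat C.E (D.rho y.1 * unit z w) := by
    have h2 := C.σ_hat y.1 (unit z w * D.rho y.1)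
    rw [hat_unit_mul, map_sum] at h2
    simp only [map_smul] at h2
    rw [h2, mul_assoc, mul_assoc, rho_mul_inv_cancel, mul_one]
  -- The choice `d = w ▷ E_x{}^y` makes `ρ(w⁻¹) d ρ(w)` the matrix unit `E_x{}^y`. Since `w⁻¹γ⁻¹w =
  -- yx⁻¹`, the matrix `ρ(x)` in `c` is turned into `ρ(y)`, as the FRT relation requires.
  have h2 := h.hat_mul_hat (c := D.rho x.1 * unit z w) (d := D.rho w.1 * unit x y * D.rho (w.1 : G)⁻¹)
    (m := w.1) (γ := w.1 * (x.1 * (y.1 : G)⁻¹) * (w.1 : G)⁻¹)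
    (fun i j hij => by
      rw [mul_unit] at hij
      have : j = w := by by_contra h'; simp [h'] at hij
      rw [this])
    (fun i j hij => by
      rw [(conj_unit_support hij).1, (conj_unit_support hij).2]; group)
  simp only [mul_inv_rev, inv_inv, map_mul, mul_assoc, rho_inv_mul_cancel_left, rho_inv_mul_cancel,
    mul_one, hat_unit] at h2
  change (∑ v, D.rho x.1 v z • (LinearMap.mulLeft k (C.E v w) ∘ₗ (C.σ w.1).toLinearMap)) _ =
    (LinearMap.mulLeft k (C.E x y) ∘ₗ (C.σ y.1).toLinearMap) _
  simp only [LinearMap.sum_apply, LinearMap.smul_apply, LinearMap.comp_apply,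
    AlgHom.toLinearMap_apply, LinearMap.mulLeft_apply, map_sum, map_smul, hl]
  simp only [hr]
  rw [← Finset.mul_sum, ← Finset.sum_mul, ← Finset.sum_mul, h1, ← hat_mul_unit C.E, C.σ_E,
    ← mul_assoc, ← mul_assoc]
  congr 1
  rw [mul_assoc (D.rho w.1), ← h2]

end Block
end QDouble
end

/-! ### Convolution with the braided antipode -/

noncomputable section

namespace QDouble

namespace Block

variable {k G : Type*} [Field k] [Group G] [Fintype G] [DecidableEq G] {D : Block k G}
  {hC : D.InvStable} {A : Type*} [Ring A] [Algebra k A]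

theorem InvStable.map_brAntipodeGen {V W : Type*} [AddCommGroup V] [Module k V] [AddCommGroup W]
    [Module k W] (hC : D.InvStable) (f : V →ₗ[k] W) (e : D.Idx → D.Idx → V) (x y : D.Idx) :
    f (hC.brAntipodeGen e x y) = hC.brAntipodeGen (fun x y => f (e x y)) x y := by
  simp [brAntipodeGen]

namespace Twist

variable {M : FRTModel hC A} {U : Type*} [Ring U] [Algebra k U] (T : Twist M U)
  (hπ : D.IsOrthogonal) (hq : hC.Compatible)

/-- The convolution product `u ↦ u₁ (S u₂)` of the identity and the antipode. -/
def convRight : U →ₗ[k] U :=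
  TensorProduct.lift (LinearMap.mul k U) ∘ₗ (T.antipode hπ hq).lTensor U ∘ₗ (T.braided hπ hq).comul

/-- The convolution product `u ↦ (S u₁) u₂` of the antipode and the identity. -/
def convLeft : U →ₗ[k] U :=
  TensorProduct.lift (LinearMap.mul k U) ∘ₗ (T.antipode hπ hq).rTensor U ∘ₗ (T.braided hπ hq).comul

theorem convRight_E (x y : D.Idx) :
    T.convRight hπ hq (T.E x y) = ∑ z, T.E x z * hC.brAntipodeGen T.E z y := by
  simp [convRight, (T.isMatrixBraided hπ hq).comul_gen, T.antipode_E]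

theorem convLeft_E (x y : D.Idx) :
    T.convLeft hπ hq (T.E x y) = ∑ z, hC.brAntipodeGen T.E x z * T.E z y := by
  simp [convLeft, (T.isMatrixBraided hπ hq).comul_gen, T.antipode_E]

theorem toFun_convRight (u : U) : T.toFun (T.convRight hπ hq u) =
    TensorProduct.lift M.trans.mul (M.brS.lTensor A (M.comul (T.toFun u))) := by
  have h := (T.isBraidedMap_equiv hπ hq).lift_lTensor (T.equiv_antipode hπ hq)
    ((T.braided hπ hq).comul u)
  rw [T.braided_mul hπ hq, ← (T.isBraidedMap_equiv hπ hq).map_comul] at h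
  exact h

theorem toFun_convLeft (u : U) : T.toFun (T.convLeft hπ hq u) =
    TensorProduct.lift M.trans.mul (M.brS.rTensor A (M.comul (T.toFun u))) := by
  have h := (T.isBraidedMap_equiv hπ hq).lift_rTensor (T.equiv_antipode hπ hq)
    ((T.braided hπ hq).comul u)
  rw [T.braided_mul hπ hq, ← (T.isBraidedMap_equiv hπ hq).map_comul] at h
  exact h

theorem antipode_σ (g : G) (u : U) :
    T.antipode hπ hq (T.σ g u) = T.σ g (T.antipode hπ hq u) := by
  have := (T.isBraidedAntiAlgMap hπ hq).map_act g u
  rwa [T.braided_act hπ hq] at this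

theorem comul_σ (g : G) (u : U) : (T.braided hπ hq).comul (T.σ g u) =
    TensorProduct.map (T.σ g).toLinearMap (T.σ g).toLinearMap ((T.braided hπ hq).comul u) := by
  have := (T.isMatrixBraided hπ hq).comul_act g u
  rwa [T.braided_act hπ hq] at this

theorem convRight_σ (g : G) (u : U) :
    T.convRight hπ hq (T.σ g u) = T.σ g (T.convRight hπ hq u) := by
  simp only [convRight, LinearMap.comp_apply, T.comul_σ hπ hq]
  induction (T.braided hπ hq).comul u with
  | zero => simp
  | add s t hs ht => simp only [map_add, hs, ht]
  | tmul a b => simp [T.antipode_σ hπ hq]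

theorem convLeft_σ (g : G) (u : U) :
    T.convLeft hπ hq (T.σ g u) = T.σ g (T.convLeft hπ hq u) := by
  simp only [convLeft, LinearMap.comp_apply, T.comul_σ hπ hq]
  induction (T.braided hπ hq).comul u with
  | zero => simp
  | add s t hs ht => simp only [map_add, hs, ht]
  | tmul a b => simp [T.antipode_σ hπ hq]

include hπ hq in
theorem toFun_E_mul_σ (x y : D.Idx) (g : G) (u : U) : T.toFun (T.E x y * T.σ g u) =
    M.act ((y.1 : G)⁻¹ * g) (T.toFun u) * M.e x y := by
  rw [T.toFun_E_mul hπ hq, T.toFun_σ hπ hq, (FRTModel.Homog.gen x y).trans_mul' hπ hq, M.act_act]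

include hπ hq in
theorem toFun_injective : Function.Injective T.toFun := (T.equiv hπ hq).injective

/-- The left side corresponds in the model to `∑ e x z · S(e z y)`, read through `χ`. Because `a₁ •
(S̲a₂)` is an ordinary convolution only after translation by `|a|`, the convolution has to be taken
at `a = R_{x⁻¹y}(e x y)`, for which `R_{|a|} a = e x y`. -/
theorem sum_E_iota_mul_right (x y : D.Idx) :
    ∑ z, T.E (hC.iota y) (hC.iota z) * T.σ (z.1 : G)⁻¹ (T.E x z) =
      T.convRight hπ hq (hat T.E (unit x y * D.rho ((x.1 : G)⁻¹ * (y.1 : G))⁻¹)) := by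
  apply T.toFun_injective hπ hq
  have h1 := (FRTModel.Homog.gen (M := M) x y).R ((x.1 : G)⁻¹ * (y.1 : G))
  rw [T.toFun_convRight, T.toFun_hat hπ hq, ← M.R_e, h1.lift_brS_lTensor hπ hq, M.R_R]
  have h2 : ((x.1 : G)⁻¹)⁻¹ * ((x.1 : G)⁻¹ * (y.1 : G) * (y.1 : G)⁻¹ *
      ((x.1 : G)⁻¹ * (y.1 : G))⁻¹) * ((x.1 : G)⁻¹ * (y.1 : G)) = 1 := by group
  rw [h2, M.R_one, AlgHom.id_apply, M.comul_e]
  simp [T.toFun_E_mul_σ hπ hq, T.toFun_E hπ hq, M.S_e, M.act_one]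

theorem sum_E_iota_mul_left (x y : D.Idx) :
    ∑ z, T.E z y * T.σ y.1 (T.E (hC.iota z) (hC.iota x)) = T.convLeft hπ hq (T.E x y) := by
  apply T.toFun_injective hπ hq
  rw [T.toFun_convLeft, T.toFun_E hπ hq, M.lift_brS_rTensor hπ hq, M.comul_e]
  simp [T.toFun_E_mul_σ hπ hq, T.toFun_E hπ hq, M.S_e, M.act_one]

end Twist

/-! ### The twist for `U`, and the action of `G` on `B` -/

section Models

variable (hC) (hπ : D.IsOrthogonal) (hq : hC.Compatible)

variable (D) in
/-- The braided enveloping algebra `U(𝓛_{𝒞,π})` with its action of `G`. -/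
def covariantU : Covariant D D.U where
  E := D.E
  adjoin_E := D.adjoin_E
  σ g := ((isURel_E D).conj g).lift
  σ_E _ := IsURel.lift_E _

/-- The braided enveloping algebra `U(𝓛_{𝒞,π})` as a twist of the FRT algebra. -/
def InvStable.twistU : Twist (hC.modelA hπ hq) D.U where
  toCovariant := covariantU D
  ψ := ((hC.modelA hπ hq).isURel hπ hq).lift
  ψ_E := IsURel.lift_E _
  χ := ((covariantU D).isFRT_op (isURel_E D)).lift
  χ_e := IsFRT.lift_t _

variable {hC}

/-- The algebra map from `B_{𝒞,π}` given by an algebra map from `U(𝓛_{𝒞,π})` which respects the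
antipode relations. -/
def InvStable.liftB {B' : Type*} [Ring B'] [Algebra k B'] (f : D.U →ₐ[k] B')
    (right : ∀ x y, f (∑ z, D.E x z * hC.brAntipodeGen D.E z y) = if x = y then 1 else 0)
    (left : ∀ x y, f (∑ z, hC.brAntipodeGen D.E x z * D.E z y) = if x = y then 1 else 0) :
    hC.B →ₐ[k] B' :=
  RingQuot.liftAlgHom k ⟨f, by
    have h1 : ∀ x y : D.Idx, f (if x = y then 1 else 0) = if x = y then 1 else 0 := by
      intro x y; split_ifs <;> simp
    rintro _ _ (⟨x, y⟩ | ⟨x, y⟩)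
    · rw [h1, right]
    · rw [h1, left]⟩

theorem InvStable.liftB_mkB {B' : Type*} [Ring B'] [Algebra k B'] (f : D.U →ₐ[k] B')
    (right : ∀ x y, f (∑ z, D.E x z * hC.brAntipodeGen D.E z y) = if x = y then 1 else 0)
    (left : ∀ x y, f (∑ z, hC.brAntipodeGen D.E x z * D.E z y) = if x = y then 1 else 0)
    (u : D.U) : InvStable.liftB f right left (hC.mkB u) = f u :=
  RingQuot.liftAlgHom_mkAlgHom_apply k _ _ _

variable (hC)

theorem InvStable.mkB_surjective : Function.Surjective hC.mkB :=
  RingQuot.mkAlgHom_surjective k _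

/-- The relations of `B` replace the convolution by the counit, which on linear combinations of
matrix units is the trace. Invariance of the trace under conjugation then makes the defining ideal
of `B` stable under `G`. -/
theorem InvStable.mkB_convRight (c : Matrix D.Idx D.Idx k) :
    hC.mkB ((hC.twistU hπ hq).convRight hπ hq (hat D.E c)) = c.trace • 1 := by
  have h1 : ∀ x y, hC.mkB ((hC.twistU hπ hq).convRight hπ hq (D.E x y)) =
      if x = y then 1 else 0 := by
    intro x y
    refine (congrArg hC.mkB ((hC.twistU hπ hq).convRight_E hπ hq x y)).trans ?_
    refine (RingQuot.mkAlgHom_rel k (BRel.right x y)).trans ?_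
    split_ifs <;> simp
  rw [map_hat D.E ((hC.twistU hπ hq).convRight hπ hq), hat_apply]
  simp [h1, Matrix.trace, Finset.sum_smul]

theorem InvStable.mkB_convLeft (c : Matrix D.Idx D.Idx k) :
    hC.mkB ((hC.twistU hπ hq).convLeft hπ hq (hat D.E c)) = c.trace • 1 := by
  have h1 : ∀ x y, hC.mkB ((hC.twistU hπ hq).convLeft hπ hq (D.E x y)) =
      if x = y then 1 else 0 := by
    intro x y
    refine (congrArg hC.mkB ((hC.twistU hπ hq).convLeft_E hπ hq x y)).trans ?_
    refine (RingQuot.mkAlgHom_rel k (BRel.left x y)).trans ?_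
    split_ifs <;> simp
  rw [map_hat D.E ((hC.twistU hπ hq).convLeft hπ hq), hat_apply]
  simp [h1, Matrix.trace, Finset.sum_smul]

theorem trace_conj_unit (g : G) (x y : D.Idx) :
    (D.rho g * unit x y * D.rho g⁻¹).trace = if x = y then 1 else 0 := by
  rw [Matrix.trace_mul_comm, ← mul_assoc, rho_inv_mul_cancel, one_mul]
  simp [Matrix.trace, unit, Matrix.single_apply, ite_and, eq_comm]

/-- The trace is an entry of `ρ(y⁻¹x)`. Were it nonzero, `y = (y⁻¹x) x (y⁻¹x)⁻¹ = y⁻¹xy` would give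
equal class labels, and then the matrix is the identity. So the shifted relation of
`sum_E_iota_mul_right` still has value `δ_{x,y}` in `B`. -/
theorem trace_unit_mul_rho_inv (x y : D.Idx) :
    (unit x y * D.rho ((x.1 : G)⁻¹ * (y.1 : G))⁻¹).trace = if x = y then 1 else 0 := by
  have h1 : (unit x y * D.rho ((x.1 : G)⁻¹ * (y.1 : G))⁻¹).trace =
      D.rho ((x.1 : G)⁻¹ * (y.1 : G))⁻¹ y x := by
    simp [Matrix.trace, unit_mul]
  rw [h1]
  by_cases h : x.1 = y.1
  · rw [h]
    simp [Matrix.one_apply, eq_comm]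
  · rw [if_neg fun h' => h (by rw [h'])]
    by_contra h0
    apply h
    have h3 : (y.1 : G) = (y.1 : G)⁻¹ * x.1 * y.1 := (rho_ne_zero h0).trans (by group)
    have h4 : (y.1 : G) * y.1 = x.1 * y.1 := by
      conv_lhs => rhs; rw [h3]
      group
    exact Subtype.ext (mul_right_cancel h4).symm

/-- The generators `E_{ai}{}^{bj}` of `B_{𝒞,π}`. -/
def InvStable.EB (x y : D.Idx) : hC.B := hC.mkB (D.E x y)

theorem InvStable.adjoin_EB : Algebra.adjoin k {a | ∃ x y, a = hC.EB x y} = ⊤ :=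
  adjoin_map_eq_top (e := D.E) hC.mkB hC.mkB_surjective D.adjoin_E

theorem InvStable.mkB_hat (c : Matrix D.Idx D.Idx k) : hC.mkB (hat D.E c) = hat hC.EB c :=
  map_hat_algHom (B := D.U) (B' := hC.B) (E := D.E) hC.mkB c

theorem InvStable.isURel_EB : IsURel hC.EB := by
  intro x y z w
  have h1 := congrArg hC.mkB (isURel_E D x y z w)
  rwa [map_mul hC.mkB, map_mul hC.mkB, mkB_hat, mkB_hat] at h1

/-- The action of `G` on `B_{𝒞,π}`. -/
def InvStable.σB (g : G) : hC.B →ₐ[k] hC.B :=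
  InvStable.liftB (B' := hC.B) (AlgHom.comp (C := hC.B) hC.mkB ((covariantU D).σ g))
    (fun x y => by
      -- The relation is recognised as a convolution at a generator, the action is moved inside it,
      -- and the convolution at the conjugated matrix unit is evaluated by the trace.
      refine (congrArg (fun u => hC.mkB ((covariantU D).σ g u))
        ((hC.twistU hπ hq).convRight_E hπ hq x y)).symm.trans ?_
      refine (congrArg hC.mkB ((hC.twistU hπ hq).convRight_σ hπ hq g (D.E x y))).symm.trans ?_
      refine (congrArg (fun u => hC.mkB ((hC.twistU hπ hq).convRight hπ hq u))
        ((covariantU D).σ_E g x y)).trans ?_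
      refine (hC.mkB_convRight hπ hq _).trans ?_
      rw [trace_conj_unit]
      split_ifs <;> simp)
    (fun x y => by
      refine (congrArg (fun u => hC.mkB ((covariantU D).σ g u))
        ((hC.twistU hπ hq).convLeft_E hπ hq x y)).symm.trans ?_
      refine (congrArg hC.mkB ((hC.twistU hπ hq).convLeft_σ hπ hq g (D.E x y))).symm.trans ?_
      refine (congrArg (fun u => hC.mkB ((hC.twistU hπ hq).convLeft hπ hq u))
        ((covariantU D).σ_E g x y)).trans ?_
      refine (hC.mkB_convLeft hπ hq _).trans ?_
      rw [trace_conj_unit]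
      split_ifs <;> simp)

theorem InvStable.σB_mkB (g : G) (u : D.U) :
    hC.σB hπ hq g (hC.mkB u) = hC.mkB ((covariantU D).σ g u) :=
  InvStable.liftB_mkB ..

/-- The braided Hopf algebra `B_{𝒞,π}` with its action of `G`. -/
def InvStable.covariantB : Covariant D hC.B where
  E := hC.EB
  adjoin_E := hC.adjoin_EB
  σ := hC.σB hπ hq
  σ_E g x y := (hC.σB_mkB hπ hq g _).trans <|
    (congrArg hC.mkB ((covariantU D).σ_E g x y)).trans (hC.mkB_hat _)

end Models

end Block
end QDouble
end

/-! ### The twist for `B` and `H` -/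

noncomputable section

namespace QDouble

namespace Block

variable {k G : Type*} [Field k] [Group G] [Fintype G] [DecidableEq G] {D : Block k G}
  (hC : D.InvStable) (hπ : D.IsOrthogonal) (hq : hC.Compatible)

theorem FRTModel.sum_trans_mul_brAntipodeGen {hC : D.InvStable} {A : Type*} [Ring A] [Algebra k A]
    (M : FRTModel hC A) (hπ : D.IsOrthogonal) (hq : hC.Compatible) (hS : IsAntipode M.coquasi M.S)
    (x y : D.Idx) :
    ∑ z, M.trans.mul (M.e x z) (hC.brAntipodeGen M.e z y) = if x = y then 1 else 0 := by
  have h : TensorProduct.lift M.trans.mul (M.brS.lTensor A (M.comul (M.e x y))) =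
      M.counit (M.e x y) • 1 := (M.brS_isBraidedAntipode hπ hq hS).antipode_right (M.e x y)
  rw [M.comul_e, M.counit_e, ite_smul, one_smul, zero_smul] at h
  simpa [M.brS_e hπ hq] using h

theorem FRTModel.sum_trans_brAntipodeGen_mul {hC : D.InvStable} {A : Type*} [Ring A] [Algebra k A]
    (M : FRTModel hC A) (hπ : D.IsOrthogonal) (hq : hC.Compatible) (hS : IsAntipode M.coquasi M.S)
    (x y : D.Idx) :
    ∑ z, M.trans.mul (hC.brAntipodeGen M.e x z) (M.e z y) = if x = y then 1 else 0 := by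
  have h : TensorProduct.lift M.trans.mul (M.brS.rTensor A (M.comul (M.e x y))) =
      M.counit (M.e x y) • 1 := (M.brS_isBraidedAntipode hπ hq hS).antipode_left (M.e x y)
  rw [M.comul_e, M.counit_e, ite_smul, one_smul, zero_smul] at h
  simpa [M.brS_e hπ hq] using h

section

variable {hC} {A : Type*} [Ring A] [Algebra k A] (M : FRTModel hC A)

include hπ hq in
theorem FRTModel.trans_mul_mul (a b : A) :
    (M.trans.mul a * M.trans.mul b : Module.End k A) = M.trans.mul (M.trans.mul a b) :=
  LinearMap.ext fun u => ((M.trans_isBraidedBialgebra hπ hq).mul_assoc a b u).symm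

include hπ hq in
theorem FRTModel.trans_mul_ite (p : Prop) [Decidable p] :
    (M.trans.mul (if p then 1 else 0) : Module.End k A) = if p then 1 else 0 := by
  split_ifs
  · exact LinearMap.ext (M.trans_isBraidedBialgebra hπ hq).one_mul
  · exact map_zero _

theorem FRTModel.isURel_lift_brAntipodeGen (x y : D.Idx) :
    (M.isURel hπ hq).lift (hC.brAntipodeGen D.E x y) =
      M.trans.mul (hC.brAntipodeGen M.e x y) := by
  rw [hC.map_brAntipodeGen M.trans.mul]
  refine (hC.map_brAntipodeGen (M.isURel hπ hq).lift.toLinearMap D.E x y).trans ?_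
  simp only [AlgHom.toLinearMap_apply, IsURel.lift_E]

variable (hS : IsAntipode M.coquasi M.S)

/-- The action of `B` on a model of `H` through the transmuted product. -/
def FRTModel.liftB : hC.B →ₐ[k] Module.End k A :=
  InvStable.liftB (M.isURel hπ hq).lift
    (fun x y => by
      simp only [map_sum, map_mul, M.isURel_lift_brAntipodeGen hπ hq, IsURel.lift_E,
        M.trans_mul_mul hπ hq]
      rw [← map_sum, M.sum_trans_mul_brAntipodeGen hπ hq hS, M.trans_mul_ite hπ hq])
    (fun x y => by
      simp only [map_sum, map_mul, M.isURel_lift_brAntipodeGen hπ hq, IsURel.lift_E,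
        M.trans_mul_mul hπ hq]
      rw [← map_sum, M.sum_trans_brAntipodeGen_mul hπ hq hS, M.trans_mul_ite hπ hq])

theorem FRTModel.liftB_mkB (x y : D.Idx) :
    M.liftB hπ hq hS (hC.mkB (D.E x y)) = M.trans.mul (M.e x y) :=
  (InvStable.liftB_mkB ..).trans (IsURel.lift_E _ x y)

end

section

variable {hC} {U : Type*} [Ring U] [Algebra k U] (C : Covariant D U)
  (h1 : ∀ x y, ∑ z, C.E (hC.iota y) (hC.iota z) * C.σ (z.1 : G)⁻¹ (C.E x z) =
    if x = y then 1 else 0)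
  (h2 : ∀ x y, ∑ z, C.E z y * C.σ y.1 (C.E (hC.iota z) (hC.iota x)) = if x = y then 1 else 0)
include h1 h2

/-- Composing two operators `u ↦ E (y ▷ u)` multiplies the acting group elements. In the right
relation they cancel term by term; in the left one they leave the action of `yx⁻¹`, which is
harmless since the coefficient is `δ_{x,y}`. -/
theorem Covariant.isInvertible_op : hC.IsInvertible C.op where
  right x y := by
    have h3 : ∀ u, ∑ z, C.E (hC.iota y) (hC.iota z) *
        C.σ (hC.iota z).1 (C.E x z * C.σ z.1 u) = (if x = y then 1 else 0) * u := by
      intro u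
      rw [← h1, Finset.sum_mul]
      refine Finset.sum_congr rfl fun z _ => ?_
      rw [hC.coe_iota, map_mul, C.σ_σ, inv_mul_cancel, C.σ_one, mul_assoc]
    simp only [op, ← MulOpposite.op_mul, ← Finset.op_sum]
    apply MulOpposite.unop_injective
    refine LinearMap.ext fun u => ?_
    have h4 := h3 u
    split_ifs with h <;> simpa [h] using h4
  left x y := by
    have h3 : ∀ u, ∑ z, C.E z y *
        C.σ y.1 (C.E (hC.iota z) (hC.iota x) * C.σ (hC.iota x).1 u) =
        (if x = y then 1 else 0) * u := by
      intro u
      simp only [hC.coe_iota, map_mul, C.σ_σ, ← mul_assoc]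
      rw [← Finset.sum_mul, h2]
      split_ifs with h
      · rw [h, mul_inv_cancel, C.σ_one]
      · rw [zero_mul, zero_mul]
    simp only [op, ← MulOpposite.op_mul, ← Finset.op_sum]
    apply MulOpposite.unop_injective
    refine LinearMap.ext fun u => ?_
    have h4 := h3 u
    split_ifs with h <;> simpa [h] using h4

variable (h : IsURel C.E)

/-- The action of `H` on `U` through the inverse of the transmutation of the product. -/
def Covariant.liftH : hC.H →ₐ[k] (Module.End k U)ᵐᵒᵖ :=
  (C.isInvertible_op h1 h2).lift (C.isFRT_op h)

theorem Covariant.liftH_tH (x y : D.Idx) : C.liftH h1 h2 h (hC.tH x y) = C.op x y :=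
  InvStable.IsInvertible.lift_tH _ _ x y

end

theorem InvStable.sum_EB_iota_mul_right (x y : D.Idx) :
    ∑ z, hC.EB (hC.iota y) (hC.iota z) * hC.σB hπ hq (z.1 : G)⁻¹ (hC.EB x z) =
      if x = y then 1 else 0 := by
  have h := congrArg hC.mkB ((hC.twistU hπ hq).sum_E_iota_mul_right hπ hq x y)
  have h1 := hC.mkB_convRight hπ hq (unit x y * D.rho ((x.1 : G)⁻¹ * (y.1 : G))⁻¹)
  rw [trace_unit_mul_rho_inv, ite_smul, one_smul, zero_smul] at h1
  refine Eq.trans ?_ (h.trans h1)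
  rw [map_sum hC.mkB]
  refine Finset.sum_congr rfl fun z _ => ?_
  rw [map_mul hC.mkB]
  exact congrArg (hC.EB (hC.iota y) (hC.iota z) * ·) (hC.σB_mkB hπ hq _ _)

theorem InvStable.sum_EB_iota_mul_left (x y : D.Idx) :
    ∑ z, hC.EB z y * hC.σB hπ hq y.1 (hC.EB (hC.iota z) (hC.iota x)) =
      if x = y then 1 else 0 := by
  have h := congrArg hC.mkB ((hC.twistU hπ hq).sum_E_iota_mul_left hπ hq x y)
  have h1 : hC.mkB ((hC.twistU hπ hq).convLeft hπ hq (D.E x y)) = if x = y then 1 else 0 :=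
    (congrArg hC.mkB ((hC.twistU hπ hq).convLeft_E hπ hq x y)).trans
      (RingQuot.mkAlgHom_rel k (BRel.left x y) |>.trans (by split_ifs <;> simp))
  refine Eq.trans ?_ (h.trans h1)
  rw [map_sum hC.mkB]
  refine Finset.sum_congr rfl fun z _ => ?_
  rw [map_mul hC.mkB]
  exact congrArg (hC.EB z y * ·) (hC.σB_mkB hπ hq _ _)

/-- The braided Hopf algebra `B_{𝒞,π}` as a twist of `H_{𝒞,π}`. -/
def InvStable.twistB : Twist (hC.modelH hπ hq) hC.B where
  toCovariant := hC.covariantB hπ hq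
  ψ := (hC.modelH hπ hq).liftB hπ hq (hC.isAntipode_modelH hπ hq)
  ψ_E := (hC.modelH hπ hq).liftB_mkB hπ hq (hC.isAntipode_modelH hπ hq)
  χ := (hC.covariantB hπ hq).liftH (hC.sum_EB_iota_mul_right hπ hq)
    (hC.sum_EB_iota_mul_left hπ hq) hC.isURel_EB
  χ_e := (hC.covariantB hπ hq).liftH_tH _ _ _

end Block
end QDouble
end

/-! ### Naturality of the identifications, and the maps to `BD(G)` -/

noncomputable section

namespace QDouble

namespace Block

variable {k G : Type*} [Field k] [Group G] [Fintype G] [DecidableEq G] {D : Block k G}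

namespace Twist

variable {hC : D.InvStable} {A A' : Type*} [Ring A] [Algebra k A] [Ring A'] [Algebra k A']
  {M : FRTModel hC A} {M' : FRTModel hC A'} {U U' : Type*} [Ring U] [Algebra k U] [Ring U']
  [Algebra k U'] (T : Twist M U) (T' : Twist M' U') {f : A →ₐ[k] A'} {f' : U →ₐ[k] U'}
  (hπ : D.IsOrthogonal) (hq : hC.Compatible) (hf : ∀ x y, f (M.e x y) = M'.e x y)
  (hf' : ∀ x y, f' (T.E x y) = T'.E x y)
include hπ hq hf hf'

/-- Both composites turn the product of `U` into the transmuted product of `A'`, so agreement on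
generators suffices. The projection `U → B` thereby inherits all its compatibilities from `A → H`.
-/
theorem equiv_map (u : U) : T'.equiv hπ hq (f' u) = f (T.equiv hπ hq u) := by
  simp only [equiv_apply]
  have h1 := (FRTModel.isBraidedMap_map hπ hq hf).map_mul
  simp only [AlgHom.toLinearMap_apply] at h1
  induction u using T.induction with
  | one => rw [map_one, toFun_one, toFun_one, map_one]
  | gen x y => rw [hf', T'.toFun_E hπ hq, T.toFun_E hπ hq, hf]
  | mul a b ha hb => rw [map_mul, T'.toFun_mul hπ hq, T.toFun_mul hπ hq, ha, hb, h1]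
  | add a b ha hb => simp only [map_add, ha, hb]
  | smul c a ha => simp only [map_smul, ha]

theorem map_eq : f'.toLinearMap =
    (T'.equiv hπ hq).symm.toLinearMap ∘ₗ f.toLinearMap ∘ₗ (T.equiv hπ hq).toLinearMap := by
  refine LinearMap.ext fun u => (T'.equiv hπ hq).injective ?_
  simp [T.equiv_map T' hπ hq hf hf']

theorem isBraidedMap_map :
    IsBraidedMap (T.braided hπ hq) (T'.braided hπ hq) f'.toLinearMap := by
  rw [T.map_eq T' hπ hq hf hf']
  exact (T'.isBraidedMap_equiv hπ hq).symm.comp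
    ((FRTModel.isBraidedMap_map hπ hq hf).comp (T.isBraidedMap_equiv hπ hq))

theorem map_antipode (u : U) :
    T'.antipode hπ hq (f' u) = f' (T.antipode hπ hq u) := by
  apply (T'.equiv hπ hq).injective
  rw [T'.equiv_antipode, T.equiv_map T' hπ hq hf hf', T.equiv_map T' hπ hq hf hf',
    T.equiv_antipode, FRTModel.map_brS hπ hq hf]

omit hf hf'

/-- The map to `BD(G)`. -/
def toBD : U →ₗ[k] DV k G := M.φ.toLinearMap ∘ₗ (T.equiv hπ hq).toLinearMap

theorem isBraidedMap_toBD : IsBraidedMap (T.braided hπ hq) (BD k G) (T.toBD hπ hq) :=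
  (M.isBraidedMap_φ hπ hq).comp (T.isBraidedMap_equiv hπ hq)

theorem toBD_E (x y : D.Idx) : T.toBD hπ hq (T.E x y) = D.rGen x y := by
  rw [rGen_eq]
  exact (congrArg M.φ (T.equiv_E hπ hq x y)).trans (M.φ_e x y)

include hf hf' in
theorem toBD_map (u : U) : T'.toBD hπ hq (f' u) = T.toBD hπ hq u :=
  (congrArg M'.φ (T.equiv_map T' hπ hq hf hf' u)).trans
    (DFunLike.congr_fun (FRTModel.map_φ hf) (T.equiv hπ hq u))

end Twist

end Block
end QDouble
end

theorem mainTheorem1 {k G : Type*} [Field k] [Group G] [Fintype G] [DecidableEq G]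
    (D : Block k G) (hC : D.InvStable) (hπ : D.IsOrthogonal) (hq : hC.Compatible) :
    -- the braided bialgebra `U(𝓛)`, its map to `BD(G)`, and the braided anti-algebra map on it
    ∃ (XU : BraidedData k G D.U) (φU : D.U →ₗ[k] DV k G) (SU : D.U →ₗ[k] D.U),
      D.IsMatrixBraided D.E XU ∧
      IsBraidedMap XU (BD k G) φU ∧ (∀ x y, φU (D.E x y) = D.rGen x y) ∧
      IsBraidedAntiAlgMap XU SU ∧ (∀ x y, SU (D.E x y) = hC.brAntipodeGen D.E x y) ∧
      (∀ S : D.U →ₗ[k] D.U, IsBraidedAntiAlgMap XU S →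
        (∀ x y, S (D.E x y) = hC.brAntipodeGen D.E x y) → S = SU) ∧
    -- the braided Hopf algebra `B`, a quotient of `U(𝓛)` through which the map to `BD(G)` factors
    ∃ (XB : BraidedData k G hC.B) (φB : hC.B →ₗ[k] DV k G) (SB : hC.B →ₗ[k] hC.B),
      D.IsMatrixBraided (fun x y => hC.mkB (D.E x y)) XB ∧
      IsBraidedMap XU XB hC.mkB.toLinearMap ∧
      IsBraidedAntipode XB SB ∧ Function.Bijective SB ∧
      (∀ u, SB (hC.mkB u) = hC.mkB (SU u)) ∧
      IsBraidedMap XB (BD k G) φB ∧ (∀ u, φB (hC.mkB u) = φU u) ∧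
    -- the coquasitriangular bialgebra `A` and its map to `D^∨(G)`
    ∃ (XA : CoquasiData k D.A) (φA : D.A →ₐ[k] DV k G),
      D.IsMatrixCoquasi D.t XA ∧
      IsCoquasiMap XA (DVdata k G) φA ∧ (∀ x y, φA (D.t x y) = D.rGen x y) ∧
    -- the coquasitriangular Hopf algebra `H`, a quotient of `A` through which that map factors
    ∃ (XH : CoquasiData k hC.H) (φH : hC.H →ₐ[k] DV k G) (SH : hC.H →ₗ[k] hC.H),
      D.IsMatrixCoquasi (fun x y => hC.mkH (D.t x y)) XH ∧
      IsCoquasiMap XA XH hC.mkH ∧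
      IsAntipode XH SH ∧
      (∀ x y, SH (hC.mkH (D.t x y)) = hC.mkH (hC.antipodeGen D.t x y)) ∧
      IsCoquasiMap XH (DVdata k G) φH ∧ φH.comp hC.mkH = φA ∧
    -- `B` is the comodule transmutation of `H`
    ∃ Φ : hC.B ≃ₗ[k] hC.H,
      IsBraidedMap XB (transmutation XH SH φH) Φ.toLinearMap ∧
      (∀ x y, Φ (hC.mkB (D.E x y)) = hC.mkH (D.t x y)) := by
  have hf : ∀ x y, hC.mkH ((hC.modelA hπ hq).e x y) = (hC.modelH hπ hq).e x y := fun _ _ => rfl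
  have hf' : ∀ x y, hC.mkB ((hC.twistU hπ hq).E x y) = (hC.twistB hπ hq).E x y := fun _ _ => rfl
  have hS := hC.isAntipode_modelH hπ hq
  refine ⟨(hC.twistU hπ hq).braided hπ hq, (hC.twistU hπ hq).toBD hπ hq,
    (hC.twistU hπ hq).antipode hπ hq, (hC.twistU hπ hq).isMatrixBraided hπ hq,
    (hC.twistU hπ hq).isBraidedMap_toBD hπ hq, (hC.twistU hπ hq).toBD_E hπ hq,
    (hC.twistU hπ hq).isBraidedAntiAlgMap hπ hq, (hC.twistU hπ hq).antipode_E hπ hq,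
    (hC.twistU hπ hq).antipode_unique hπ hq, ?_⟩
  refine ⟨(hC.twistB hπ hq).braided hπ hq, (hC.twistB hπ hq).toBD hπ hq,
    (hC.twistB hπ hq).antipode hπ hq, (hC.twistB hπ hq).isMatrixBraided hπ hq,
    Block.Twist.isBraidedMap_map _ _ hπ hq hf hf',
    (hC.twistB hπ hq).isBraidedAntipode hπ hq hS, (hC.twistB hπ hq).antipode_bijective hπ hq,
    Block.Twist.map_antipode _ _ hπ hq hf hf',
    (hC.twistB hπ hq).isBraidedMap_toBD hπ hq, Block.Twist.toBD_map _ _ hπ hq hf hf', ?_⟩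
  refine ⟨(hC.modelA hπ hq).coquasi, (hC.modelA hπ hq).φ, (hC.modelA hπ hq).isMatrixCoquasi hπ hq,
    (hC.modelA hπ hq).isCoquasiMap,
    fun x y => ((hC.modelA hπ hq).φ_e x y).trans (D.rGen_eq x y).symm, ?_⟩
  refine ⟨(hC.modelH hπ hq).coquasi, (hC.modelH hπ hq).φ, (hC.modelH hπ hq).S,
    (hC.modelH hπ hq).isMatrixCoquasi hπ hq, Block.FRTModel.isCoquasiMap_map hf, hS,
    (hC.modelH hπ hq).S_e, (hC.modelH hπ hq).isCoquasiMap, Block.FRTModel.map_φ hf, ?_⟩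
  exact ⟨(hC.twistB hπ hq).equiv hπ hq, (hC.twistB hπ hq).isBraidedMap_equiv hπ hq,
    (hC.twistB hπ hq).equiv_E hπ hq⟩
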